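/- **Setting.** Let $\mu>0$, $T>0$, $J_T=[0,T]$, and $\mathcal B(u)=u\,\partial_xu$. Let $C_b^\infty$ be the space of infinitely differentiable functions $\mathbb R\to\mathbb R$ that are bounded together with all their derivatives. For an integer $s\ge0$ let $H^s_{\rm ul}$ be the space of functions with $\|f\|_{H^s_{\rm ul}}=\sup_{y\in\mathbb R}\|f\|_{H^s([y,y+1])}<\infty$, and let $L^2_{\rm ul}=H^0_{\rm ul}$. Fix $h$ with $h\in L^2(J_T,H^s_{\rm ul})$ for every $s\ge0$, and fix $u_0,\hat u\in C_b^\infty$. For a finite-dimensional subspace $E\subset C_b^\infty$ consider the equations $$\partial_tu-\mu\,\partial_x^2u+\mathcal B(u)=h+\eta,\qquad(2.2)$$ $$\partial_tu-\mu\,\partial_x^2(u+\zeta)+\mathcal B(u+\zeta)=h+\eta,\qquad(2.3)$$ on $(0,T)\times\mathbb R$ with $u(0,\cdot)=u_0$ and controls $\eta,\zeta\in C^\infty(J_T,E)$. A solution is a function $u$ which lies in $L^\infty(J_T\times\mathbb R)$ and in $L^p(J_T,H^1_{\rm ul})$ for all $p\in[1,\frac43)$, satisfies $\sup_{y}\int_0^T\!\int_y^{y+1}|\partial_xu|^2\,dx\,dt<\infty$,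 is bounded and continuous from $(0,T]$ to $L^2_{\rm ul}$, converges to $u_0$ in $L^2_{\rm loc}$ as $t\to0^+$, and satisfies the equation in the sense of distributions. For $\varepsilon,r,K>0$, Eq. (2.2) is called *$(\varepsilon,r,E)$-controllable with constant $K$* if there is $\eta\in C^\infty(J_T,E)$ such that the solution $u$ of (2.2) with $u(0,\cdot)=u_0$ satisfies $$\|u(T)\|_{L^2_{\rm ul}}+\|u(T)\|_{L^\infty(\mathbb R)}\le K,\qquad \|u(T)-\hat u\|_{L^2([-r,r])}<\varepsilon .$$ The definition for Eq. (2.3) is the same, with two controls $\eta,\zeta\in C^\infty(J_T,E)$. For given $\varepsilon,r$, an equation is called *$E$-controllable* if it is $(\varepsilon,r,E)$-controllable with some constant $K>0$; it is called *uniformly $E$-controllable* if there is one $K>0$ such that it is $(\varepsilon,r,E)$-controllable with constant $K$ for all $\varepsilon,r>0$. **Statement.** Let $G\subset C_b^\infty$ be a finite-dimensional subspace and let $N\subset G$ be a non-empty set that is invariant under multiplication by real numbers and satisfies $\mathcal B(N)\subset G$. Let $\mathcal F(N,G)$ be the linear span of all functions $\eta+\xi\,\partial_x\tilde\xi+\tilde\xi\,\partial_x\xi$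 with $\eta,\xi\in G$ and $\tilde\xi\in N$. Then: 1. For all $\varepsilon,r>0$, Eq. (2.3) is $G$-controllable if and only if Eq. (2.2) is $\mathcal F(N,G)$-controllable. 2. For all $\varepsilon,r>0$, Eq. (2.2) is $G$-controllable if and only if Eq. (2.2) is $\mathcal F(N,G)$-controllable. 3. The equivalences in 1 and 2 also hold with "controllable" replaced by "uniformly controllable". 4. The constants can be taken arbitrarily close to each other: for all $\varepsilon,r>0$ and $0<K<K'$, if one of the two properties in 1 holds with constant $K$, then the other holds with constant $K'$; likewise for 2. -/

import Mathlib

open MeasureTheory Filter Topology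
open scoped ContDiff ENNReal

/-- `f ∈ C_b^∞(ℝ)`: infinitely differentiable, bounded together with all derivatives. -/
def IsCbInf (f : ℝ → ℝ) : Prop :=
  ContDiff ℝ ((⊤ : ℕ∞) : WithTop ℕ∞) f ∧
    ∀ k : ℕ, ∃ C : ℝ, ∀ x : ℝ, |iteratedDeriv k f x| ≤ C

/-- `g` is the `k`-th weak (distributional) derivative of `f` on `ℝ`.
For `k = 0` this means that `f` is locally integrable and `g = f` almost everywhere. -/
def HasWeakDeriv (k : ℕ) (f g : ℝ → ℝ) : Prop :=
  LocallyIntegrable f volume ∧ LocallyIntegrable g volume ∧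
    ∀ φ : ℝ → ℝ, ContDiff ℝ ((⊤ : ℕ∞) : WithTop ℕ∞) φ → HasCompactSupport φ →
      ∫ x, f x * iteratedDeriv k φ x = (-1) ^ k * ∫ x, g x * φ x

/-- The norm of `H^s_ul(ℝ)`, i.e. `sup_y (∑_{k ≤ s} ‖∂_x^k f‖²_{L²([y,y+1])})^{1/2}`, with values in
`[0,∞]`. Weak derivatives are unique up to null sets, so the infimum is over one value when all
weak derivatives of order `≤ s` exist, and it is `∞` otherwise. Thus `f ∈ H^s_ul` if and only if
this quantity is finite. For `s = 0` this is the norm of `L²_ul`. -/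
noncomputable def hulNorm (s : ℕ) (f : ℝ → ℝ) : ℝ≥0∞ :=
  ⨅ (g : ℕ → ℝ → ℝ) (_ : ∀ k ≤ s, HasWeakDeriv k f (g k)),
    ⨆ y : ℝ, (∑ k ∈ Finset.range (s + 1),
      ∫⁻ x in Set.Icc y (y + 1), ‖g k x‖ₑ ^ 2) ^ (1 / 2 : ℝ)

/-- The closed space-time slab `[0,T] × ℝ`; points are `(t, x)`. -/
def slab (T : ℝ) : Set (ℝ × ℝ) := Set.Icc 0 T ×ˢ Set.univ

/-- `f ∈ L^p([0,T], H^s_ul)`: the function `f` of `(t, x)` is measurable on the slab, and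
`t ↦ ‖f(t,·)‖_{H^s_ul}` is in `L^p(0,T)` (expressed by an `L^p` majorant). -/
def MemLpHul (p : ℝ≥0∞) (s : ℕ) (T : ℝ) (f : ℝ → ℝ → ℝ) : Prop :=
  AEStronglyMeasurable (fun z : ℝ × ℝ => f z.1 z.2) (volume.restrict (slab T)) ∧
    ∃ m : ℝ → ℝ, MemLp m p (volume.restrict (Set.Icc 0 T)) ∧
      ∀ᵐ t ∂(volume.restrict (Set.Icc 0 T)), hulNorm s (f t) ≤ ENNReal.ofReal (m t)

/-- Test functions on the open slab `(0,T) × ℝ`. -/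
def IsTestFunction (T : ℝ) (φ : ℝ × ℝ → ℝ) : Prop :=
  ContDiff ℝ ((⊤ : ℕ∞) : WithTop ℕ∞) φ ∧ HasCompactSupport φ ∧
    tsupport φ ⊆ Set.Ioo 0 T ×ˢ Set.univ

/-- `v` is the weak derivative `∂_x u` on the slab, and
`sup_y ∫_0^T ∫_y^{y+1} |∂_x u|² dx dt < ∞`, that is, `‖∂_x u(·,x)‖_{L²(0,T)} ∈ L²_ul`. -/
def HasSquareIntegrableWeakDerivX (T : ℝ) (u v : ℝ → ℝ → ℝ) : Prop :=
  AEStronglyMeasurable (fun z : ℝ × ℝ => v z.1 z.2) (volume.restrict (slab T)) ∧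
    (⨆ y : ℝ, ∫⁻ z in Set.Icc 0 T ×ˢ Set.Icc y (y + 1), ‖v z.1 z.2‖ₑ ^ 2) < ⊤ ∧
    ∀ φ : ℝ × ℝ → ℝ, IsTestFunction T φ →
      ∫ z in slab T, u z.1 z.2 * deriv (fun x => φ (z.1, x)) z.2 =
        - ∫ z in slab T, v z.1 z.2 * φ z

/-- `u ∈ C_*([0,T], L²_ul)` with limit `u₀` as `t → 0+`: bounded and continuous on `(0,T]` with
values in `L²_ul`, and `u(t) → u₀` in `L²_loc` as `t → 0+`. -/
def MemCStarWithInitial (T : ℝ) (u₀ : ℝ → ℝ) (u : ℝ → ℝ → ℝ) : Prop :=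
  (∃ C : ℝ, ∀ t ∈ Set.Ioc 0 T, hulNorm 0 (u t) ≤ ENNReal.ofReal C) ∧
  (∀ t₀ ∈ Set.Ioc 0 T,
    Tendsto (fun t => hulNorm 0 (fun x => u t x - u t₀ x)) (𝓝[Set.Ioc 0 T] t₀) (𝓝 0)) ∧
  (∀ R : ℝ, 0 < R →
    Tendsto (fun t => eLpNorm (fun x => u t x - u₀ x) 2 (volume.restrict (Set.Icc (-R) R)))
      (𝓝[>] 0) (𝓝 0))

/-- `u` is a solution on `[0,T]` of the Cauchy problem
`∂_t u - μ ∂_x²(u + g) + (u + g) ∂_x(u + g) = f`, `u(0,·) = u₀`, in the class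
`L^∞([0,T]×ℝ) ∩ C_*([0,T], L²_ul) ∩ L^p([0,T], H^1_ul)` for all `p ∈ [1, 4/3)`, with
`‖∂_x u(·,x)‖_{L²(0,T)} ∈ L²_ul`. The equation holds in the sense of distributions
on `(0,T) × ℝ`; `v` is the weak derivative `∂_x u`. -/
def IsBurgersSolution (μ T : ℝ) (f g : ℝ → ℝ → ℝ) (u₀ : ℝ → ℝ) (u : ℝ → ℝ → ℝ) : Prop :=
  MemLp (fun z : ℝ × ℝ => u z.1 z.2) ⊤ (volume.restrict (slab T)) ∧
  MemCStarWithInitial T u₀ u ∧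
  (∀ p : ℝ, 1 ≤ p → p < 4 / 3 → MemLpHul (ENNReal.ofReal p) 1 T u) ∧
  ∃ v : ℝ → ℝ → ℝ, HasSquareIntegrableWeakDerivX T u v ∧
    ∀ φ : ℝ × ℝ → ℝ, IsTestFunction T φ →
      ∫ z in slab T,
        (- u z.1 z.2 * deriv (fun t => φ (t, z.2)) z.1
          - μ * (u z.1 z.2 + g z.1 z.2) * iteratedDeriv 2 (fun x => φ (z.1, x)) z.2
          + (u z.1 z.2 + g z.1 z.2) * (v z.1 z.2 + deriv (g z.1) z.2) * φ z) =
      ∫ z in slab T, f z.1 z.2 * φ z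

/-- `η ∈ C^∞([0,T], G)` for a finite-dimensional space `G` of functions: `η` is a finite
combination of elements of `G` with coefficients that are smooth functions of `t ∈ [0,T]`. -/
def IsSmoothControl (T : ℝ) (G : Submodule ℝ (ℝ → ℝ)) (η : ℝ → ℝ → ℝ) : Prop :=
  ∃ (n : ℕ) (e : Fin n → ℝ → ℝ) (c : Fin n → ℝ → ℝ),
    (∀ i, e i ∈ G) ∧
    (∀ i, ContDiffOn ℝ ((⊤ : ℕ∞) : WithTop ℕ∞) (c i) (Set.Icc 0 T)) ∧
    ∀ t ∈ Set.Icc 0 T, ∀ x : ℝ, η t x = ∑ i, c i t * e i x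

/-- The nonlinearity `B(u) = u ∂_x u`. -/
noncomputable def burgersB (u : ℝ → ℝ) : ℝ → ℝ := fun x => u x * deriv u x

/-- `F(N,G)`: the linear span of the functions `η + ξ ∂_x ξ' + ξ' ∂_x ξ` with `η, ξ ∈ G` and
`ξ' ∈ N`. -/
noncomputable def extendedSpace (N : Set (ℝ → ℝ)) (G : Submodule ℝ (ℝ → ℝ)) :
    Submodule ℝ (ℝ → ℝ) :=
  Submodule.span ℝ {w | ∃ η ∈ G, ∃ ξ ∈ G, ∃ ξ' ∈ N,
    w = fun x => η x + ξ x * deriv ξ' x + ξ' x * deriv ξ x}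

/-- The terminal inequalities `‖w‖_{L²_ul} + ‖w‖_{L^∞} ≤ K` and `‖w - û‖_{L²([-r,r])} < ε`. -/
def ReachesTarget (uhat : ℝ → ℝ) (ε r K : ℝ) (w : ℝ → ℝ) : Prop :=
  hulNorm 0 w + eLpNorm w ⊤ volume ≤ ENNReal.ofReal K ∧
    eLpNorm (fun x => w x - uhat x) 2 (volume.restrict (Set.Icc (-r) r)) < ENNReal.ofReal ε

/-- The equation `∂_t u - μ ∂_x² u + B(u) = h + η` is `(ε,r,G)`-controllable at time `T` for the
pair `(u₀, û)`, with bound constant `K`. -/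
def BurgersControllable (μ T : ℝ) (h : ℝ → ℝ → ℝ) (u₀ uhat : ℝ → ℝ)
    (G : Submodule ℝ (ℝ → ℝ)) (ε r K : ℝ) : Prop :=
  ∃ η : ℝ → ℝ → ℝ, IsSmoothControl T G η ∧
    ∃ u : ℝ → ℝ → ℝ,
      IsBurgersSolution μ T (fun t x => h t x + η t x) (fun _ _ => 0) u₀ u ∧
      ReachesTarget uhat ε r K (u T)

/-- The extended equation `∂_t u - μ ∂_x²(u + ζ) + B(u + ζ) = h + η` is `(ε,r,G)`-controllable at
time `T` for the pair `(u₀, û)`, with bound constant `K`. -/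
def ExtendedControllable (μ T : ℝ) (h : ℝ → ℝ → ℝ) (u₀ uhat : ℝ → ℝ)
    (G : Submodule ℝ (ℝ → ℝ)) (ε r K : ℝ) : Prop :=
  ∃ η ζ : ℝ → ℝ → ℝ, IsSmoothControl T G η ∧ IsSmoothControl T G ζ ∧
    ∃ u : ℝ → ℝ → ℝ,
      IsBurgersSolution μ T (fun t x => h t x + η t x) ζ u₀ u ∧
      ReachesTarget uhat ε r K (u T)

/-! The inclusion of `G` in `extendedSpace N G` and the choice ζ = 0 give the easy implications.
What remains is to remove, at the price of an arbitrarily small error at time `T`, an extended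
control ζ and a control with values in the larger space. The error is small uniformly in x, so it
only enlarges `K` to any `K'` above it and leaves the strict inequality with ε intact.

Everything rests on one stability result, `exists_perturbed_solution`. Let u solve the equation with
force f and extended control g. If f is changed by ∂_x b and g is replaced by k, the difference w of
the solutions satisfies ∂_t w − μ∂_x²w = ∂_x[b + μ∂_x(k − g) − ((u+w+k)² − (u+g)²)/2] with w(0) = 0.
With w = e^{λt}v this becomes a quadratic equation v = κ ∗ (A − Bv − Dv²), where κ is the damped
x-derivative of the heat kernel, an integrable function whose mass tends to 0 as λ grows. Hence one
contraction covers the whole of [0,T], and w is uniformly small as soon as κ ∗ A is, even when A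
itself is large. That v also has the derivatives demanded of a solution follows from difference
quotients: they obey a linear convolution inequality, which a convergent series of convolution
powers resolves (`deriv_of_kconv_eq`).

There are two sources of smallness of κ ∗ A. It is small when A is bounded and small in L¹ of strips
(`exists_abs_kconv_le`), and when A is a time-continuous amplitude multiplied by a fast oscillation
(`exists_abs_kconv_oscillation_le`).

The first one removes ζ. Multiply ζ by a time cutoff χ that is close to 1 in L¹ and vanishes at 0
and `T`; the solution changes little, and u + χζ solves the equation without extended control and
with the extra force ∂_t(χζ), which takes values in `G`. Initial and final values are unaffected by
χζ.

The second one creates the nonlinearity. For ζ' = √2 sin(rt) ζ the terms linear in ζ' average out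
and (ζ')²/2 averages to ζ²/2, so u persists approximately if ζ∂_xζ is added to the force
(`IsBurgersSolution.exists_oscillating`). Take ζ = ξ'/r − r c(t) ξ with ξ' in `N`. Then ζ∂_xζ =
r⁻²B(ξ') − c(ξ∂_xξ' + ξ'∂_xξ) + r²c²B(ξ): the first term is a control in `G`, the second cancels a
generator of the extended space, and the third is negligible for small r. Removing the oscillating
extended control by the cutoff ends the treatment of one generator. Generators are then replaced one
at a time, the others being regarded as part of the given force. -/

/-! ### Primitives of locally integrable functions -/

/-- `F` is a primitive of the locally integrable function `v`. -/
structure IsPrimitive (F v : ℝ → ℝ) : Prop where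
  locInt : LocallyIntegrable v volume
  sub_eq : ∀ a b : ℝ, F b - F a = ∫ x in a..b, v x

namespace IsPrimitive

variable {F G v w : ℝ → ℝ}

theorem intervalIntegrable (hF : IsPrimitive F v) (a b : ℝ) : IntervalIntegrable v volume a b :=
  intervalIntegrable_iff.2 ((LocallyIntegrable.integrableOn_isCompact hF.locInt isCompact_uIcc).mono_set
    Set.uIoc_subset_uIcc)

theorem eq_add (hF : IsPrimitive F v) (a : ℝ) : F = fun x => F a + ∫ y in a..x, v y := by
  funext x; rw [← hF.sub_eq a x]; ring

theorem continuous (hF : IsPrimitive F v) : Continuous F := by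
  rw [hF.eq_add 0]
  exact continuous_const.add (intervalIntegral.continuous_primitive hF.intervalIntegrable 0)

theorem absolutelyContinuous (hF : IsPrimitive F v) (a b : ℝ) :
    AbsolutelyContinuousOnInterval F a b := by
  have h := (hF.intervalIntegrable a b).absolutelyContinuousOnInterval_intervalIntegral
    (c := a) (by simp)
  have h2 : AbsolutelyContinuousOnInterval (fun _ : ℝ => F a) a b :=
    (LipschitzWith.const (F a)).lipschitzOnWith.absolutelyContinuousOnInterval
  rw [hF.eq_add a]
  exact h2.add h

theorem ae_hasDerivAt (hF : IsPrimitive F v) : ∀ᵐ x, HasDerivAt F (v x) x := by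
  filter_upwards [LocallyIntegrable.ae_hasDerivAt_integral hF.locInt] with x hx
  rw [hF.eq_add 0]
  exact (hx 0).const_add _

/-- An absolutely continuous function is the integral of its almost everywhere derivative, so it is
enough to identify that derivative off a null set. This gives the product rule below. -/
theorem of_absolutelyContinuous (h : ∀ a b, AbsolutelyContinuousOnInterval F a b)
    (hv : ∀ᵐ x, HasDerivAt F (v x) x) (hli : LocallyIntegrable v volume) :
    IsPrimitive F v := by
  refine ⟨hli, fun a b => ?_⟩
  rw [← (h a b).integral_deriv_eq_sub]
  apply intervalIntegral.integral_congr_ae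
  filter_upwards [hv] with x hx _ using hx.deriv

theorem add (hF : IsPrimitive F v) (hG : IsPrimitive G w) :
    IsPrimitive (fun x => F x + G x) (fun x => v x + w x) := by
  refine ⟨hF.locInt.add hG.locInt, fun a b => ?_⟩
  rw [intervalIntegral.integral_add (hF.intervalIntegrable a b) (hG.intervalIntegrable a b),
    ← hF.sub_eq, ← hG.sub_eq]
  ring

theorem const_mul (c : ℝ) (hF : IsPrimitive F v) :
    IsPrimitive (fun x => c * F x) (fun x => c * v x) := by
  refine ⟨hF.locInt.smul c, fun a b => ?_⟩
  rw [intervalIntegral.integral_const_mul, ← hF.sub_eq]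
  ring

theorem locallyIntegrable_mul (hF : IsPrimitive F v) (hG : Continuous G) :
    LocallyIntegrable (fun x => v x * G x) volume := by
  have : LocallyIntegrable (fun x => G x * v x) volume := by
    rw [locallyIntegrable_iff]
    intro k hk
    exact (hF.locInt.integrableOn_isCompact hk).continuousOn_mul hG.continuousOn hk
  simpa [mul_comm] using this

theorem mul (hF : IsPrimitive F v) (hG : IsPrimitive G w) :
    IsPrimitive (fun x => F x * G x) (fun x => v x * G x + F x * w x) := by
  apply of_absolutelyContinuous
  · intro a b
    exact (hF.absolutelyContinuous a b).mul (hG.absolutelyContinuous a b)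
  · filter_upwards [hF.ae_hasDerivAt, hG.ae_hasDerivAt] with x h1 h2
    exact h1.mul h2
  · refine (hF.locallyIntegrable_mul hG.continuous).add ?_
    simpa [mul_comm] using hG.locallyIntegrable_mul hF.continuous

theorem of_hasDerivAt (h : ∀ x, HasDerivAt F (v x) x) (hv : Continuous v) : IsPrimitive F v :=
  ⟨hv.locallyIntegrable, fun a b =>
    (intervalIntegral.integral_eq_sub_of_hasDerivAt (fun x _ => h x)
      (hv.intervalIntegrable a b)).symm⟩

theorem integral_mul_deriv {φ φ' : ℝ → ℝ} (hF : IsPrimitive F v)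
    (hφ : ∀ x, HasDerivAt φ (φ' x) x) (hφ' : Continuous φ') (hc : HasCompactSupport φ) :
    ∫ x, F x * φ' x = - ∫ x, v x * φ x := by
  have hP := hF.mul (of_hasDerivAt hφ hφ')
  have hφc : Continuous φ := (of_hasDerivAt hφ hφ').continuous
  have hφ'eq : φ' = deriv φ := by funext x; exact (hφ x).deriv.symm
  have hc' : HasCompactSupport φ' := hφ'eq ▸ hc.deriv
  have i1 : Integrable (fun x => v x * φ x) volume := by
    have := (hF.locallyIntegrable_mul hφc).integrableOn_isCompact hc.isCompact
    refine (integrableOn_iff_integrable_of_support_subset ?_).1 this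
    intro x hx
    exact subset_tsupport φ (right_ne_zero_of_mul hx)
  have i2 : Integrable (fun x => F x * φ' x) volume :=
    (hF.continuous.mul hφ').integrable_of_hasCompactSupport hc'.mul_left
  rw [eq_neg_iff_add_eq_zero, ← integral_add i2 i1]
  -- The radius `R` may be negative; the points ±(|R|+1) lie strictly outside the support in any
  -- case, so the boundary terms vanish there.
  obtain ⟨R, hR⟩ := hc.isCompact.isBounded.subset_closedBall 0
  have hR1 : ∀ x, R < |x| → φ x = 0 := by
    intro x hx
    by_contra hne
    have := hR (subset_tsupport φ hne)
    simp [Real.norm_eq_abs] at this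
    linarith
  have hsupp : Function.support (fun x => F x * φ' x + v x * φ x) ⊆
      Set.Ioc (-(|R| + 1)) (|R| + 1) := by
    intro x hx
    by_contra hne
    have hx1 : |R| < |x| := by
      by_contra hle
      push Not at hle
      have := abs_le.1 hle
      exact hne ⟨by linarith, by linarith⟩
    apply hx
    have e1 : φ x = 0 := hR1 x (lt_of_le_of_lt (le_abs_self R) hx1)
    have e2 : φ' x = 0 := by
      by_contra hne2
      have hm : x ∈ tsupport φ := by
        have : x ∈ tsupport φ' := subset_tsupport φ' hne2
        rw [hφ'eq] at this
        exact (tsupport_deriv_subset ) this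
      have := hR hm
      simp [Real.norm_eq_abs] at this
      linarith [le_abs_self R]
    simp [e1, e2]
  rw [← intervalIntegral.integral_eq_integral_of_support_subset hsupp]
  have := hP.sub_eq (-(|R| + 1)) (|R| + 1)
  have z1 : φ (|R| + 1) = 0 := hR1 _ (by
    rw [abs_of_nonneg (by positivity)]; linarith [le_abs_self R])
  have z2 : φ (-(|R| + 1)) = 0 := hR1 _ (by
    rw [abs_neg, abs_of_nonneg (by positivity)]; linarith [le_abs_self R])
  simp only [z1, z2, mul_zero, sub_zero] at this
  rw [this]
  congr 1; funext x; ring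

theorem hasWeakDeriv {f : ℝ → ℝ} (hF : IsPrimitive F v) (hf : f =ᵐ[volume] F) :
    HasWeakDeriv 1 f v := by
  refine ⟨hF.continuous.locallyIntegrable.congr hf.symm, hF.locInt, fun φ hφ hc => ?_⟩
  rw [iteratedDeriv_one]
  have : ∫ x, f x * deriv φ x = ∫ x, F x * deriv φ x := by
    apply integral_congr_ae
    filter_upwards [hf] with x hx
    rw [hx]
  rw [this, hF.integral_mul_deriv (fun x => (hφ.differentiable (by simp) x).hasDerivAt)
    (hφ.continuous_deriv (by simp)) hc]
  ring

/-- A continuous function whose difference quotients are bounded in `L²` of every unit interval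
is absolutely continuous. -/
theorem of_difference_quotients (hF : Continuous F) {m : ℝ}
    (h : ∀ n : ℕ, ∀ y : ℝ, ∫⁻ x in Set.Icc y (y + 1),
      ‖((n : ℝ) + 1) * (F (x + 1 / ((n : ℝ) + 1)) - F x)‖ₑ ^ 2 ≤ ENNReal.ofReal m) :
    IsPrimitive F (deriv F) := by
  set q : ℕ → ℝ → ℝ := fun n x => ((n : ℝ) + 1) * (F (x + 1 / ((n : ℝ) + 1)) - F x) with hq
  have hqc : ∀ n, Continuous (q n) := fun n => by simp only [hq]; fun_prop
  have hq2 : ∀ n, Continuous fun x => q n x ^ 2 := fun n => (hqc n).pow 2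
  -- `Fn n` is the mean of `F` over an interval of length 1/(n+1) to the right of x. It is C¹ with
  -- derivative the difference quotient `q n`, and converges pointwise to `F`; absolute continuity,
  -- uniform in n, passes to the limit.
  set P : ℝ → ℝ := fun x => ∫ y in (0:ℝ)..x, F y with hP
  have hPd : ∀ x, HasDerivAt P (F x) x := fun x =>
    intervalIntegral.integral_hasDerivAt_right (hF.intervalIntegrable _ _)
      (hF.stronglyMeasurableAtFilter _ _) hF.continuousAt
  set Fn : ℕ → ℝ → ℝ := fun n x => ((n : ℝ) + 1) * (P (x + 1 / ((n : ℝ) + 1)) - P x) with hFn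
  have hFnP : ∀ n, IsPrimitive (Fn n) (q n) := fun n => of_hasDerivAt (fun x =>
    (((hPd _).comp_add_const x (1 / ((n : ℝ) + 1))).sub (hPd x)).const_mul _) (hqc n)
  have hlim : ∀ x, Tendsto (fun n => Fn n x) atTop (𝓝 (F x)) := by
    intro x
    have h1 := (hasDerivAt_iff_tendsto_slope_zero.1 (hPd x))
    have h2 : Tendsto (fun n : ℕ => 1 / ((n : ℝ) + 1)) atTop (𝓝[≠] 0) := by
      refine tendsto_nhdsWithin_iff.2 ⟨tendsto_one_div_add_atTop_nhds_zero_nat, ?_⟩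
      filter_upwards with n
      simp only [Set.mem_compl_iff, Set.mem_singleton_iff]
      positivity
    refine (h1.comp h2).congr fun n => ?_
    simp [hFn]
  have hbound : ∀ a b : ℝ, ∃ C : ℝ, 0 ≤ C ∧ ∀ n, ∫ x in Set.uIoc a b, (q n x) ^ 2 ≤ C := by
    intro a b
    obtain ⟨k, hk⟩ := exists_nat_gt (max a b - min a b)
    refine ⟨(k * ENNReal.ofReal m).toReal, ENNReal.toReal_nonneg, fun n => ?_⟩
    rw [integral_eq_lintegral_of_nonneg_ae (ae_of_all _ fun x => sq_nonneg _)
      (hq2 n).aestronglyMeasurable]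
    refine ENNReal.toReal_mono (ENNReal.mul_ne_top (by simp) (by simp)) ?_
    have hsub : Set.uIoc a b ⊆ ⋃ j ∈ Finset.range k,
        Set.Icc (min a b + j) (min a b + j + 1) := by
      intro x hx
      simp only [Set.uIoc, Set.mem_Ioc] at hx
      simp only [Set.mem_iUnion, Finset.mem_range]
      have h0 : 0 ≤ x - min a b := by linarith
      have hlt : x - min a b < k := by linarith
      refine ⟨⌊x - min a b⌋₊, ?_, ?_, ?_⟩
      · exact (Nat.floor_lt h0).2 hlt
      · linarith [Nat.floor_le h0]
      · linarith [Nat.lt_floor_add_one (x - min a b)]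
    calc ∫⁻ x in Set.uIoc a b, ENNReal.ofReal (q n x ^ 2)
        = ∫⁻ x in Set.uIoc a b, ‖q n x‖ₑ ^ 2 := by
          refine lintegral_congr fun x => ?_
          rw [← enorm_pow, Real.enorm_eq_ofReal (sq_nonneg _)]
      _ ≤ ∫⁻ x in ⋃ j ∈ Finset.range k,
            Set.Icc (min a b + j) (min a b + j + 1), ‖q n x‖ₑ ^ 2 :=
          lintegral_mono_set hsub
      _ ≤ ∑ j ∈ Finset.range k, ∫⁻ x in Set.Icc (min a b + j) (min a b + j + 1),
            ‖q n x‖ₑ ^ 2 := by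
          generalize Finset.range k = s
          induction s using Finset.induction_on with
          | empty => simp
          | insert j s hj ih =>
            rw [Finset.set_biUnion_insert, Finset.sum_insert hj]
            exact (lintegral_union_le _ _ _).trans (add_le_add le_rfl ih)
      _ ≤ ∑ j ∈ Finset.range k, ENNReal.ofReal m := Finset.sum_le_sum fun j _ => h n _
      _ = k * ENNReal.ofReal m := by simp
  have hac : ∀ a b, AbsolutelyContinuousOnInterval F a b := by
    intro a b
    rw [absolutelyContinuousOnInterval_iff]
    intro ε hε
    obtain ⟨C, hC0, hC⟩ := hbound a b
    set η := ε / (2 * (C + 1)) with hη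
    have hη0 : 0 < η := by positivity
    -- Young's inequality |q| ≤ (η/2)q² + 1/(2η) bounds the total variation over the intervals by
    -- ηC/2 plus their length divided by 2η. The choices of η and of the length make each
    -- contribution at most ε/4.
    refine ⟨ε * η / 2, by positivity, fun E hE hlen => ?_⟩
    have key : ∀ n, ∑ i ∈ Finset.range E.1, dist (Fn n (E.2 i).1) (Fn n (E.2 i).2) ≤ ε / 2 := by
      intro n
      have hint : ∀ s : Set ℝ, s ⊆ Set.uIoc a b → ∀ g : ℝ → ℝ, Continuous g →
          IntegrableOn g s volume := fun s hs g hg =>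
        ((hg.integrableOn_uIcc (a := a) (b := b)).mono_set Set.uIoc_subset_uIcc).mono_set hs
      have hsubi : ∀ i ∈ Finset.range E.1, Set.uIoc (E.2 i).1 (E.2 i).2 ⊆ Set.uIoc a b :=
        fun i hi => AbsolutelyContinuousOnInterval.uIoc_subset_of_mem_disjWithin (I := E.2)
          (n := E.1) hE (Finset.mem_range.1 hi)
      have hstep : ∀ i ∈ Finset.range E.1, dist (Fn n (E.2 i).1) (Fn n (E.2 i).2) ≤
          η / 2 * (∫ x in Set.uIoc (E.2 i).1 (E.2 i).2, q n x ^ 2) +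
            1 / (2 * η) * dist (E.2 i).1 (E.2 i).2 := by
        intro i hi
        have hs := hsubi i hi
        rw [dist_comm, Real.dist_eq, (hFnP n).sub_eq]
        calc |∫ x in (E.2 i).1..(E.2 i).2, q n x|
            ≤ ∫ x in Set.uIoc (E.2 i).1 (E.2 i).2, |q n x| :=
              intervalIntegral.norm_integral_le_integral_norm_uIoc (f := q n)
          _ ≤ ∫ x in Set.uIoc (E.2 i).1 (E.2 i).2, (η / 2 * q n x ^ 2 + 1 / (2 * η)) := by
              refine setIntegral_mono (hint _ hs _ (hqc n).abs)
                (hint _ hs _ (by have := hqc n; fun_prop)) fun x => ?_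
              have : 0 ≤ (η * |q n x| - 1) ^ 2 / (2 * η) := by positivity
              have e : (η * |q n x| - 1) ^ 2 / (2 * η) =
                  η / 2 * q n x ^ 2 + 1 / (2 * η) - |q n x| := by
                rw [← sq_abs (q n x)]; field_simp; ring
              linarith
          _ = _ := by
              rw [integral_add ((hint _ hs _ (hq2 n)).const_mul _)
                (hint _ hs _ continuous_const), integral_const_mul]
              congr 1
              simp [Set.uIoc, Measure.real, Real.dist_eq, max_sub_min_eq_abs', mul_comm]
      refine (Finset.sum_le_sum hstep).trans ?_
      rw [Finset.sum_add_distrib, ← Finset.mul_sum, ← Finset.mul_sum,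
        ← integral_biUnion_finset (Finset.range E.1) (by simp [Set.uIoc]) hE.2
          (fun i hi => hint _ (hsubi i hi) _ (hq2 n))]
      have h1 : ∫ x in ⋃ i ∈ Finset.range E.1, Set.uIoc (E.2 i).1 (E.2 i).2, q n x ^ 2 ≤ C := by
        refine le_trans ?_ (hC n)
        refine setIntegral_mono_set (hint _ le_rfl _ (hq2 n))
          (ae_of_all _ fun x => sq_nonneg _) (ae_of_all _ ?_)
        exact Set.iUnion₂_subset hsubi
      have h2 : η / 2 * C ≤ ε / 4 := by
        rw [hη, div_div, div_mul_eq_mul_div, div_le_div_iff₀ (by positivity) (by norm_num)]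
        nlinarith
      have h3 : 1 / (2 * η) * (ε * η / 2) = ε / 4 := by field_simp; norm_num
      have h4 := mul_le_mul_of_nonneg_left h1 (by positivity : 0 ≤ η / 2)
      have h5 := mul_le_mul_of_nonneg_left hlen.le (by positivity : 0 ≤ 1 / (2 * η))
      linarith
    have hl : Tendsto (fun n => ∑ i ∈ Finset.range E.1,
        dist (Fn n (E.2 i).1) (Fn n (E.2 i).2)) atTop
        (𝓝 (∑ i ∈ Finset.range E.1, dist (F (E.2 i).1) (F (E.2 i).2))) :=
      tendsto_finsetSum _ fun i _ => (hlim _).dist (hlim _)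
    have := le_of_tendsto' hl key
    linarith
  refine ⟨?_, fun a b => (hac a b).integral_deriv_eq_sub.symm⟩
  rw [locallyIntegrable_iff]
  intro k hk
  obtain ⟨R, hR⟩ := hk.isBounded.subset_closedBall 0
  have := (intervalIntegrable_iff.1 ((hac (-|R| - 1) (|R|)).intervalIntegrable_deriv))
  refine this.mono_set fun x hx => ?_
  have := hR hx
  simp only [Metric.mem_closedBall, dist_zero_right, Real.norm_eq_abs] at this
  have h2 := abs_le.1 (this.trans (le_abs_self R))
  rw [Set.uIoc_of_le (by linarith [abs_nonneg R])]
  exact ⟨by linarith, h2.2⟩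

end IsPrimitive

/-! ### Partial derivatives of test functions -/

/-- The partial derivative in the first variable (time). -/
noncomputable def partialT (φ : ℝ × ℝ → ℝ) (z : ℝ × ℝ) : ℝ := fderiv ℝ φ z (1, 0)

/-- The partial derivative in the second variable (space). -/
noncomputable def partialX (φ : ℝ × ℝ → ℝ) (z : ℝ × ℝ) : ℝ := fderiv ℝ φ z (0, 1)

section PartialDerivatives

variable {φ : ℝ × ℝ → ℝ}

theorem hasDerivAt_partialX (hφ : Differentiable ℝ φ) (t x : ℝ) :
    HasDerivAt (fun x => φ (t, x)) (partialX φ (t, x)) x := by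
  have h1 : HasDerivAt (fun x : ℝ => (t, x)) ((0 : ℝ), (1 : ℝ)) x :=
    (hasDerivAt_const x t).prodMk (hasDerivAt_id x)
  exact (hφ (t, x)).hasFDerivAt.comp_hasDerivAt x h1

theorem hasDerivAt_partialT (hφ : Differentiable ℝ φ) (t x : ℝ) :
    HasDerivAt (fun t => φ (t, x)) (partialT φ (t, x)) t := by
  have h1 : HasDerivAt (fun t : ℝ => (t, x)) ((1 : ℝ), (0 : ℝ)) t :=
    (hasDerivAt_id t).prodMk (hasDerivAt_const t x)
  exact (hφ (t, x)).hasFDerivAt.comp_hasDerivAt t h1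

theorem contDiff_partialX (hφ : ContDiff ℝ ∞ φ) : ContDiff ℝ ∞ (partialX φ) :=
  (hφ.fderiv_right (m := ∞) (by simp)).clm_apply contDiff_const

theorem contDiff_partialT (hφ : ContDiff ℝ ∞ φ) : ContDiff ℝ ∞ (partialT φ) :=
  (hφ.fderiv_right (m := ∞) (by simp)).clm_apply contDiff_const

theorem tsupport_partialX_subset : tsupport (partialX φ) ⊆ tsupport φ := by
  refine (closure_mono ?_).trans (tsupport_fderiv_subset ℝ (f := φ))
  intro z hz h
  exact hz (by simp [partialX, h])

theorem tsupport_partialT_subset : tsupport (partialT φ) ⊆ tsupport φ := by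
  refine (closure_mono ?_).trans (tsupport_fderiv_subset ℝ (f := φ))
  intro z hz h
  exact hz (by simp [partialT, h])

theorem iteratedDeriv_two_eq_partialX (hφ : ContDiff ℝ ∞ φ) (z : ℝ × ℝ) :
    iteratedDeriv 2 (fun x => φ (z.1, x)) z.2 = partialX (partialX φ) z := by
  rw [iteratedDeriv_succ, iteratedDeriv_one]
  have : deriv (fun x => φ (z.1, x)) = fun x => partialX φ (z.1, x) := by
    funext x
    exact (hasDerivAt_partialX (hφ.differentiable (by simp)) z.1 x).deriv
  rw [this]
  exact (hasDerivAt_partialX ((contDiff_partialX hφ).differentiable (by simp)) z.1 z.2).deriv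

theorem partialT_partialX_comm (hφ : ContDiff ℝ ∞ φ) :
    partialT (partialX φ) = partialX (partialT φ) := by
  funext z
  have hs : IsSymmSndFDerivAt ℝ φ z := (hφ.contDiffAt).isSymmSndFDerivAt
    (by rw [minSmoothness_of_isRCLikeNormedField]; exact WithTop.coe_le_coe.2 (le_top : (2 : ℕ∞) ≤ ⊤))
  have hd : DifferentiableAt ℝ (fderiv ℝ φ) z :=
    ((hφ.fderiv_right (m := ∞) (by simp)).differentiable (by simp)) z
  have e : ∀ v w : ℝ × ℝ, fderiv ℝ (fun z => fderiv ℝ φ z v) z w = fderiv ℝ (fderiv ℝ φ) z w v := by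
    intro v w
    rw [fderiv_clm_apply hd (differentiableAt_const v)]
    simp
  simp only [partialT, partialX]
  rw [show fderiv ℝ (partialX φ) z = fderiv ℝ (fun z => fderiv ℝ φ z (0, 1)) z from rfl,
    show fderiv ℝ (partialT φ) z = fderiv ℝ (fun z => fderiv ℝ φ z (1, 0)) z from rfl, e, e]
  exact hs _ _

theorem HasCompactSupport.partialX (hφ : HasCompactSupport φ) :
    HasCompactSupport (partialX φ) :=
  hφ.mono' (subset_closure.trans tsupport_partialX_subset)

theorem HasCompactSupport.partialT (hφ : HasCompactSupport φ) :
    HasCompactSupport (partialT φ) :=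
  hφ.mono' (subset_closure.trans tsupport_partialT_subset)

theorem IsTestFunction.partialX {T : ℝ} (hφ : IsTestFunction T φ) :
    IsTestFunction T (partialX φ) :=
  ⟨contDiff_partialX hφ.1, hφ.2.1.partialX, tsupport_partialX_subset.trans hφ.2.2⟩

theorem IsTestFunction.partialT {T : ℝ} (hφ : IsTestFunction T φ) :
    IsTestFunction T (partialT φ) :=
  ⟨contDiff_partialT hφ.1, hφ.2.1.partialT, tsupport_partialT_subset.trans hφ.2.2⟩

theorem IsTestFunction.eq_zero {T : ℝ} (hφ : IsTestFunction T φ) {z : ℝ × ℝ}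
    (hz : z.1 ∉ Set.Ioo 0 T) : φ z = 0 := by
  by_contra h
  exact hz (hφ.2.2 (subset_tsupport φ h)).1

theorem IsTestFunction.translate {T : ℝ} (hφ : IsTestFunction T φ) (h : ℝ) :
    IsTestFunction T (fun z => φ (z.1, z.2 - h)) := by
  refine ⟨hφ.1.comp (contDiff_fst.prodMk (contDiff_snd.sub contDiff_const)), ?_, ?_⟩
  · have := hφ.2.1.comp_homeomorph (Homeomorph.subRight ((0 : ℝ), h))
    simpa [Function.comp_def, Prod.sub_def] using this
  · have e : (fun z : ℝ × ℝ => φ (z.1, z.2 - h)) = φ ∘ (Homeomorph.subRight ((0 : ℝ), h)) := by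
      funext z
      simp [Prod.sub_def]
    rw [e, tsupport_comp_eq_preimage]
    intro z hz
    have := (hφ.2.2 hz).1
    simpa using this

end PartialDerivatives

/-! ### Weak x-derivatives and primitives on time slices -/

section WeakDerivativeSlices

theorem integrable_mul_of_bounded_support {V g : ℝ × ℝ → ℝ} (hV : LocallyIntegrable V volume)
    (hg : Measurable g) {C R : ℝ} (hgC : ∀ z, |g z| ≤ C) (hgR : ∀ z, R < ‖z‖ → g z = 0) :
    Integrable (fun z => V z * g z) volume := by
  have h1 : IntegrableOn V (Metric.closedBall 0 R) volume :=
    hV.integrableOn_isCompact (isCompact_closedBall 0 R)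
  have h2 : IntegrableOn (fun z => V z * g z) (Metric.closedBall 0 R) volume :=
    Integrable.mul_bdd h1 hg.aestronglyMeasurable (ae_of_all _ hgC)
  refine (integrableOn_iff_integrable_of_support_subset ?_).1 h2
  intro z hz
  by_contra hne
  exact right_ne_zero_of_mul hz (hgR z (by simpa using hne))

theorem norm_prod_le_add_abs (z : ℝ × ℝ) (y : ℝ) : ‖z‖ ≤ ‖(z.1, z.2 + y)‖ + |y| := by
  simp only [Prod.norm_def, Real.norm_eq_abs]
  refine max_le ?_ ?_
  · linarith [le_max_left |z.1| |z.2 + y|, abs_nonneg y]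
  · have := le_max_right |z.1| |z.2 + y|
    have h2 : |z.2| ≤ |z.2 + y| + |y| := by
      have := abs_sub (z.2 + y) y
      simpa using this
    linarith

theorem integral_comp_add_snd (F : ℝ × ℝ → ℝ) (y : ℝ) :
    ∫ z : ℝ × ℝ, F (z.1, z.2 + y) = ∫ z, F z := by
  have := integral_add_right_eq_self (μ := (volume : Measure (ℝ × ℝ))) F ((0 : ℝ), y)
  simpa [Prod.add_def] using this

/-- Integrability needed for Fubini in the shift and the space-time point. After translating back,
`V` is only seen on the fixed ball of radius `R + |h|`, so local integrability suffices. -/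
theorem integrable_translate_mul {V g : ℝ × ℝ → ℝ} (hV : LocallyIntegrable V volume)
    (hVm : Measurable V) (hg : Measurable g) {C R : ℝ} (hgC : ∀ z, |g z| ≤ C)
    (hgR : ∀ z, R < ‖z‖ → g z = 0) (h : ℝ) :
    Integrable (fun p : ℝ × (ℝ × ℝ) => V (p.2.1, p.2.2 + p.1) * g p.2)
      ((volume.restrict (Set.uIoc 0 h)).prod volume) := by
  have hC : 0 ≤ C := (abs_nonneg _).trans (hgC 0)
  have hg' : ∀ y : ℝ, Measurable fun z : ℝ × ℝ => g (z.1, z.2 - y) := fun y =>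
    hg.comp (by fun_prop)
  have hgR' : ∀ (y : ℝ) (z : ℝ × ℝ), |y| ≤ |h| → R + |h| < ‖z‖ → g (z.1, z.2 - y) = 0 := by
    intro y z hy hz
    apply hgR
    have := norm_prod_le_add_abs z (-y)
    rw [abs_neg, ← sub_eq_add_neg] at this
    linarith
  have hint : ∀ y : ℝ, |y| ≤ |h| → Integrable (fun z => V z * g (z.1, z.2 - y)) volume :=
    fun y hy => integrable_mul_of_bounded_support hV (hg' y) (fun z => hgC _)
      (fun z hz => hgR' y z hy hz)
  have hm : Measurable (fun p : ℝ × (ℝ × ℝ) => V (p.2.1, p.2.2 + p.1) * g p.2) :=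
    (hVm.comp (by fun_prop)).mul (hg.comp measurable_snd)
  have : IsFiniteMeasure (volume.restrict (Set.uIoc 0 h)) := ⟨by simp [Set.uIoc]⟩
  have hy : ∀ y ∈ Set.uIoc 0 h, |y| ≤ |h| := by
    intro y hy
    rcases Set.mem_uIoc.1 hy with ⟨h1, h2⟩ | ⟨h1, h2⟩
    · rw [abs_of_pos h1, abs_of_nonneg (h1.le.trans h2)]; exact h2
    · rw [abs_of_nonpos h2, abs_of_neg (h1.trans_le h2)]; linarith
  rw [integrable_prod_iff hm.aestronglyMeasurable]
  constructor
  · filter_upwards [ae_restrict_mem measurableSet_uIoc] with y hyh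
    have := (hint y (hy y hyh)).comp_add_right ((0 : ℝ), y)
    simpa [Prod.add_def] using this
  · have hK : IntegrableOn V (Metric.closedBall 0 (R + |h|)) volume :=
      hV.integrableOn_isCompact (isCompact_closedBall 0 _)
    refine Integrable.mono' (g := fun _ => C * ∫ z in Metric.closedBall 0 (R + |h|), ‖V z‖)
      (integrable_const _)
      (hm.stronglyMeasurable.norm.integral_prod_right.aestronglyMeasurable) ?_
    filter_upwards [ae_restrict_mem measurableSet_uIoc] with y hyh
    rw [Real.norm_of_nonneg (integral_nonneg fun _ => norm_nonneg _)]
    have e := integral_comp_add_snd (fun z => ‖V z * g (z.1, z.2 - y)‖) y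
    simp only [add_sub_cancel_right] at e
    rw [e, ← integral_const_mul]
    rw [← setIntegral_eq_integral_of_forall_compl_eq_zero (s := Metric.closedBall 0 (R + |h|))]
    · refine setIntegral_mono_ae ((hint y (hy y hyh)).norm.integrableOn) (hK.norm.const_mul _)
        (ae_of_all _ fun z => ?_)
      simp only [norm_mul, Real.norm_eq_abs]
      rw [mul_comm]
      exact mul_le_mul_of_nonneg_right (hgC _) (abs_nonneg _)
    · intro z hz
      simp [hgR' y z (hy y hyh) (by simpa using hz)]

theorem exists_bound_support {φ : ℝ × ℝ → ℝ} (hφ : Continuous φ) (hc : HasCompactSupport φ) :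
    ∃ C R : ℝ, (∀ z, |φ z| ≤ C) ∧ ∀ z, R < ‖z‖ → φ z = 0 := by
  obtain ⟨C, hC⟩ := hc.exists_bound_of_continuous hφ
  obtain ⟨R, hR⟩ := hc.isCompact.isBounded.subset_closedBall 0
  refine ⟨C, R, hC, fun z hz => ?_⟩
  by_contra hne
  have := hR (subset_tsupport φ hne)
  simp at this
  linarith

/-- The shift is placed on the test function, so differentiation under the integral needs no
regularity of `U`. -/
theorem hasDerivAt_integral_translate {U φ : ℝ × ℝ → ℝ} (hU : LocallyIntegrable U volume)
    (hφ : ContDiff ℝ ∞ φ) (hc : HasCompactSupport φ) (h : ℝ) :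
    HasDerivAt (fun h => ∫ z : ℝ × ℝ, U z * φ (z.1, z.2 - h))
      (- ∫ z : ℝ × ℝ, U z * partialX φ (z.1, z.2 - h)) h := by
  obtain ⟨C, R, hC, hR⟩ := exists_bound_support (contDiff_partialX hφ).continuous hc.partialX
  obtain ⟨C', R', hC', hR'⟩ := exists_bound_support hφ.continuous hc
  have hC0 : 0 ≤ C := (abs_nonneg _).trans (hC 0)
  have hUm : AEStronglyMeasurable U volume := hU.aestronglyMeasurable
  have hint : ∀ y, Integrable (fun z : ℝ × ℝ => U z * φ (z.1, z.2 - y)) volume := fun y =>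
    integrable_mul_of_bounded_support (R := R' + |y|) hU
      (hφ.continuous.measurable.comp (by fun_prop)) (fun z => hC' _) (fun z hz => hR' _ (by
        have := norm_prod_le_add_abs z (-y)
        rw [abs_neg, ← sub_eq_add_neg] at this
        linarith))
  have key := hasDerivAt_integral_of_dominated_loc_of_deriv_le (μ := (volume : Measure (ℝ × ℝ)))
    (F := fun h z => U z * φ (z.1, z.2 - h)) (F' := fun h z => U z * (- partialX φ (z.1, z.2 - h)))
    (x₀ := h) (s := Metric.ball h 1)
    (bound := (Metric.closedBall 0 (R + (|h| + 1))).indicator fun z => |U z| * C)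
    (Metric.ball_mem_nhds h one_pos)
    (Eventually.of_forall fun y => (hint y).aestronglyMeasurable) (hint h)
    (hUm.mul (((contDiff_partialX hφ).continuous.comp (by fun_prop)).neg.aestronglyMeasurable))
    ?_ ?_ ?_
  · have e : - ∫ z : ℝ × ℝ, U z * partialX φ (z.1, z.2 - h) =
        ∫ z : ℝ × ℝ, U z * (- partialX φ (z.1, z.2 - h)) := by
      rw [← integral_neg]
      congr 1; funext z; ring
    rw [e]
    exact key.2
  · refine ae_of_all _ fun z y hy => ?_
    have hy1 : |y| ≤ |h| + 1 := by
      have : |y - h| < 1 := by simpa [Real.dist_eq] using hy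
      have := abs_sub_abs_le_abs_sub y h
      linarith
    by_cases hz : z ∈ Metric.closedBall (0 : ℝ × ℝ) (R + (|h| + 1))
    · rw [Set.indicator_of_mem hz, norm_mul, norm_neg, Real.norm_eq_abs, Real.norm_eq_abs]
      exact mul_le_mul_of_nonneg_left (hC _) (abs_nonneg _)
    · rw [Set.indicator_of_notMem hz, hR, neg_zero, mul_zero, norm_zero]
      simp only [Metric.mem_closedBall, dist_zero_right, not_le] at hz
      have := norm_prod_le_add_abs z (-y)
      rw [abs_neg, ← sub_eq_add_neg] at this
      linarith
  · rw [integrable_indicator_iff measurableSet_closedBall]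
    exact (hU.integrableOn_isCompact (isCompact_closedBall 0 _)).abs.mul_const C
  · refine ae_of_all _ fun z y hy => ?_
    have h1 := (hasDerivAt_partialX (hφ.differentiable (by simp)) z.1 (z.2 - y))
    have h2 := h1.scomp y ((hasDerivAt_id y).const_sub z.2)
    simpa [Function.comp_def] using h2.const_mul (U z)

variable {T : ℝ} {U V : ℝ × ℝ → ℝ}

/-- A function with a weak derivative in `x` satisfies the fundamental theorem of calculus
in `x`, almost everywhere, for each fixed increment. -/
theorem ae_sub_eq_integral_of_weakDeriv (hU : LocallyIntegrable U volume)
    (hV : LocallyIntegrable V volume) (hVm : Measurable V)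
    (hUV : ∀ φ, IsTestFunction T φ → ∫ z, U z * partialX φ z = - ∫ z, V z * φ z) (h : ℝ) :
    ∀ᵐ z : ℝ × ℝ, z ∈ Set.Ioo 0 T ×ˢ (Set.univ : Set ℝ) →
      U (z.1, z.2 + h) - U z - ∫ y in (0:ℝ)..h, V (z.1, z.2 + y) = 0 := by
  have hUh : LocallyIntegrable (fun z : ℝ × ℝ => U (z.1, z.2 + h)) volume := by
    rw [locallyIntegrable_iff]
    intro k hk
    have h1 := hU.integrableOn_isCompact
      (hk.image (show Continuous (fun z : ℝ × ℝ => z + ((0 : ℝ), h)) by fun_prop))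
    have h2 := (measurePreserving_add_right (volume : Measure (ℝ × ℝ))
      ((0 : ℝ), h)).integrableOn_image (f := U) (s := k)
      (measurableEmbedding_addRight ((0 : ℝ), h))
    have h3 := h2.1 h1
    simpa [Function.comp_def, Prod.add_def] using h3
  have hVh : LocallyIntegrable (fun z : ℝ × ℝ => ∫ y in (0:ℝ)..h, V (z.1, z.2 + y)) volume := by
    rw [locallyIntegrable_iff]
    intro k hk
    obtain ⟨R, hR⟩ := hk.isBounded.subset_closedBall 0
    refine IntegrableOn.mono_set ?_ hR
    have h1 := integrable_translate_mul hV hVm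
      (g := (Metric.closedBall 0 R).indicator fun _ => 1)
      (measurable_const.indicator measurableSet_closedBall) (C := 1) (R := R)
      (fun z => by
        by_cases hz : z ∈ Metric.closedBall (0 : ℝ × ℝ) R <;> simp [Set.indicator, hz])
      (fun z hz => Set.indicator_of_notMem (by simpa using hz) _) h
    have h2 := h1.integral_prod_right
    rw [← integrable_indicator_iff measurableSet_closedBall]
    have h3 : Integrable (fun z : ℝ × ℝ => (if 0 ≤ h then (1:ℝ) else -1) *
        ∫ y in Set.uIoc 0 h, V (z.1, z.2 + y) *
          (Metric.closedBall (0 : ℝ × ℝ) R).indicator (fun _ => (1 : ℝ)) z) volume :=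
      h2.const_mul _
    refine h3.congr (ae_of_all _ fun z => ?_)
    by_cases hz : z ∈ Metric.closedBall (0 : ℝ × ℝ) R
    · simp only [Set.indicator_of_mem hz, mul_one]
      rw [intervalIntegral.intervalIntegral_eq_integral_uIoc, smul_eq_mul]
    · simp [Set.indicator_of_notMem hz]
  apply (isOpen_Ioo.prod isOpen_univ).ae_eq_zero_of_integral_contDiff_smul_eq_zero
  · exact ((hUh.sub hU).sub hVh).locallyIntegrableOn _
  intro φ hφ hc hs
  have hT : IsTestFunction T φ := ⟨hφ, hc, hs⟩
  obtain ⟨C, R, hC, hR⟩ := exists_bound_support hφ.continuous hc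
  have i1 : ∀ {W : ℝ × ℝ → ℝ}, LocallyIntegrable W volume → Integrable (fun z => W z * φ z) :=
    fun hW => integrable_mul_of_bounded_support hW hφ.continuous.measurable hC hR
  -- The weak derivative, tested against translates of φ, says that the pairing of `U` with the
  -- shifted φ is a C¹ function of the shift with derivative the pairing with `V`. The fundamental
  -- theorem of calculus in the shift, followed by Fubini, gives the tested form of the claim.
  have hD : ∀ y, HasDerivAt (fun h => ∫ z : ℝ × ℝ, U z * φ (z.1, z.2 - h))
      (∫ z : ℝ × ℝ, V z * φ (z.1, z.2 - y)) y := by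
    intro y
    convert hasDerivAt_integral_translate hU hφ hc y using 1
    have := hUV _ (hT.translate y)
    rw [← neg_eq_iff_eq_neg] at this
    rw [← this]
    congr 2; funext z; congr 1
    have h1 := (hasDerivAt_partialX (hφ.differentiable (by simp)) z.1 (z.2 - y)).comp_sub_const
      z.2 y
    have h2 := hasDerivAt_partialX ((hT.translate y).1.differentiable (by simp)) z.1 z.2
    exact h2.unique h1
  have hDc : Continuous (fun y => ∫ z : ℝ × ℝ, V z * φ (z.1, z.2 - y)) :=
    continuous_iff_continuousAt.2 fun y => (hasDerivAt_integral_translate hV hφ hc y).continuousAt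
  have hFTC := intervalIntegral.integral_eq_sub_of_hasDerivAt (a := 0) (b := h)
    (fun y _ => hD y) (hDc.intervalIntegrable _ _)
  simp only [sub_zero] at hFTC
  have e1 : ∫ z : ℝ × ℝ, U (z.1, z.2 + h) * φ z = ∫ z : ℝ × ℝ, U z * φ (z.1, z.2 - h) := by
    rw [← integral_comp_add_snd (fun z => U z * φ (z.1, z.2 - h)) h]
    simp
  have e2 : ∫ z : ℝ × ℝ, (∫ y in (0:ℝ)..h, V (z.1, z.2 + y)) * φ z =
      ∫ y in (0:ℝ)..h, ∫ z : ℝ × ℝ, V z * φ (z.1, z.2 - y) := by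
    have hsw := integral_integral_swap
      (f := fun (y : ℝ) (z : ℝ × ℝ) => V (z.1, z.2 + y) * φ z) (integrable_translate_mul hV hVm hφ.continuous.measurable hC hR h)
    rw [intervalIntegral.intervalIntegral_eq_integral_uIoc]
    have e3 : ∀ y : ℝ, ∫ z : ℝ × ℝ, V z * φ (z.1, z.2 - y) =
        ∫ z : ℝ × ℝ, V (z.1, z.2 + y) * φ z := by
      intro y
      rw [← integral_comp_add_snd _ y]
      simp
    simp only [e3]
    rw [hsw, smul_eq_mul, ← integral_const_mul]
    congr 1; funext z
    rw [intervalIntegral.intervalIntegral_eq_integral_uIoc, integral_mul_const, smul_eq_mul]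
    ring
  simp only [smul_eq_mul]
  have e4 : ∀ z : ℝ × ℝ, φ z * (U (z.1, z.2 + h) - U z - ∫ y in (0:ℝ)..h, V (z.1, z.2 + y)) =
      U (z.1, z.2 + h) * φ z - U z * φ z - (∫ y in (0:ℝ)..h, V (z.1, z.2 + y)) * φ z := by
    intro z; ring
  simp only [e4]
  have i2 : Integrable (fun z : ℝ × ℝ => U (z.1, z.2 + h) * φ z - U z * φ z) volume :=
    (i1 hUh).sub (i1 hU)
  rw [integral_sub i2 (i1 hVh), integral_sub (i1 hUh) (i1 hU), e1, e2, hFTC]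
  ring

/-- The oriented integral with variable endpoint is the difference of two integrals over the whole
line of indicators, for 0 < y ≤ h and for h < y ≤ 0, and each of these is measurable in its
parameters. -/
theorem measurable_intervalIntegral_translate (hVm : Measurable V) :
    Measurable fun p : ℝ × (ℝ × ℝ) => ∫ y in (0:ℝ)..p.1, V (p.2.1, p.2.2 + y) := by
  have key : ∀ s : Set (ℝ × ℝ), MeasurableSet s → Measurable fun p : ℝ × (ℝ × ℝ) =>
      ∫ y, s.indicator (fun q => V (p.2.1, p.2.2 + q.2)) (p.1, y) := by
    intro s hs
    have : Measurable fun q : (ℝ × (ℝ × ℝ)) × ℝ =>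
        {q : (ℝ × (ℝ × ℝ)) × ℝ | (q.1.1, q.2) ∈ s}.indicator
          (fun q => V (q.1.2.1, q.1.2.2 + q.2)) q :=
      (hVm.comp (by fun_prop)).indicator ((by fun_prop : Measurable
        fun q : (ℝ × (ℝ × ℝ)) × ℝ => (q.1.1, q.2)) hs)
    exact this.stronglyMeasurable.integral_prod_right'.measurable
  have h1 := key {q | 0 < q.2 ∧ q.2 ≤ q.1}
    ((measurableSet_lt measurable_const measurable_snd).inter
      (measurableSet_le measurable_snd measurable_fst))
  have h2 := key {q | q.1 < q.2 ∧ q.2 ≤ 0}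
    ((measurableSet_lt measurable_fst measurable_snd).inter
      (measurableSet_le measurable_snd measurable_const))
  convert h1.sub h2 using 1
  funext p
  simp only [intervalIntegral, Pi.sub_apply]
  rw [← integral_indicator measurableSet_Ioc, ← integral_indicator measurableSet_Ioc]
  rfl

theorem ae_slice_locallyIntegrable (hV : LocallyIntegrable V volume) :
    ∀ᵐ t : ℝ, LocallyIntegrable (fun x => V (t, x)) volume := by
  have h : ∀ n : ℕ, ∀ᵐ t : ℝ, Integrable (fun x =>
      (Set.Icc (-n : ℝ) n ×ˢ Set.Icc (-n : ℝ) n).indicator V (t, x)) volume := by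
    intro n
    have h1 : IntegrableOn V (Set.Icc (-n : ℝ) n ×ˢ Set.Icc (-n : ℝ) n) volume :=
      hV.integrableOn_isCompact (isCompact_Icc.prod isCompact_Icc)
    exact ((integrable_indicator_iff (measurableSet_Icc.prod measurableSet_Icc)).2 h1).prod_right_ae
  filter_upwards [ae_all_iff.2 h] with t ht
  rw [locallyIntegrable_iff]
  intro k hk
  obtain ⟨R, hR⟩ := hk.isBounded.subset_closedBall 0
  obtain ⟨n, hn⟩ := exists_nat_ge (max |t| R)
  have h2 : IntegrableOn (fun x => V (t, x)) (Set.Icc (-n : ℝ) n) volume := by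
    rw [← integrable_indicator_iff measurableSet_Icc]
    refine (ht n).congr (ae_of_all _ fun x => ?_)
    have htn : t ∈ Set.Icc (-n : ℝ) n := abs_le.1 ((le_max_left _ _).trans hn)
    by_cases hx : x ∈ Set.Icc (-n : ℝ) n
    · simp only [Set.indicator_of_mem hx, Set.indicator_of_mem (Set.mk_mem_prod htn hx)]
    · simp only [Set.indicator_of_notMem hx]
      exact Set.indicator_of_notMem (fun h => hx h.2) _
  refine h2.mono_set fun x hx => ?_
  have := hR hx
  simp only [Metric.mem_closedBall, dist_zero_right, Real.norm_eq_abs] at this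
  exact abs_le.1 (this.trans ((le_max_right _ _).trans hn))

/-- A function on the slab with a weak derivative in `x` is, for almost every `t`, almost
everywhere equal to a primitive of the slice of that derivative. -/
theorem ae_slice_isPrimitive (hU : LocallyIntegrable U volume) (hUm : Measurable U)
    (hV : LocallyIntegrable V volume) (hVm : Measurable V)
    (hUV : ∀ φ, IsTestFunction T φ → ∫ z, U z * partialX φ z = - ∫ z, V z * φ z) :
    ∀ᵐ t : ℝ, t ∈ Set.Ioo 0 T → ∃ F, IsPrimitive F (fun x => V (t, x)) ∧
      (fun x => U (t, x)) =ᵐ[volume] F := by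
  have h1 : ∀ᵐ h : ℝ, ∀ᵐ z : ℝ × ℝ, z ∈ Set.Ioo 0 T ×ˢ (Set.univ : Set ℝ) →
      U (z.1, z.2 + h) - U z - ∫ y in (0:ℝ)..h, V (z.1, z.2 + y) = 0 :=
    ae_of_all _ (ae_sub_eq_integral_of_weakDeriv hU hV hVm hUV)
  have hmeas : MeasurableSet {p : ℝ × (ℝ × ℝ) | p.2 ∈ Set.Ioo 0 T ×ˢ (Set.univ : Set ℝ) →
      U (p.2.1, p.2.2 + p.1) - U p.2 - ∫ y in (0:ℝ)..p.1, V (p.2.1, p.2.2 + y) = 0} := by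
    refine MeasurableSet.imp (measurable_snd (measurableSet_Ioo.prod MeasurableSet.univ)) ?_
    refine measurableSet_eq_fun ?_ measurable_const
    exact ((hUm.comp (by fun_prop)).sub (hUm.comp measurable_snd)).sub
      (measurable_intervalIntegral_translate hVm)
  -- The exceptional null set depends on the increment. Joint measurability allows the order to be
  -- exchanged: for almost every point, the formula holds for almost every increment.
  have h2 := (Measure.ae_ae_comm hmeas).1 h1
  rw [Measure.volume_eq_prod] at h2
  have h3 := Measure.ae_ae_of_ae_prod h2
  filter_upwards [h3, ae_slice_locallyIntegrable hV] with t ht hloc htT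
  -- One good base point in the slice is enough: the increments x − x₀ reach almost every x.
  obtain ⟨x₀, hx₀⟩ := ht.exists
  refine ⟨fun x => U (t, x₀) + ∫ y in x₀..x, V (t, y), ⟨hloc, fun a b => ?_⟩, ?_⟩
  · have hi : ∀ a b, IntervalIntegrable (fun x => V (t, x)) volume a b := fun a b =>
      intervalIntegrable_iff.2 ((LocallyIntegrable.integrableOn_isCompact hloc isCompact_uIcc).mono_set
        Set.uIoc_subset_uIcc)
    rw [← intervalIntegral.integral_add_adjacent_intervals (hi x₀ a) (hi a b)]
    ring
  · have h4 : ∀ᵐ x : ℝ, (t, x₀) ∈ Set.Ioo 0 T ×ˢ (Set.univ : Set ℝ) →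
      U (t, x₀ + (x - x₀)) - U (t, x₀) - ∫ y in (0:ℝ)..(x - x₀), V (t, x₀ + y) = 0 :=
      (measurePreserving_sub_right volume x₀).quasiMeasurePreserving.ae hx₀
    filter_upwards [h4] with x hx
    have := hx ⟨htT, trivial⟩
    rw [intervalIntegral.integral_comp_add_left (fun y => V (t, y))] at this
    simp only [add_zero, add_sub_cancel] at this
    linarith

/-- A function with a locally integrable weak derivative is almost everywhere equal to a
primitive of it. -/
theorem HasWeakDeriv.exists_isPrimitive {f g : ℝ → ℝ} (h : HasWeakDeriv 1 f g) :
    ∃ F, IsPrimitive F g ∧ f =ᵐ[volume] F := by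
  obtain ⟨hf, hg, hfg⟩ := h
  set f' := hf.aestronglyMeasurable.mk f
  set g' := hg.aestronglyMeasurable.mk g
  have ef : f =ᵐ[volume] f' := hf.aestronglyMeasurable.ae_eq_mk
  have eg : g =ᵐ[volume] g' := hg.aestronglyMeasurable.ae_eq_mk
  have hf' : LocallyIntegrable f' volume := hf.congr ef
  have hg' : LocallyIntegrable g' volume := hg.congr eg
  have hloc : ∀ k : ℝ → ℝ, LocallyIntegrable k volume →
      LocallyIntegrable (fun z : ℝ × ℝ => k z.2) volume := by
    intro k hk
    rw [locallyIntegrable_iff]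
    intro s hs
    obtain ⟨R, hR⟩ := hs.isBounded.subset_closedBall 0
    refine IntegrableOn.mono_set ?_ hR
    rw [show (0 : ℝ × ℝ) = ((0 : ℝ), (0 : ℝ)) from rfl, ← closedBall_prod_same]
    rw [IntegrableOn, Measure.volume_eq_prod, ← Measure.prod_restrict]
    have : IsFiniteMeasure (volume.restrict (Metric.closedBall (0:ℝ) R)) :=
      ⟨by rw [Measure.restrict_apply_univ]; exact measure_closedBall_lt_top⟩
    exact (hk.integrableOn_isCompact (isCompact_closedBall 0 R)).integrable.comp_snd _
  -- The one-dimensional statement is read off from the slab (0,1) × ℝ for functions constant in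
  -- time: all slices are then the same function, and some good slice exists because (0,1) has
  -- positive measure.
  have hUV : ∀ φ, IsTestFunction 1 φ →
      ∫ z : ℝ × ℝ, f' z.2 * partialX φ z = - ∫ z : ℝ × ℝ, g' z.2 * φ z := by
    intro φ hφ
    obtain ⟨C, R, hC, hR⟩ := exists_bound_support hφ.1.continuous hφ.2.1
    obtain ⟨C', R', hC', hR'⟩ := exists_bound_support hφ.partialX.1.continuous hφ.partialX.2.1
    have i1 := integrable_mul_of_bounded_support (hloc f' hf')
      hφ.partialX.1.continuous.measurable hC' hR'
    have i2 := integrable_mul_of_bounded_support (hloc g' hg')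
      hφ.1.continuous.measurable hC hR
    rw [Measure.volume_eq_prod] at i1 i2 ⊢
    rw [integral_prod _ i1, integral_prod _ i2, ← integral_neg]
    congr 1; funext t
    have hs : ContDiff ℝ ∞ fun x => φ (t, x) := hφ.1.comp (contDiff_const.prodMk contDiff_id)
    have hcs : HasCompactSupport fun x => φ (t, x) := by
      refine HasCompactSupport.of_support_subset_isCompact (isCompact_closedBall (0 : ℝ) R) ?_
      intro x hx
      by_contra hne
      apply hx
      apply hR
      simp only [Metric.mem_closedBall, dist_zero_right, not_le] at hne
      exact lt_of_lt_of_le hne (le_max_right ‖t‖ ‖x‖)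
    have := hfg _ hs hcs
    rw [iteratedDeriv_one, pow_one, neg_one_mul] at this
    have e1 : ∫ x, f x * deriv (fun x => φ (t, x)) x = ∫ x, f' x * partialX φ (t, x) := by
      apply integral_congr_ae
      filter_upwards [ef] with x hx
      rw [hx, (hasDerivAt_partialX (hφ.1.differentiable (by simp)) t x).deriv]
    have e2 : ∫ x, g x * φ (t, x) = ∫ x, g' x * φ (t, x) := by
      apply integral_congr_ae
      filter_upwards [eg] with x hx
      rw [hx]
    simpa [e1, e2] using this
  have key := ae_slice_isPrimitive (T := 1) (U := fun z => f' z.2) (V := fun z => g' z.2)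
    (hloc f' hf')
    (hf.aestronglyMeasurable.stronglyMeasurable_mk.measurable.comp measurable_snd) (hloc g' hg')
    (hg.aestronglyMeasurable.stronglyMeasurable_mk.measurable.comp measurable_snd) hUV
  have hpos : (volume : Measure ℝ) (Set.Ioo 0 1) ≠ 0 := by simp
  obtain ⟨t, ht, hF⟩ := (frequently_ae_mem_iff.2 hpos).and_eventually key |>.exists
  obtain ⟨F, hF1, hF2⟩ := hF ht
  refine ⟨F, ⟨hg, fun a b => ?_⟩, ef.trans hF2⟩
  rw [hF1.sub_eq]
  apply intervalIntegral.integral_congr_ae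
  filter_upwards [eg] with x hx _ using hx.symm

end WeakDerivativeSlices

/-! ### Convolution with measures, Minkowski's inequality and the resolvent -/

section MeasureConvolution

theorem lintegral_mul_le_of_sq_le {α : Type*} [MeasurableSpace α] {μ : Measure α}
    {f g : α → ℝ≥0∞} (hf : AEMeasurable f μ) (hg : AEMeasurable g μ) {a b : ℝ≥0∞}
    (ha : ∫⁻ x, f x ^ 2 ∂μ ≤ a ^ 2) (hb : ∫⁻ x, g x ^ 2 ∂μ ≤ b ^ 2) :
    ∫⁻ x, f x * g x ∂μ ≤ a * b := by
  have h := ENNReal.lintegral_mul_le_Lp_mul_Lq μ Real.HolderConjugate.two_two hf hg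
  simp only [Pi.mul_apply, ENNReal.rpow_two] at h
  refine h.trans (mul_le_mul' ?_ ?_)
  · calc _ ≤ (a ^ 2) ^ (1 / 2 : ℝ) := ENNReal.rpow_le_rpow ha (by norm_num)
      _ = a := by rw [← ENNReal.rpow_two, ← ENNReal.rpow_mul]; norm_num
  · calc _ ≤ (b ^ 2) ^ (1 / 2 : ℝ) := ENNReal.rpow_le_rpow hb (by norm_num)
      _ = b := by rw [← ENNReal.rpow_two, ← ENNReal.rpow_mul]; norm_num

/-- Minkowski's integral inequality in `L²`. -/
theorem lintegral_sq_lintegral_le {α β : Type*} [MeasurableSpace α] [MeasurableSpace β]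
    {ν : Measure α} {μ : Measure β} [SFinite ν] [SFinite μ] {F : α → β → ℝ≥0∞}
    (hF : Measurable (Function.uncurry F)) {n : α → ℝ≥0∞} (hn : Measurable n)
    (h : ∀ w, ∫⁻ x, F w x ^ 2 ∂μ ≤ n w ^ 2) :
    ∫⁻ x, (∫⁻ w, F w x ∂ν) ^ 2 ∂μ ≤ (∫⁻ w, n w ∂ν) ^ 2 := by
  have hFx : ∀ x, Measurable fun w => F w x := fun x => hF.comp measurable_prodMk_right
  have hFw : ∀ w, Measurable fun x => F w x := fun w => hF.comp measurable_prodMk_left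
  have hA : Measurable fun x => ∫⁻ w, F w x ∂ν :=
    Measurable.lintegral_prod_right' (f := fun p : β × α => F p.2 p.1)
      (hF.comp (by fun_prop : Measurable fun p : β × α => (p.2, p.1)))
  -- The square is written as a double integral over w and w', Tonelli moves the x-integral inside,
  -- and Cauchy–Schwarz bounds it by the product n(w)n(w').
  calc ∫⁻ x, (∫⁻ w, F w x ∂ν) ^ 2 ∂μ
      = ∫⁻ x, ∫⁻ w', (∫⁻ w, F w x ∂ν) * F w' x ∂ν ∂μ := by
        refine lintegral_congr fun x => ?_
        rw [lintegral_const_mul _ (hFx x), sq]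
    _ = ∫⁻ w', ∫⁻ x, (∫⁻ w, F w x ∂ν) * F w' x ∂μ ∂ν := by
        refine lintegral_lintegral_swap (Measurable.aemeasurable ?_)
        exact (hA.comp measurable_fst).mul (hF.comp (by fun_prop : Measurable
          fun p : β × α => (p.2, p.1)))
    _ = ∫⁻ w', ∫⁻ w, ∫⁻ x, F w x * F w' x ∂μ ∂ν ∂ν := by
        refine lintegral_congr fun w' => ?_
        simp_rw [← lintegral_mul_const _ (hFx _)]
        refine lintegral_lintegral_swap (Measurable.aemeasurable ?_)
        exact (hF.comp (by fun_prop : Measurable fun p : β × α => (p.2, p.1))).mul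
          ((hFw w').comp measurable_fst)
    _ ≤ ∫⁻ w', ∫⁻ w, n w * n w' ∂ν ∂ν := by
        gcongr with w' w
        exact lintegral_mul_le_of_sq_le (hFw w).aemeasurable (hFw w').aemeasurable (h w) (h w')
    _ = (∫⁻ w, n w ∂ν) ^ 2 := by
        simp_rw [lintegral_mul_const _ hn]
        rw [lintegral_const_mul _ hn, sq]

/-- The convolution of a nonnegative function with a measure. -/
noncomputable def mconv (ν : Measure (ℝ × ℝ)) (f : ℝ × ℝ → ℝ≥0∞) (z : ℝ × ℝ) : ℝ≥0∞ :=
  ∫⁻ w, f (z - w) ∂ν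

variable {ν : Measure (ℝ × ℝ)} {f g : ℝ × ℝ → ℝ≥0∞}

theorem measurable_mconv [SFinite ν] (hf : Measurable f) : Measurable (mconv ν f) :=
  Measurable.lintegral_prod_right' (f := fun p : (ℝ × ℝ) × (ℝ × ℝ) => f (p.1 - p.2))
    (hf.comp (by fun_prop))

theorem mconv_mono (h : ∀ z, f z ≤ g z) (z : ℝ × ℝ) : mconv ν f z ≤ mconv ν g z :=
  lintegral_mono fun _ => h _

theorem mconv_add (hf : Measurable f) (z : ℝ × ℝ) :
    mconv ν (fun z => f z + g z) z = mconv ν f z + mconv ν g z :=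
  lintegral_add_left (hf.comp (by fun_prop)) _

theorem mconv_const_mul (c : ℝ≥0∞) (hf : Measurable f) (z : ℝ × ℝ) :
    mconv ν (fun z => c * f z) z = c * mconv ν f z :=
  lintegral_const_mul _ (hf.comp (by fun_prop))

theorem mconv_conv {κ : Measure (ℝ × ℝ)} [SFinite ν] [SFinite κ] (hf : Measurable f)
    (z : ℝ × ℝ) : mconv (ν ∗ κ) f z = mconv ν (mconv κ f) z := by
  have := Measure.lintegral_conv (μ := ν) (ν := κ) (f := fun w => f (z - w))
    (hf.comp (by fun_prop))
  rw [mconv, this]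
  simp only [mconv, sub_sub]

/-- The square of the norm `sup_y ‖f‖_{L²(ℝ × [y, y+1])}`. -/
noncomputable def stripSq (f : ℝ × ℝ → ℝ≥0∞) : ℝ≥0∞ :=
  ⨆ y : ℝ, ∫⁻ z in Set.univ ×ˢ Set.Icc y (y + 1), f z ^ 2

theorem lintegral_strip_translate (f : ℝ × ℝ → ℝ≥0∞) (w : ℝ × ℝ) (y : ℝ) :
    ∫⁻ z in (Set.univ : Set ℝ) ×ˢ Set.Icc y (y + 1), f (z - w) =
      ∫⁻ z in (Set.univ : Set ℝ) ×ˢ Set.Icc (y - w.2) (y - w.2 + 1), f z := by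
  have hm : ∀ y : ℝ, MeasurableSet ((Set.univ : Set ℝ) ×ˢ Set.Icc y (y + 1)) := fun y =>
    MeasurableSet.univ.prod measurableSet_Icc
  rw [← lintegral_indicator (hm y), ← lintegral_indicator (hm _)]
  symm
  rw [← lintegral_sub_right_eq_self _ w]
  refine lintegral_congr fun z => ?_
  simp only [Set.indicator, Set.mem_prod, Set.mem_univ, true_and, Set.mem_Icc, Prod.snd_sub]
  congr 1
  apply propext
  constructor <;> rintro ⟨h1, h2⟩ <;> constructor <;> linarith

theorem lintegral_Icc_translate (f : ℝ → ℝ≥0∞) (w y : ℝ) :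
    ∫⁻ x in Set.Icc y (y + 1), f (x - w) = ∫⁻ x in Set.Icc (y - w) (y - w + 1), f x := by
  rw [← lintegral_indicator measurableSet_Icc, ← lintegral_indicator measurableSet_Icc]
  symm
  rw [← lintegral_sub_right_eq_self _ w]
  refine lintegral_congr fun z => ?_
  simp only [Set.indicator, Set.mem_Icc]
  congr 1
  apply propext
  constructor <;> rintro ⟨h1, h2⟩ <;> constructor <;> linarith

/-- Minkowski's inequality: the supremum over all strips is translation invariant, so averaging
translates with total mass at most 1 cannot increase it. -/
theorem stripSq_mconv_le [SFinite ν] (hν : ν Set.univ ≤ 1) (hf : Measurable f) :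
    stripSq (mconv ν f) ≤ stripSq f := by
  refine iSup_le fun y => ?_
  have e : (stripSq f ^ (1 / 2 : ℝ)) ^ 2 = stripSq f := by
    rw [← ENNReal.rpow_two, ← ENNReal.rpow_mul]; norm_num
  have := lintegral_sq_lintegral_le (ν := ν)
    (μ := volume.restrict ((Set.univ : Set ℝ) ×ˢ Set.Icc y (y + 1)))
    (F := fun w z => f (z - w)) (hf.comp (by fun_prop)) (n := fun _ => stripSq f ^ (1 / 2 : ℝ))
    measurable_const (fun w => by
      rw [e, lintegral_strip_translate (fun z => f z ^ 2)]
      exact le_iSup (fun y : ℝ => ∫⁻ z in Set.univ ×ˢ Set.Icc y (y + 1), f z ^ 2) _)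
  refine this.trans ?_
  rw [lintegral_const, mul_pow, e]
  calc stripSq f * ν Set.univ ^ 2 ≤ stripSq f * 1 := by
        gcongr
        exact pow_le_one₀ zero_le hν
    _ = stripSq f := mul_one _

/-- Minkowski's inequality on one slice: translation in space only moves the unit interval, so the
bounds are convolved in time alone. The space coordinate 0 on the right is arbitrary. -/
theorem slice_mconv_le [SFinite ν] (hf : Measurable f) {n : ℝ → ℝ≥0∞} (hnm : Measurable n)
    (hn : ∀ s y : ℝ, ∫⁻ x in Set.Icc y (y + 1), f (s, x) ^ 2 ≤ n s ^ 2) (t y : ℝ) :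
    ∫⁻ x in Set.Icc y (y + 1), mconv ν f (t, x) ^ 2 ≤
      (mconv ν (fun z => n z.1) (t, 0)) ^ 2 := by
  refine lintegral_sq_lintegral_le (ν := ν) (F := fun (w : ℝ × ℝ) (x : ℝ) => f ((t, x) - w)) (hf.comp (by fun_prop))
    (n := fun w => n (t - w.1)) (hnm.comp (by fun_prop)) (fun w => ?_)
  have := lintegral_Icc_translate (fun x => f (t - w.1, x) ^ 2) w.2 y
  simp only [Prod.sub_def] at this ⊢
  rw [this]
  exact hn _ _

/-- Jensen's inequality for a measure of mass at most 1, then Tonelli and translation invariance in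
time. This carries the time integrability of slice norms through a convolution. -/
theorem lintegral_rpow_mconv_le [SFinite ν] (hν : ν Set.univ ≤ 1) {n : ℝ → ℝ≥0∞}
    (hn : Measurable n) {p : ℝ} (hp : 1 ≤ p) :
    ∫⁻ t, (mconv ν (fun z => n z.1) (t, 0)) ^ p ≤ ∫⁻ t, n t ^ p := by
  have hp0 : 0 < p := by linarith
  have h1 : ∀ t, (mconv ν (fun z => n z.1) (t, 0)) ^ p ≤ ∫⁻ w, n (t - w.1) ^ p ∂ν := by
    intro t
    have h := eLpNorm'_le_eLpNorm'_mul_rpow_measure_univ (μ := ν) zero_lt_one hp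
      (f := fun w : ℝ × ℝ => n (t - w.1))
      ((hn.comp (by fun_prop)).aestronglyMeasurable)
    simp only [eLpNorm', enorm_eq_self, ENNReal.rpow_one, div_one] at h
    have h2 : mconv ν (fun z => n z.1) (t, 0) ≤ (∫⁻ w, n (t - w.1) ^ p ∂ν) ^ (1 / p) := by
      refine h.trans ?_
      calc _ ≤ (∫⁻ w, n (t - w.1) ^ p ∂ν) ^ (1 / p) * 1 := by
            gcongr
            refine ENNReal.rpow_le_one hν ?_
            rw [sub_nonneg]
            exact (div_le_one hp0).2 hp
        _ = _ := mul_one _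
    calc _ ≤ ((∫⁻ w, n (t - w.1) ^ p ∂ν) ^ (1 / p)) ^ p := ENNReal.rpow_le_rpow h2 hp0.le
      _ = _ := by rw [← ENNReal.rpow_mul, one_div_mul_cancel hp0.ne', ENNReal.rpow_one]
  calc _ ≤ ∫⁻ t : ℝ, ∫⁻ w : ℝ × ℝ, n (t - w.1) ^ p ∂ν := lintegral_mono h1
    _ = ∫⁻ w : ℝ × ℝ, (∫⁻ t : ℝ, n (t - w.1) ^ p) ∂ν := by
        refine lintegral_lintegral_swap (Measurable.aemeasurable ?_)
        exact (hn.comp (by fun_prop)).pow_const p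
    _ = ∫⁻ w, (∫⁻ t, n t ^ p) ∂ν := by
        refine lintegral_congr fun w => ?_
        exact lintegral_sub_right_eq_self (fun t => n t ^ p) w.1
    _ ≤ (∫⁻ t, n t ^ p) * 1 := by rw [lintegral_const]; gcongr
    _ = _ := mul_one _

/-- Iterated convolution powers of a measure. -/
noncomputable def convPow (κ : Measure (ℝ × ℝ)) : ℕ → Measure (ℝ × ℝ)
  | 0 => Measure.dirac 0
  | n + 1 => convPow κ n ∗ κ

theorem convPow_univ_le {κ : Measure (ℝ × ℝ)} [IsFiniteMeasure κ]
    (hκ : κ Set.univ ≤ 1 / 2) (n : ℕ) :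
    IsFiniteMeasure (convPow κ n) ∧ convPow κ n Set.univ ≤ (1 / 2) ^ n := by
  induction n with
  | zero => exact ⟨by rw [convPow]; infer_instance, by simp [convPow]⟩
  | succ n ih =>
    have := ih.1
    refine ⟨by rw [convPow]; infer_instance, ?_⟩
    have h := Measure.lintegral_conv (μ := convPow κ n) (ν := κ) (f := fun _ => 1)
      measurable_const
    simp only [lintegral_const, one_mul] at h
    rw [convPow, h, pow_succ, mul_comm]
    exact mul_le_mul' ih.2 hκ

/-- A Gronwall-type principle: a bounded solution of the linear convolution inequality
`q ≤ κ * (α + q)` is controlled by the convolution of `α` with a fixed measure. -/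
theorem exists_resolvent {κ : Measure (ℝ × ℝ)} [IsFiniteMeasure κ] (hκ : κ Set.univ ≤ 1 / 2) :
    ∃ ν : Measure (ℝ × ℝ), ν Set.univ ≤ 1 ∧ ∀ q α : ℝ × ℝ → ℝ≥0∞, Measurable q → Measurable α →
      ∀ Q : ℝ≥0∞, Q ≠ ⊤ → (∀ z, q z ≤ Q) → (∀ z, q z ≤ mconv κ (fun z => α z + q z) z) →
      ∀ z, q z ≤ mconv ν α z := by
  have hfin : ∀ n, IsFiniteMeasure (convPow κ n) := fun n => (convPow_univ_le hκ n).1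
  -- The Neumann series without its zeroth term; its mass is at most the sum of 2^{-n} over n ≥ 1.
  refine ⟨Measure.sum fun n => convPow κ (n + 1), ?_, ?_⟩
  · rw [Measure.sum_apply _ MeasurableSet.univ]
    calc ∑' n, convPow κ (n + 1) Set.univ ≤ ∑' n : ℕ, (2⁻¹ : ℝ≥0∞) ^ (n + 1) := by
          refine ENNReal.tsum_le_tsum fun n => ?_
          simpa using (convPow_univ_le hκ (n + 1)).2
      _ = 1 := by rw [ENNReal.tsum_geometric_add_one, ENNReal.one_sub_inv_two, inv_inv,
            ENNReal.inv_mul_cancel (by simp) (by simp)]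
  · intro q α hq hα Q hQ hqQ hle z
    -- The inequality is iterated n times. The remaining term is at most `Q` 2^{-n}; only the
    -- finiteness of `Q` matters, and the final bound does not depend on it.
    have hstep : ∀ n, q z ≤ (∑ i ∈ Finset.range n, mconv (convPow κ (i + 1)) α z) +
        mconv (convPow κ n) q z := by
      intro n
      induction n with
      | zero => simp [convPow, mconv]
      | succ n ih =>
        refine ih.trans ?_
        rw [Finset.sum_range_succ, add_assoc]
        gcongr
        calc mconv (convPow κ n) q z
            ≤ mconv (convPow κ n) (mconv κ fun z => α z + q z) z := mconv_mono hle z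
          _ = mconv (convPow κ (n + 1)) (fun z => α z + q z) z :=
              (mconv_conv (hα.add hq) z).symm
          _ = _ := mconv_add hα z
    have hrem : ∀ n, mconv (convPow κ n) q z ≤ Q * (1 / 2) ^ n := by
      intro n
      calc mconv (convPow κ n) q z ≤ ∫⁻ _, Q ∂(convPow κ n) := lintegral_mono fun _ => hqQ _
        _ = Q * convPow κ n Set.univ := lintegral_const _
        _ ≤ _ := by gcongr; exact (convPow_univ_le hκ n).2
    have hsum : ∀ n, ∑ i ∈ Finset.range n, mconv (convPow κ (i + 1)) α z ≤
        mconv (Measure.sum fun n => convPow κ (n + 1)) α z := by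
      intro n
      rw [mconv, lintegral_sum_measure]
      exact ENNReal.sum_le_tsum _
    have hlim : Tendsto (fun n : ℕ => mconv (Measure.sum fun n => convPow κ (n + 1)) α z +
        Q * (1 / 2) ^ n) atTop
        (𝓝 (mconv (Measure.sum fun n => convPow κ (n + 1)) α z + Q * 0)) := by
      refine tendsto_const_nhds.add (ENNReal.Tendsto.const_mul ?_ (Or.inr hQ))
      exact ENNReal.tendsto_pow_atTop_nhds_zero_of_lt_one (by norm_num)
    rw [mul_zero, add_zero] at hlim
    exact ge_of_tendsto' hlim fun n => (hstep n).trans (add_le_add (hsum n) (hrem n))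

end MeasureConvolution

/-! ### The x-derivative of the damped heat kernel -/

section HeatKernel

/-- The standard Gaussian density. -/
noncomputable def gauss (z : ℝ) : ℝ := Real.exp (-(1 / 2) * z ^ 2) / √(2 * Real.pi)

theorem hasDerivAt_gauss (z : ℝ) : HasDerivAt gauss (-(z * gauss z)) z := by
  have h := (((hasDerivAt_pow 2 z).const_mul (-(1 / 2))).exp).div_const √(2 * Real.pi)
  refine h.congr_deriv ?_
  unfold gauss
  push_cast
  ring

theorem continuous_gauss : Continuous gauss := by unfold gauss; fun_prop

theorem gauss_nonneg (z : ℝ) : 0 ≤ gauss z := by unfold gauss; positivity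

theorem integrable_gauss : Integrable gauss volume :=
  (integrable_exp_neg_mul_sq (by norm_num : (0:ℝ) < 1 / 2)).div_const _

theorem integral_gauss : ∫ z, gauss z = 1 := by
  unfold gauss
  rw [integral_div, integral_gaussian]
  rw [show Real.pi / (1 / 2) = 2 * Real.pi by ring]
  exact div_self (by positivity)

theorem integrable_mul_gauss : Integrable (fun z => z * gauss z) volume := by
  have := (integrable_mul_exp_neg_mul_sq (by norm_num : (0:ℝ) < 1 / 2)).div_const √(2 * Real.pi)
  refine this.congr (ae_of_all _ fun z => ?_)
  simp [gauss, mul_div_assoc]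

theorem isPrimitive_gauss : IsPrimitive gauss (fun z => -(z * gauss z)) :=
  IsPrimitive.of_hasDerivAt hasDerivAt_gauss (by have := continuous_gauss; fun_prop)

/-- The `x`-derivative of the heat kernel of `∂_t - μ ∂_x²`, damped by `e^{-lam t}`. -/
noncomputable def heatK (μ lam : ℝ) (z : ℝ × ℝ) : ℝ :=
  if 0 < z.1 then Real.exp (-lam * z.1) *
    ((2 * μ * z.1)⁻¹ * -(z.2 / √(2 * μ * z.1) * gauss (z.2 / √(2 * μ * z.1)))) else 0

variable {μ lam : ℝ}

theorem measurable_heatK : Measurable (heatK μ lam) := by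
  have := continuous_gauss.measurable
  unfold heatK
  refine Measurable.ite (measurableSet_lt measurable_const measurable_fst) ?_ measurable_const
  fun_prop

theorem heatK_eq_exp_mul (lam' : ℝ) (z : ℝ × ℝ) :
    heatK μ lam z = Real.exp ((lam' - lam) * z.1) * heatK μ lam' z := by
  unfold heatK
  split_ifs
  · rw [← mul_assoc (Real.exp ((lam' - lam) * z.1)), ← Real.exp_add]
    congr 2; ring
  · simp

/-- Parabolic scaling: the L¹ norm of the slice is a multiple of t^{-1/2}, integrable at 0, times
the damping, which gives integrability at infinity. The exponent 1 on t puts the right side in the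
form of a Gamma integral. -/
theorem integral_norm_heatK_slice (hμ : 0 < μ) {t : ℝ} (ht : 0 < t) :
    ∫ x, ‖heatK μ lam (t, x)‖ =
      (∫ z, |z * gauss z|) / √(2 * μ) * (t ^ (-(1 / 2) : ℝ) * Real.exp (-lam * t ^ (1 : ℝ))) := by
  have hs : 0 < 2 * μ * t := by positivity
  have hs' : 0 < √(2 * μ * t) := Real.sqrt_pos.2 hs
  have e : ∀ x, ‖heatK μ lam (t, x)‖ = Real.exp (-lam * t) * (2 * μ * t)⁻¹ *
      |x / √(2 * μ * t) * gauss (x / √(2 * μ * t))| := by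
    intro x
    simp only [heatK, ht, if_true, Real.norm_eq_abs, abs_mul, abs_neg]
    rw [abs_of_pos (Real.exp_pos _), abs_of_pos (inv_pos.2 hs)]
    ring
  simp_rw [e]
  rw [integral_const_mul,
    Measure.integral_comp_div (fun z => |z * gauss z|) √(2 * μ * t), smul_eq_mul, abs_of_pos hs',
    Real.rpow_one, Real.rpow_neg ht.le, ← Real.sqrt_eq_rpow, Real.sqrt_mul (by positivity)]
  have h1 : √(2 * μ) ^ 2 = 2 * μ := Real.sq_sqrt (by positivity)
  have h2 : √t ^ 2 = t := Real.sq_sqrt ht.le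
  have h3 : 0 < √t := Real.sqrt_pos.2 ht
  have h4 : 0 < √(2 * μ) := Real.sqrt_pos.2 (by positivity)
  rw [show (2 * μ * t)⁻¹ = (√(2 * μ) ^ 2 * √t ^ 2)⁻¹ by rw [h1, h2]]
  field_simp

theorem integrable_heatK (hμ : 0 < μ) (hlam : 0 < lam) : Integrable (heatK μ lam) volume := by
  rw [Measure.volume_eq_prod, integrable_prod_iff measurable_heatK.aestronglyMeasurable]
  constructor
  · refine ae_of_all _ fun t => ?_
    by_cases ht : 0 < t
    · have hs' : 0 < √(2 * μ * t) := Real.sqrt_pos.2 (by positivity)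
      simp only [heatK, ht, if_true]
      exact (((integrable_mul_gauss.comp_div hs'.ne').neg).const_mul _).const_mul _
    · simp [heatK, ht]
  · have h1 : IntegrableOn (fun t : ℝ => t ^ (-(1 / 2) : ℝ) * Real.exp (-lam * t ^ (1 : ℝ)))
        (Set.Ioi 0) :=
      integrableOn_rpow_mul_exp_neg_mul_rpow (by norm_num) one_pos hlam
    have h2 := (integrable_indicator_iff measurableSet_Ioi).2
      (h1.const_mul ((∫ z, |z * gauss z|) / √(2 * μ)))
    refine h2.congr (ae_of_all _ fun t => ?_)
    by_cases ht : 0 < t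
    · rw [Set.indicator_of_mem (Set.mem_Ioi.2 ht)]
      exact (integral_norm_heatK_slice hμ ht).symm
    · rw [Set.indicator_of_notMem (by simpa using ht)]
      simp [heatK, ht]

/-- Dominated convergence as the damping grows. This takes the place of an argument on short time
intervals: with strong damping a single contraction works on all of [0,T]. -/
theorem exists_integral_heatK_le (hμ : 0 < μ) {ε : ℝ} (hε : 0 < ε) :
    ∃ lam > 0, ∫ z, |heatK μ lam z| ≤ ε := by
  have h1 : Tendsto (fun n : ℕ => ∫ z, |heatK μ ((n : ℝ) + 1) z|) atTop
      (𝓝 (∫ _ : ℝ × ℝ, (0 : ℝ))) := by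
    refine tendsto_integral_of_dominated_convergence (fun z => |heatK μ 1 z|)
      (fun n => measurable_heatK.abs.aestronglyMeasurable)
      (integrable_heatK hμ one_pos).abs (fun n => ae_of_all _ fun z => ?_)
      (ae_of_all _ fun z => ?_)
    · rw [Real.norm_eq_abs, abs_abs, heatK_eq_exp_mul 1, abs_mul, Real.abs_exp]
      by_cases hz : 0 < z.1
      · refine mul_le_of_le_one_left (abs_nonneg _) (Real.exp_le_one_iff.2 ?_)
        have : (0:ℝ) ≤ n * z.1 := by positivity
        linarith
      · simp [heatK, hz]
    · by_cases hz : 0 < z.1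
      · have e : ∀ n : ℕ, |heatK μ ((n : ℝ) + 1) z| =
            Real.exp (-z.1) ^ n * |heatK μ 1 z| := by
          intro n
          rw [heatK_eq_exp_mul 1, abs_mul, Real.abs_exp, ← Real.exp_nat_mul]
          congr 2; ring
        simp_rw [e]
        rw [← zero_mul |heatK μ 1 z|]
        exact (tendsto_pow_atTop_nhds_zero_of_lt_one (Real.exp_pos _).le
          (Real.exp_lt_one_iff.2 (by linarith))).mul_const _
      · simp [heatK, hz]
  simp only [integral_zero] at h1
  obtain ⟨n, hn⟩ := (h1.eventually (gt_mem_nhds hε)).exists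
  exact ⟨(n : ℝ) + 1, by positivity, hn.le⟩

variable {φ : ℝ × ℝ → ℝ}

/-- The average of a function over the Gaussian profile of the heat kernel. -/
noncomputable def gaussAverage (μ : ℝ) (θ : ℝ × ℝ → ℝ) (s y τ : ℝ) : ℝ :=
  ∫ z, gauss z * θ (s + τ, y + √(2 * μ * τ) * z)

theorem continuous_gaussAverage {θ : ℝ × ℝ → ℝ} (hθ : Continuous θ) {C : ℝ}
    (hC : ∀ z, |θ z| ≤ C) (s y : ℝ) : Continuous (gaussAverage μ θ s y) := by
  have := continuous_gauss
  refine continuous_of_dominated (bound := fun z => gauss z * C)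
    (fun τ => (by fun_prop : Continuous fun z => gauss z *
      θ (s + τ, y + √(2 * μ * τ) * z)).aestronglyMeasurable)
    (fun τ => ae_of_all _ fun z => ?_) (integrable_gauss.mul_const C)
    (ae_of_all _ fun z => by fun_prop)
  rw [Real.norm_eq_abs, abs_mul, abs_of_nonneg (gauss_nonneg z)]
  exact mul_le_mul_of_nonneg_left (hC _) (gauss_nonneg z)

theorem hasCompactSupport_line (hc : HasCompactSupport φ) (t y : ℝ) {σ : ℝ}
    (hσ : σ ≠ 0) : HasCompactSupport fun z => φ (t, y + σ * z) := by
  obtain ⟨R, hR⟩ := hc.isCompact.isBounded.subset_closedBall 0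
  refine HasCompactSupport.of_support_subset_isCompact
    (isCompact_closedBall (0 : ℝ) ((|R| + |y|) / |σ|)) ?_
  intro z hz
  have h1 := hR (subset_tsupport φ hz)
  simp only [Metric.mem_closedBall, dist_zero_right] at h1 ⊢
  have h2 : |y + σ * z| ≤ R := (le_max_right ‖t‖ ‖y + σ * z‖).trans h1
  rw [Real.norm_eq_abs, le_div_iff₀ (abs_pos.2 hσ), ← abs_mul, mul_comm]
  have : |σ * z| ≤ |y + σ * z| + |y| := by
    have := abs_sub (y + σ * z) y
    simpa using this
  linarith [le_abs_self R]

theorem hasDerivAt_partialX_line (hφ : ContDiff ℝ ∞ φ) (t y σ z : ℝ) :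
    HasDerivAt (fun z => φ (t, y + σ * z)) (σ * partialX φ (t, y + σ * z)) z := by
  have h1 := hasDerivAt_partialX (hφ.differentiable (by simp)) t (y + σ * z)
  have h2 := h1.scomp z (((hasDerivAt_id z).const_mul σ).const_add y)
  simpa [Function.comp_def] using h2

theorem integral_gauss_mul_partialX (hφ : ContDiff ℝ ∞ φ) (hc : HasCompactSupport φ)
    (t y : ℝ) {σ : ℝ} (hσ : σ ≠ 0) :
    σ * ∫ z, gauss z * partialX φ (t, y + σ * z) = ∫ z, z * gauss z * φ (t, y + σ * z) := by
  have h := isPrimitive_gauss.integral_mul_deriv (hasDerivAt_partialX_line hφ t y σ)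
    (by have := (contDiff_partialX hφ).continuous; fun_prop) (hasCompactSupport_line hc t y hσ)
  have e1 : ∫ x, -(x * gauss x) * φ (t, y + σ * x) = - ∫ z, z * gauss z * φ (t, y + σ * z) := by
    rw [← integral_neg]; congr 1; funext z; ring
  rw [e1, neg_neg] at h
  rw [← h, ← integral_const_mul]
  congr 1; funext z; ring

theorem integrable_gauss_mul {F : ℝ → ℝ} (hF : Continuous F) {C : ℝ} (hC : ∀ z, |F z| ≤ C) :
    Integrable (fun z => gauss z * F z) volume :=
  integrable_gauss.mul_bdd hF.aestronglyMeasurable (ae_of_all _ hC)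

/-- `gaussAverage` is the heat semigroup at time τ applied to the slice of φ at time s + τ, written
in the rescaled variable, where it is regular up to τ = 0. The chain rule produces a term (μ/σ) z
∂_xφ with σ = √(2μτ), and Gaussian integration by parts turns it into μ∂_x²φ. -/
theorem hasDerivAt_gaussAverage (hμ : 0 < μ) (hφ : ContDiff ℝ ∞ φ)
    (hc : HasCompactSupport φ) (s y : ℝ) {τ : ℝ} (hτ : 0 < τ) :
    HasDerivAt (gaussAverage μ φ s y)
      (∫ z, gauss z * (partialT φ (s + τ, y + √(2 * μ * τ) * z) +
        μ * partialX (partialX φ) (s + τ, y + √(2 * μ * τ) * z))) τ := by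
  have hg := continuous_gauss
  have hφc := hφ.continuous
  have hTc := (contDiff_partialT hφ).continuous
  have hXc := (contDiff_partialX hφ).continuous
  have hXXc := (contDiff_partialX (contDiff_partialX hφ)).continuous
  obtain ⟨C, -, hC, -⟩ := exists_bound_support hφc hc
  obtain ⟨CT, -, hCT, -⟩ := exists_bound_support hTc hc.partialT
  obtain ⟨CX, -, hCX, -⟩ := exists_bound_support hXc hc.partialX
  obtain ⟨CXX, -, hCXX, -⟩ := exists_bound_support hXXc hc.partialX.partialX
  have hCX0 : 0 ≤ CX := (abs_nonneg _).trans (hCX 0)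
  have hσ : 0 < √(2 * μ * τ) := Real.sqrt_pos.2 (by positivity)
  have key := hasDerivAt_integral_of_dominated_loc_of_deriv_le (μ := (volume : Measure ℝ))
    (F := fun τ z => gauss z * φ (s + τ, y + √(2 * μ * τ) * z))
    (F' := fun τ z => gauss z * (partialT φ (s + τ, y + √(2 * μ * τ) * z) +
      μ / √(2 * μ * τ) * z * partialX φ (s + τ, y + √(2 * μ * τ) * z)))
    -- Staying above τ/2 keeps √(2μτ') at least √(μτ), which bounds the singular factor uniformly.
    (x₀ := τ) (s := Set.Ioi (τ / 2))
    (bound := fun z => gauss z * CT + μ / √(μ * τ) * CX * |z * gauss z|)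
    (Ioi_mem_nhds (by linarith))
    (Eventually.of_forall fun τ => (by fun_prop : Continuous fun z => gauss z *
      φ (s + τ, y + √(2 * μ * τ) * z)).aestronglyMeasurable)
    (integrable_gauss_mul (by fun_prop) fun z => hC _)
    (by fun_prop : Continuous fun z => gauss z * (partialT φ (s + τ, y + √(2 * μ * τ) * z) +
      μ / √(2 * μ * τ) * z * partialX φ (s + τ, y + √(2 * μ * τ) * z))).aestronglyMeasurable
    ?_ ((integrable_gauss.mul_const _).add (integrable_mul_gauss.abs.const_mul _)) ?_
  · have e : ∫ z, gauss z * (partialT φ (s + τ, y + √(2 * μ * τ) * z) +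
        μ / √(2 * μ * τ) * z * partialX φ (s + τ, y + √(2 * μ * τ) * z)) =
        ∫ z, gauss z * (partialT φ (s + τ, y + √(2 * μ * τ) * z) +
        μ * partialX (partialX φ) (s + τ, y + √(2 * μ * τ) * z)) := by
      have i1 : Integrable (fun z => gauss z * partialT φ (s + τ, y + √(2 * μ * τ) * z)) volume :=
        integrable_gauss_mul (by fun_prop) fun z => hCT _
      have i2 : Integrable (fun z => z * gauss z *
          partialX φ (s + τ, y + √(2 * μ * τ) * z)) volume :=
        integrable_mul_gauss.mul_bdd (by fun_prop : Continuous fun z =>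
          partialX φ (s + τ, y + √(2 * μ * τ) * z)).aestronglyMeasurable
          (ae_of_all _ fun z => hCX _)
      have i3 : Integrable (fun z => gauss z *
          partialX (partialX φ) (s + τ, y + √(2 * μ * τ) * z)) volume :=
        integrable_gauss_mul (by fun_prop) fun z => hCXX _
      have h1 := integral_gauss_mul_partialX (contDiff_partialX hφ) hc.partialX (s + τ) y hσ.ne'
      have e1 : ∀ z, gauss z * (partialT φ (s + τ, y + √(2 * μ * τ) * z) +
          μ / √(2 * μ * τ) * z * partialX φ (s + τ, y + √(2 * μ * τ) * z)) =
          gauss z * partialT φ (s + τ, y + √(2 * μ * τ) * z) + μ / √(2 * μ * τ) *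
            (z * gauss z * partialX φ (s + τ, y + √(2 * μ * τ) * z)) := fun z => by ring
      have e2 : ∀ z, gauss z * (partialT φ (s + τ, y + √(2 * μ * τ) * z) +
          μ * partialX (partialX φ) (s + τ, y + √(2 * μ * τ) * z)) =
          gauss z * partialT φ (s + τ, y + √(2 * μ * τ) * z) + μ *
            (gauss z * partialX (partialX φ) (s + τ, y + √(2 * μ * τ) * z)) := fun z => by ring
      simp_rw [e1, e2]
      rw [integral_add i1 (i2.const_mul _), integral_add i1 (i3.const_mul _),
        integral_const_mul, integral_const_mul, ← h1]
      field_simp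
    rw [← e]
    exact key.2
  · refine ae_of_all _ fun z τ' hτ' => ?_
    simp only [Set.mem_Ioi] at hτ'
    have h1 : √(μ * τ) ≤ √(2 * μ * τ') := Real.sqrt_le_sqrt (by nlinarith)
    have h2 : 0 < √(μ * τ) := Real.sqrt_pos.2 (by positivity)
    have h3 : μ / √(2 * μ * τ') ≤ μ / √(μ * τ) := div_le_div_of_nonneg_left hμ.le h2 h1
    rw [Real.norm_eq_abs, abs_mul, abs_of_nonneg (gauss_nonneg z)]
    have h4 : |μ / √(2 * μ * τ') * z * partialX φ (s + τ', y + √(2 * μ * τ') * z)| ≤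
        μ / √(μ * τ) * CX * |z| := by
      rw [abs_mul, abs_mul, abs_of_nonneg (by positivity : 0 ≤ μ / √(2 * μ * τ'))]
      calc μ / √(2 * μ * τ') * |z| * |partialX φ (s + τ', y + √(2 * μ * τ') * z)|
          ≤ μ / √(μ * τ) * |z| * CX := by gcongr; exact hCX _
        _ = _ := by ring
    calc gauss z * |partialT φ (s + τ', y + √(2 * μ * τ') * z) +
          μ / √(2 * μ * τ') * z * partialX φ (s + τ', y + √(2 * μ * τ') * z)|
        ≤ gauss z * (CT + μ / √(μ * τ) * CX * |z|) := by
          refine mul_le_mul_of_nonneg_left ?_ (gauss_nonneg z)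
          exact (abs_add_le _ _).trans (add_le_add (hCT _) h4)
      _ = _ := by rw [abs_mul, abs_of_nonneg (gauss_nonneg z)]; ring
  · refine ae_of_all _ fun z τ' hτ' => ?_
    simp only [Set.mem_Ioi] at hτ'
    have hpos : 0 < 2 * μ * τ' := by have : 0 < τ' := by linarith
                                     positivity
    have h1 : HasDerivAt (fun τ => √(2 * μ * τ)) (μ / √(2 * μ * τ')) τ' := by
      have := (((hasDerivAt_id τ').const_mul (2 * μ)).sqrt hpos.ne')
      refine this.congr_deriv ?_
      simp only [id]
      field_simp
    have h2 : HasDerivAt (fun τ => (s + τ, y + √(2 * μ * τ) * z))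
        ((1 : ℝ), μ / √(2 * μ * τ') * z) τ' :=
      ((hasDerivAt_id τ').const_add s).prodMk ((h1.mul_const z).const_add y)
    have h3 := ((hφ.differentiable (by simp)) (s + τ', y + √(2 * μ * τ') * z)).hasFDerivAt.comp_hasDerivAt
      τ' h2
    have h4 := h3.const_mul (gauss z)
    refine h4.congr_deriv ?_
    have : ((1 : ℝ), μ / √(2 * μ * τ') * z) = (1, 0) + (μ / √(2 * μ * τ') * z) • (0, 1) := by
      ext <;> simp
    rw [this, map_add, map_smul, smul_eq_mul]
    rfl

/-- After the substitution x = √(2μτ) z, Gaussian integration by parts moves the derivative from the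
kernel to `F`. -/
theorem integral_heatK_slice (hμ : 0 < μ) {F : ℝ × ℝ → ℝ} (hF : ContDiff ℝ ∞ F)
    (hc : HasCompactSupport F) (s y : ℝ) {τ : ℝ} (hτ : 0 < τ) :
    ∫ x, heatK μ 0 (τ, x) * F (s + τ, y + x) =
      - ∫ z, gauss z * partialX F (s + τ, y + √(2 * μ * τ) * z) := by
  have hpos : 0 < 2 * μ * τ := by positivity
  have hσ : 0 < √(2 * μ * τ) := Real.sqrt_pos.2 hpos
  have h1 := integral_gauss_mul_partialX hF hc (s + τ) y hσ.ne'
  have h2 := Measure.integral_comp_div (fun z => z * gauss z * F (s + τ, y + √(2 * μ * τ) * z))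
    √(2 * μ * τ)
  rw [← h1, smul_eq_mul, abs_of_pos hσ] at h2
  have e : ∀ x, heatK μ 0 (τ, x) * F (s + τ, y + x) = - (2 * μ * τ)⁻¹ *
      (x / √(2 * μ * τ) * gauss (x / √(2 * μ * τ)) *
        F (s + τ, y + √(2 * μ * τ) * (x / √(2 * μ * τ)))) := by
    intro x
    rw [mul_div_cancel₀ _ hσ.ne']
    simp only [heatK, hτ, if_true, neg_zero, zero_mul, Real.exp_zero, one_mul]
    ring
  simp_rw [e]
  rw [integral_const_mul, h2]
  have h3 : √(2 * μ * τ) * √(2 * μ * τ) = 2 * μ * τ := Real.mul_self_sqrt hpos.le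
  rw [← mul_assoc √(2 * μ * τ), h3]
  field_simp

/-- The kernel `heatK` is the `x`-derivative of the fundamental solution of the heat equation. -/
theorem integral_heatK_mul_heat_operator (hμ : 0 < μ) (hφ : ContDiff ℝ ∞ φ)
    (hc : HasCompactSupport φ) (s y : ℝ) :
    Integrable (fun z : ℝ × ℝ => heatK μ 0 z * (partialT φ (s + z.1, y + z.2) +
      μ * partialX (partialX φ) (s + z.1, y + z.2))) volume ∧
    ∫ z : ℝ × ℝ, heatK μ 0 z * (partialT φ (s + z.1, y + z.2) +
      μ * partialX (partialX φ) (s + z.1, y + z.2)) = partialX φ (s, y) := by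
  set F : ℝ × ℝ → ℝ := fun z => partialT φ z + μ * partialX (partialX φ) z with hFdef
  have hF : ContDiff ℝ ∞ F :=
    (contDiff_partialT hφ).add (contDiff_const.mul (contDiff_partialX (contDiff_partialX hφ)))
  have hFc : HasCompactSupport F := hc.partialT.add (hc.partialX.partialX.mul_left)
  obtain ⟨C, R, hC, hR⟩ := exists_bound_support hF.continuous hFc
  have hC0 : 0 ≤ C := (abs_nonneg _).trans (hC 0)
  have hint : Integrable (fun z : ℝ × ℝ => heatK μ 0 z * F (s + z.1, y + z.2)) volume := by
    -- The integrability of the kernel is known only with damping; since `F` vanishes for times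
    -- beyond `R`, the compensating factor e^τ stays bounded where it is needed.
    have h1 : Integrable (fun z : ℝ × ℝ => heatK μ 1 z * (Real.exp z.1 * F (s + z.1, y + z.2)))
        volume := by
      refine (integrable_heatK hμ one_pos).mul_bdd (c := Real.exp (R - s) * C)
        (by have := hF.continuous; fun_prop) (ae_of_all _ fun z => ?_)
      rw [Real.norm_eq_abs, abs_mul, Real.abs_exp]
      by_cases hz : s + z.1 ≤ R
      · exact mul_le_mul (Real.exp_le_exp.2 (by linarith)) (hC _) (abs_nonneg _)
          (Real.exp_pos _).le
      · rw [hR _ (lt_of_lt_of_le (not_le.1 hz) ((le_abs_self _).trans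
          (le_max_left ‖s + z.1‖ ‖y + z.2‖))), abs_zero, mul_zero]
        positivity
    refine h1.congr (ae_of_all _ fun z => ?_)
    simp only
    rw [heatK_eq_exp_mul (μ := μ) (lam := 0) 1 z]
    simp only [sub_zero, one_mul]
    ring
  refine ⟨hint, ?_⟩
  have hθ := contDiff_partialX hφ
  obtain ⟨Cθ, Rθ, hCθ, hRθ⟩ := exists_bound_support hθ.continuous hc.partialX
  have hFx : partialX F = fun z => partialT (partialX φ) z + μ * partialX (partialX (partialX φ)) z := by
    funext z
    rw [partialT_partialX_comm hφ]
    have h1 := hasDerivAt_partialX ((contDiff_partialT hφ).differentiable (by simp)) z.1 z.2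
    have h2 := hasDerivAt_partialX
      ((contDiff_partialX (contDiff_partialX hφ)).differentiable (by simp)) z.1 z.2
    exact (hasDerivAt_partialX (hF.differentiable (by simp)) z.1 z.2).unique
      (h1.add (h2.const_mul μ))
  -- The slice integral at time τ is minus the derivative of the Gaussian average of ∂_xφ.
  -- Integrating over τ > 0 leaves the value at τ = 0, which is ∂_xφ(s,y), because the average
  -- vanishes for large τ.
  have hJ : ∀ τ ∈ Set.Ioi (0:ℝ), HasDerivAt (gaussAverage μ (partialX φ) s y)
      (- ∫ x, heatK μ 0 (τ, x) * F (s + τ, y + x)) τ := by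
    intro τ hτ
    rw [integral_heatK_slice hμ hF hFc s y hτ, neg_neg, hFx]
    exact hasDerivAt_gaussAverage hμ hθ hc.partialX s y hτ
  rw [Measure.volume_eq_prod] at hint ⊢
  rw [integral_prod _ hint]
  have hI := hint.integral_prod_left
  have hlim : Tendsto (gaussAverage μ (partialX φ) s y) atTop (𝓝 0) := by
    refine tendsto_const_nhds.congr' ?_
    filter_upwards [eventually_gt_atTop (Rθ - s)] with τ hτ
    have : ∀ z, partialX φ (s + τ, y + √(2 * μ * τ) * z) = 0 := fun z =>
      hRθ _ (lt_of_lt_of_le (by linarith) ((le_abs_self _).trans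
        (le_max_left ‖s + τ‖ ‖y + √(2 * μ * τ) * z‖)))
    simp [gaussAverage, this]
  have h := integral_Ioi_of_hasDerivAt_of_tendsto
    (continuous_gaussAverage hθ.continuous hCθ s y).continuousWithinAt hJ hI.neg.integrableOn hlim
  rw [integral_neg, zero_sub, neg_inj] at h
  have e0 : gaussAverage μ (partialX φ) s y 0 = partialX φ (s, y) := by
    simp [gaussAverage, integral_mul_const, integral_gauss]
  rw [← e0, ← h]
  symm
  refine setIntegral_eq_integral_of_forall_compl_eq_zero fun τ hτ => ?_
  simp only [Set.mem_Ioi] at hτ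
  simp [heatK, hτ]

end HeatKernel

/-! ### Smallness of convolutions with an integrable kernel -/

section KernelConvolution

/-- Convolution of a kernel with a bounded function on the plane. -/
noncomputable def kconv (κ F : ℝ × ℝ → ℝ) (z : ℝ × ℝ) : ℝ := ∫ w, κ (z - w) * F w

variable {κ F G : ℝ × ℝ → ℝ} {C : ℝ}

theorem integrable_kconv (hκ : Integrable κ volume) (hF : Measurable F) (hC : ∀ z, |F z| ≤ C)
    (z : ℝ × ℝ) : Integrable (fun w => κ (z - w) * F w) volume :=
  (hκ.comp_sub_left z).mul_bdd hF.aestronglyMeasurable (ae_of_all _ hC)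

theorem kconv_eq (κ F : ℝ × ℝ → ℝ) (z : ℝ × ℝ) : kconv κ F z = ∫ w, κ w * F (z - w) := by
  rw [kconv, ← integral_sub_left_eq_self _ volume z]
  simp

theorem abs_kconv_le (hκ : Integrable κ volume) (hC : ∀ z, |F z| ≤ C)
    (z : ℝ × ℝ) : |kconv κ F z| ≤ (∫ w, |κ w|) * C := by
  rw [kconv_eq, ← integral_mul_const]
  refine (norm_integral_le_integral_norm (fun w => κ w * F (z - w))).trans ?_
  refine integral_mono_of_nonneg (ae_of_all _ fun w => norm_nonneg _) (hκ.abs.mul_const C)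
    (ae_of_all _ fun w => ?_)
  simp only [norm_mul, Real.norm_eq_abs]
  exact mul_le_mul_of_nonneg_left (hC _) (abs_nonneg _)

theorem kconv_sub {C' : ℝ} (hκ : Integrable κ volume) (hF : Measurable F) (hC : ∀ z, |F z| ≤ C)
    (hG : Measurable G) (hC' : ∀ z, |G z| ≤ C') (z : ℝ × ℝ) :
    kconv κ (fun w => F w - G w) z = kconv κ F z - kconv κ G z := by
  simp only [kconv]
  rw [← integral_sub (integrable_kconv hκ hF hC z) (integrable_kconv hκ hG hC' z)]
  congr 1; funext w; ring

theorem kconv_add {C' : ℝ} (hκ : Integrable κ volume) (hF : Measurable F) (hC : ∀ z, |F z| ≤ C)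
    (hG : Measurable G) (hC' : ∀ z, |G z| ≤ C') (z : ℝ × ℝ) :
    kconv κ (fun w => F w + G w) z = kconv κ F z + kconv κ G z := by
  simp only [kconv]
  rw [← integral_add (integrable_kconv hκ hF hC z) (integrable_kconv hκ hG hC' z)]
  congr 1; funext w; ring

theorem exists_integral_translate_sub_le (hκ : Integrable κ volume) {ε : ℝ} (hε : 0 < ε) :
    ∃ δ > 0, ∀ h : ℝ × ℝ, ‖h‖ < δ → ∫ w, |κ (w + h) - κ w| ≤ ε := by
  obtain ⟨g, hgc, hgκ, hgcont, hgi⟩ :=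
    hκ.exists_hasCompactSupport_integral_sub_le (show 0 < ε / 3 by positivity)
  obtain ⟨R, hR⟩ := hgc.isCompact.isBounded.subset_closedBall 0
  have hgR : ∀ z, R < ‖z‖ → g z = 0 := by
    intro z hz
    by_contra hne
    have := hR (subset_tsupport g hne)
    simp at this
    linarith
  set V := (volume (Metric.closedBall (0 : ℝ × ℝ) (R + 1))).toReal with hV
  have huc := hgc.uniformContinuous_of_continuous hgcont
  obtain ⟨δ, hδ, hδg⟩ := Metric.uniformContinuous_iff.1 huc (ε / (3 * (V + 1))) (by positivity)
  refine ⟨min δ 1, by positivity, fun h hh => ?_⟩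
  have hκh : Integrable (fun w => κ (w + h)) volume := hκ.comp_add_right h
  have hgh : Integrable (fun w => g (w + h)) volume := hgi.comp_add_right h
  have h1 : ∫ w, |g (w + h) - g w| ≤ ε / 3 := by
    rw [← setIntegral_eq_integral_of_forall_compl_eq_zero (s := Metric.closedBall 0 (R + 1))]
    · calc ∫ w in Metric.closedBall 0 (R + 1), |g (w + h) - g w|
          ≤ ∫ w in Metric.closedBall (0 : ℝ × ℝ) (R + 1), ε / (3 * (V + 1)) := by
            refine setIntegral_mono (hgh.sub hgi).abs.integrableOn
              (integrableOn_const (measure_closedBall_lt_top).ne) fun w => ?_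
            refine (hδg (a := w + h) (b := w) ?_).le
            simpa [dist_eq_norm] using lt_of_lt_of_le hh (min_le_left _ _)
        _ = V * (ε / (3 * (V + 1))) := by
            rw [setIntegral_const, smul_eq_mul, Measure.real]
        _ ≤ ε / 3 := by
            have : 0 ≤ V := ENNReal.toReal_nonneg
            rw [mul_div_assoc', div_le_div_iff₀ (by positivity) (by norm_num)]
            nlinarith
    · intro w hw
      simp only [Metric.mem_closedBall, dist_zero_right, not_le] at hw
      have h2 : ‖w‖ ≤ ‖w + h‖ + ‖h‖ := by
        have := norm_sub_le (w + h) h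
        simpa using this
      have h3 : ‖h‖ < 1 := lt_of_lt_of_le hh (min_le_right _ _)
      rw [hgR _ (by linarith), hgR w (by linarith)]
      simp
  have h2 : ∫ w, |κ (w + h) - g (w + h)| ≤ ε / 3 := by
    rw [integral_add_right_eq_self (fun w => |κ w - g w|) h]
    exact hgκ
  have h3 : ∫ w, |κ w - g w| ≤ ε / 3 := hgκ
  have i1 := (hκh.sub hgh).abs
  have i2 := (hgh.sub hgi).abs
  have i3 := (hκ.sub hgi).abs
  calc ∫ w, |κ (w + h) - κ w|
      ≤ ∫ w, (|κ (w + h) - g (w + h)| + |g (w + h) - g w| + |κ w - g w|) := by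
        refine integral_mono (hκh.sub hκ).abs ((i1.add i2).add i3) fun w => ?_
        have e : κ (w + h) - κ w = (κ (w + h) - g (w + h)) + (g (w + h) - g w) - (κ w - g w) := by
          ring
        simp only
        rw [e]
        exact (abs_sub _ _).trans (add_le_add (abs_add_le _ _) le_rfl)
    _ = (∫ w, |κ (w + h) - g (w + h)|) + (∫ w, |g (w + h) - g w|) + ∫ w, |κ w - g w| := by
        have e1 := integral_add (i1.add i2) i3
        have e2 := integral_add i1 i2
        simp only [Pi.add_apply, Pi.sub_apply] at e1 e2
        rw [e1, e2]
    _ ≤ ε := by linarith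

theorem uniformContinuous_kconv (hκ : Integrable κ volume) (hF : Measurable F)
    (hC : ∀ z, |F z| ≤ C) : UniformContinuous (kconv κ F) := by
  have hC0 : 0 ≤ C := (abs_nonneg _).trans (hC 0)
  rw [Metric.uniformContinuous_iff]
  intro ε hε
  obtain ⟨δ, hδ, h⟩ := exists_integral_translate_sub_le hκ (show 0 < ε / (2 * (C + 1)) by positivity)
  refine ⟨δ, hδ, fun {a b} hab => ?_⟩
  have e : kconv κ F a - kconv κ F b = ∫ w, (κ (b - w + (a - b)) - κ (b - w)) * F w := by
    rw [kconv, kconv, ← integral_sub (integrable_kconv hκ hF hC a) (integrable_kconv hκ hF hC b)]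
    congr 1; funext w
    rw [show b - w + (a - b) = a - w by abel]
    ring
  have hk : Integrable (fun w => κ (w + (a - b)) - κ w) volume := (hκ.comp_add_right _).sub hκ
  rw [Real.dist_eq, e]
  calc |∫ w, (κ (b - w + (a - b)) - κ (b - w)) * F w|
      ≤ ∫ w, |κ (b - w + (a - b)) - κ (b - w)| * C := by
        refine (norm_integral_le_integral_norm
          (fun w => (κ (b - w + (a - b)) - κ (b - w)) * F w)).trans ?_
        refine integral_mono_of_nonneg (ae_of_all _ fun w => norm_nonneg _)
          ((hk.comp_sub_left b).abs.mul_const C) (ae_of_all _ fun w => ?_)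
        simp only [norm_mul, Real.norm_eq_abs]
        exact mul_le_mul_of_nonneg_left (hC _) (abs_nonneg _)
    _ = (∫ w, |κ (w + (a - b)) - κ w|) * C := by
        rw [integral_mul_const, integral_sub_left_eq_self (fun w => |κ (w + (a - b)) - κ w|)]
    _ ≤ ε / (2 * (C + 1)) * C := by
        gcongr
        exact h _ (by simpa [dist_eq_norm] using hab)
    _ < ε := by
        rw [div_mul_eq_mul_div, div_lt_iff₀ (by positivity)]
        nlinarith

theorem enorm_kconv_le (hκ : AEMeasurable κ volume) (hF : Measurable F) (z : ℝ × ℝ) :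
    ‖kconv κ F z‖ₑ ≤ mconv (volume.withDensity fun w => ‖κ w‖ₑ) (fun z => ‖F z‖ₑ) z := by
  have h := lintegral_withDensity_eq_lintegral_mul₀ (μ := (volume : Measure (ℝ × ℝ))) hκ.enorm
    (g := fun w => ‖F (z - w)‖ₑ) ((hF.comp (by fun_prop)).enorm.aemeasurable)
  rw [kconv_eq, mconv, h]
  refine (enorm_integral_le_lintegral_enorm _).trans (le_of_eq ?_)
  refine lintegral_congr fun w => ?_
  simp [enorm_mul]

theorem kconv_translate (κ F : ℝ × ℝ → ℝ) (z h : ℝ × ℝ) :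
    kconv κ F (z + h) = kconv κ (fun w => F (w + h)) z := by
  rw [kconv_eq, kconv_eq]
  congr 1; funext w
  rw [add_sub_right_comm]

/-- Convolution with a fixed kernel maps functions which are bounded and small in `L¹` of strips
to uniformly small functions. -/
theorem exists_abs_kconv_le (hκ : Integrable κ volume) {M ε : ℝ} (hM : 0 ≤ M) (hε : 0 < ε) :
    ∃ R > 0, ∃ δ > 0, ∀ F : ℝ × ℝ → ℝ, Measurable F → (∀ z, |F z| ≤ M) →
      (∀ x : ℝ, ∫⁻ z in (Set.univ : Set ℝ) ×ˢ Set.Icc (x - R) (x + R), ‖F z‖ₑ ≤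
        ENNReal.ofReal δ) → ∀ z, |kconv κ F z| ≤ ε := by
  -- The kernel is split into a compactly supported bounded part, which sees only the L¹ norm of `F`
  -- on a strip, and a part of small mass, which sees only the bound `M`.
  obtain ⟨g, hgc, hgκ, hgcont, hgi⟩ :=
    hκ.exists_hasCompactSupport_integral_sub_le (show 0 < ε / (2 * (M + 1)) by positivity)
  obtain ⟨B, R, hB, hR⟩ := exists_bound_support hgcont hgc
  have hB0 : 0 ≤ B := (abs_nonneg _).trans (hB 0)
  refine ⟨|R| + 1, by positivity, ε / (2 * (B + 1)), by positivity, fun F hF hFM hsmall z => ?_⟩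
  have e : kconv κ F z = kconv (fun w => κ w - g w) F z + kconv g F z := by
    have i1 : Integrable (fun w => (κ (z - w) - g (z - w)) * F w) volume :=
      integrable_kconv (hκ.sub hgi) hF hFM z
    simp only [kconv]
    rw [← integral_add i1 (integrable_kconv hgi hF hFM z)]
    congr 1; funext w; ring
  have h1 : |kconv (fun w => κ w - g w) F z| ≤ ε / 2 := by
    refine (abs_kconv_le (hκ.sub hgi) hFM z).trans ?_
    have : (∫ w, |κ w - g w|) ≤ ε / (2 * (M + 1)) := hgκ
    calc (∫ w, |κ w - g w|) * M ≤ ε / (2 * (M + 1)) * M := by gcongr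
      _ ≤ ε / 2 := by
        rw [div_mul_eq_mul_div, div_le_div_iff₀ (by positivity) (by norm_num)]
        nlinarith
  have h2 : |kconv g F z| ≤ ε / 2 := by
    have h3 : ‖kconv g F z‖ₑ ≤ ENNReal.ofReal (ε / 2) := by
      calc ‖kconv g F z‖ₑ ≤ ∫⁻ w, ‖g (z - w) * F w‖ₑ := enorm_integral_le_lintegral_enorm _
        _ ≤ ∫⁻ w, ((Set.univ : Set ℝ) ×ˢ Set.Icc (z.2 - (|R| + 1)) (z.2 + (|R| + 1))).indicator
              (fun w => ENNReal.ofReal B * ‖F w‖ₑ) w := by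
            refine lintegral_mono fun w => ?_
            by_cases hw : w ∈ (Set.univ : Set ℝ) ×ˢ Set.Icc (z.2 - (|R| + 1)) (z.2 + (|R| + 1))
            · rw [Set.indicator_of_mem hw, enorm_mul, Real.enorm_eq_ofReal_abs (g (z - w))]
              gcongr
              exact hB _
            · rw [hR, zero_mul, enorm_zero]
              · exact zero_le
              · simp only [Set.mem_prod, Set.mem_univ, true_and, Set.mem_Icc, not_and_or,
                  not_le] at hw
                refine lt_of_lt_of_le ?_ (le_max_right ‖(z - w).1‖ ‖(z - w).2‖)
                rw [Real.norm_eq_abs, Prod.snd_sub, lt_abs]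
                rcases hw with hw | hw
                · left; linarith [le_abs_self R]
                · right; linarith [le_abs_self R]
        _ = ENNReal.ofReal B * ∫⁻ w in (Set.univ : Set ℝ) ×ˢ
              Set.Icc (z.2 - (|R| + 1)) (z.2 + (|R| + 1)), ‖F w‖ₑ := by
            rw [lintegral_indicator (MeasurableSet.univ.prod measurableSet_Icc),
              lintegral_const_mul _ hF.enorm]
        _ ≤ ENNReal.ofReal B * ENNReal.ofReal (ε / (2 * (B + 1))) := by gcongr; exact hsmall _
        _ ≤ ENNReal.ofReal (ε / 2) := by
            rw [← ENNReal.ofReal_mul hB0]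
            refine ENNReal.ofReal_le_ofReal ?_
            rw [mul_div_assoc', div_le_div_iff₀ (by positivity) (by norm_num)]
            nlinarith
    rw [Real.enorm_eq_ofReal_abs] at h3
    exact (ENNReal.ofReal_le_ofReal_iff (by positivity)).1 h3
  rw [e]
  exact (abs_add_le _ _).trans (by linarith)

/-- Convolution of a rapidly oscillating function with a fixed kernel is uniformly small. -/
theorem exists_abs_kconv_oscillation_le (hκ : Integrable κ volume) {a : ℝ × ℝ → ℝ}
    (ha : Measurable a) {M : ℝ} (hM : ∀ z, |a z| ≤ M)
    (hTC : ∀ R δ : ℝ, 0 < R → 0 < δ → ∃ τ₀ > 0, ∀ τ, 0 < τ → τ < τ₀ → ∀ x : ℝ,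
      ∫⁻ z in (Set.univ : Set ℝ) ×ˢ Set.Icc (x - R) (x + R), ‖a (z.1 + τ, z.2) - a z‖ₑ ≤
        ENNReal.ofReal δ) {ε : ℝ} (hε : 0 < ε) :
    ∃ τ₀ > 0, ∀ τ, 0 < τ → τ < τ₀ → ∀ e : ℝ → ℝ, Measurable e → (∀ s, |e s| ≤ 1) →
      (∀ s, e (s + τ) = - e s) → ∀ z, |kconv κ (fun w => e w.1 * a w) z| ≤ ε := by
  have hM0 : 0 ≤ M := (abs_nonneg _).trans (hM 0)
  obtain ⟨R, hR, δ, hδ, hsmall⟩ := exists_abs_kconv_le hκ (show 0 ≤ 2 * M by positivity) hε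
  obtain ⟨τ₁, hτ₁, h1⟩ := hTC R δ hR hδ
  obtain ⟨τ₂, hτ₂, h2⟩ := exists_integral_translate_sub_le hκ (show 0 < ε / (M + 1) by positivity)
  refine ⟨min τ₁ τ₂, by positivity, fun τ hτ hττ e he he1 heτ z => ?_⟩
  have hea : Measurable fun w : ℝ × ℝ => e w.1 * a w := (he.comp measurable_fst).mul ha
  have hb : ∀ (b : ℝ × ℝ → ℝ) (K : ℝ), (∀ w, |b w| ≤ K) → ∀ w : ℝ × ℝ, |e w.1 * b w| ≤ K := by
    intro b K hb w
    rw [abs_mul]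
    exact (mul_le_of_le_one_left (abs_nonneg _) (he1 _)).trans (hb w)
  have ha' : Measurable fun w : ℝ × ℝ => a (w.1 + τ, w.2) := ha.comp (by fun_prop)
  have hea' : Measurable fun w : ℝ × ℝ => e w.1 * a (w.1 + τ, w.2) :=
    (he.comp measurable_fst).mul ha'
  -- A shift by τ reverses the sign of e. Averaging the convolution with its shifted form gives 2
  -- κ∗(ea) = κ∗(e(a − a_τ)) + (κ − κ_τ)∗(e a_τ). The first term is small since a varies little over
  -- time τ, the second by continuity of translations in L¹.
  have e1 : kconv κ (fun w => e w.1 * a w) z =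
      - ∫ w, κ (z - w - (τ, 0)) * (e w.1 * a (w.1 + τ, w.2)) := by
    rw [kconv, ← integral_add_right_eq_self _ ((τ, 0) : ℝ × ℝ), ← integral_neg]
    congr 1; funext w
    simp only [Prod.fst_add, heτ, sub_sub]
    rw [show w + ((τ, 0) : ℝ × ℝ) = (w.1 + τ, w.2) by ext <;> simp]
    ring
  set F : ℝ × ℝ → ℝ := fun w => e w.1 * (a w - a (w.1 + τ, w.2)) with hF
  have hFm : Measurable F := (he.comp measurable_fst).mul (ha.sub ha')
  have hFM : ∀ w, |F w| ≤ 2 * M := hb _ _ fun w =>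
    (abs_sub _ _).trans (by linarith [hM w, hM (w.1 + τ, w.2)])
  have hFs : |kconv κ F z| ≤ ε := by
    refine hsmall F hFm hFM (fun x => ?_) z
    refine le_trans (lintegral_mono fun w => ?_) (h1 τ hτ (lt_of_lt_of_le hττ (min_le_left _ _)) x)
    simp only [hF]
    rw [enorm_mul, ← enorm_neg (a w - _), neg_sub]
    refine mul_le_of_le_one_left zero_le ?_
    rw [Real.enorm_eq_ofReal_abs]
    exact ENNReal.ofReal_le_one.2 (he1 _)
  set K : ℝ × ℝ → ℝ := fun w => κ w - κ (w - (τ, 0)) with hK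
  have hKi : Integrable K volume := hκ.sub (hκ.comp_sub_right _)
  have hKs : |kconv K (fun w => e w.1 * a (w.1 + τ, w.2)) z| ≤ ε := by
    refine (abs_kconv_le hKi (hb _ _ fun w => hM (w.1 + τ, w.2)) z).trans ?_
    have h3 : ∫ w, |K w| ≤ ε / (M + 1) := by
      have := h2 ((τ, 0) : ℝ × ℝ) (by
        simp [Prod.norm_def, abs_of_pos hτ, hττ.trans_le (min_le_right τ₁ τ₂), hτ₂])
      rw [← integral_sub_right_eq_self _ ((τ, 0) : ℝ × ℝ)] at this
      simpa [hK] using this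
    calc (∫ w, |K w|) * M ≤ ε / (M + 1) * M := by gcongr
      _ ≤ ε := by
        rw [div_mul_eq_mul_div, div_le_iff₀ (by positivity)]
        nlinarith
  have e2 : 2 * kconv κ (fun w => e w.1 * a w) z =
      kconv κ F z + kconv K (fun w => e w.1 * a (w.1 + τ, w.2)) z := by
    have i1 := integrable_kconv hκ hea (hb a M hM) z
    have i2 := integrable_kconv (hκ.comp_sub_right ((τ, 0) : ℝ × ℝ)) hea'
      (hb _ _ fun w => hM (w.1 + τ, w.2)) z
    rw [two_mul]
    nth_rewrite 2 [e1]
    simp only [kconv]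
    rw [← sub_eq_add_neg, ← integral_sub i1 i2,
      ← integral_add (integrable_kconv hκ hFm hFM z)
        (integrable_kconv hKi hea' (hb _ _ fun w => hM (w.1 + τ, w.2)) z)]
    congr 1; funext w
    simp only [hF, hK]
    ring
  have : |2 * kconv κ (fun w => e w.1 * a w) z| ≤ 2 * ε := by
    rw [e2]
    exact (abs_add_le _ _).trans (by linarith)
  rw [abs_mul, abs_of_pos (by norm_num : (0:ℝ) < 2)] at this
  linarith

end KernelConvolution

/-! ### Contraction for the quadratic convolution equation -/

section FixedPoint

open BoundedContinuousFunction in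
/-- A quadratic convolution equation with a kernel of small mass and a small source has a small
bounded solution. -/
theorem exists_kconv_fixedPoint {κ A B D : ℝ × ℝ → ℝ} (hκ : Integrable κ volume)
    (hA : Measurable A) (hB : Measurable B) (hD : Measurable D) {CA M L ρ : ℝ}
    (hAC : ∀ z, |A z| ≤ CA) (hBM : ∀ z, |B z| ≤ M) (hDL : ∀ z, |D z| ≤ L) (hρ : 0 < ρ)
    (hsmall : (∫ w, |κ w|) * (M + 2 * L * ρ) ≤ 1 / 2) (hAρ : ∀ z, |kconv κ A z| ≤ ρ / 2) :
    ∃ v : ℝ × ℝ → ℝ, Continuous v ∧ (∀ z, |v z| ≤ ρ) ∧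
      ∀ z, v z = kconv κ (fun w => A w - B w * v w - D w * v w ^ 2) z := by
  have hM0 : 0 ≤ M := (abs_nonneg _).trans (hBM 0)
  have hL0 : 0 ≤ L := (abs_nonneg _).trans (hDL 0)
  have hκ0 : 0 ≤ ∫ w, |κ w| := integral_nonneg fun _ => abs_nonneg _
  set N : (ℝ × ℝ → ℝ) → ℝ × ℝ → ℝ := fun v w => B w * v w + D w * v w ^ 2 with hN
  have hNm : ∀ v : ℝ × ℝ → ℝ, Continuous v → Measurable (N v) := fun v hv =>
    (hB.mul hv.measurable).add (hD.mul (hv.measurable.pow_const 2))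
  have hNb : ∀ v : ℝ × ℝ → ℝ, (∀ z, |v z| ≤ ρ) → ∀ w, |N v w| ≤ M * ρ + L * ρ ^ 2 := by
    intro v hv w
    refine (abs_add_le _ _).trans (add_le_add ?_ ?_)
    · rw [abs_mul]
      exact mul_le_mul (hBM w) (hv w) (abs_nonneg _) hM0
    · rw [abs_mul, abs_pow]
      exact mul_le_mul (hDL w) (pow_le_pow_left₀ (abs_nonneg _) (hv w) 2) (by positivity) hL0
  have hNlip : ∀ v v' : ℝ × ℝ → ℝ, (∀ z, |v z| ≤ ρ) → (∀ z, |v' z| ≤ ρ) → ∀ d : ℝ,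
      (∀ z, |v z - v' z| ≤ d) → ∀ w, |N v w - N v' w| ≤ (M + 2 * L * ρ) * d := by
    intro v v' hv hv' d hd w
    have e : N v w - N v' w = B w * (v w - v' w) + D w * ((v w + v' w) * (v w - v' w)) := by
      simp only [hN]; ring
    have hd0 : 0 ≤ d := (abs_nonneg _).trans (hd 0)
    rw [e]
    calc |B w * (v w - v' w) + D w * ((v w + v' w) * (v w - v' w))|
        ≤ |B w| * |v w - v' w| + |D w| * (|v w + v' w| * |v w - v' w|) := by
          refine (abs_add_le _ _).trans (le_of_eq ?_)
          rw [abs_mul, abs_mul, abs_mul]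
      _ ≤ M * d + L * ((2 * ρ) * d) := by
          have : |v w + v' w| ≤ 2 * ρ := (abs_add_le _ _).trans (by linarith [hv w, hv' w])
          gcongr
          · exact hBM w
          · exact hd w
          · exact hDL w
          · exact hd w
      _ = (M + 2 * L * ρ) * d := by ring
  have hval : ∀ v : ℝ × ℝ → ℝ, Continuous v → (∀ z, |v z| ≤ ρ) → ∀ z,
      kconv κ (fun w => A w - N v w) z = kconv κ A z - kconv κ (N v) z := fun v hv hvb z =>
    kconv_sub hκ hA hAC (hNm v hv) (hNb v hvb) z
  have hbound : ∀ v : ℝ × ℝ → ℝ, Continuous v → (∀ z, |v z| ≤ ρ) → ∀ z,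
      |kconv κ (fun w => A w - N v w) z| ≤ ρ := by
    intro v hv hvb z
    rw [hval v hv hvb z]
    have h1 := abs_kconv_le hκ (hNb v hvb) z
    -- The same smallness assumption serves twice: here half of ρ is left for the source, so the
    -- ball is mapped into itself, and below it gives the Lipschitz constant 1/2.
    have h2 : (∫ w, |κ w|) * (M * ρ + L * ρ ^ 2) ≤ ρ / 2 := by
      calc (∫ w, |κ w|) * (M * ρ + L * ρ ^ 2)
          ≤ (∫ w, |κ w|) * (M + 2 * L * ρ) * ρ := by
            rw [mul_assoc]
            refine mul_le_mul_of_nonneg_left ?_ hκ0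
            nlinarith [mul_nonneg hL0 (sq_nonneg ρ)]
        _ ≤ 1 / 2 * ρ := by gcongr
        _ = ρ / 2 := by ring
    exact (abs_sub _ _).trans (by linarith [hAρ z])
  let X := Metric.closedBall (0 : (ℝ × ℝ) →ᵇ ℝ) ρ
  have hX : ∀ v : X, ∀ z, |v.1 z| ≤ ρ := fun v z =>
    (v.1.norm_coe_le_norm z).trans (mem_closedBall_zero_iff.1 v.2)
  have hcont : ∀ v : X, Continuous (kconv κ (fun w => A w - N v.1 w)) := fun v =>
    (uniformContinuous_kconv hκ (hA.sub (hNm _ v.1.continuous)) (C := CA + (M * ρ + L * ρ ^ 2))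
      (fun w => (abs_sub _ _).trans (add_le_add (hAC w) (hNb _ (hX v) w)))).continuous
  let Φ : X → X := fun v => ⟨BoundedContinuousFunction.ofNormedAddCommGroup
    (kconv κ (fun w => A w - N v.1 w)) (hcont v) ρ (hbound _ v.1.continuous (hX v)), by
      rw [mem_closedBall_zero_iff]
      exact BoundedContinuousFunction.norm_ofNormedAddCommGroup_le _ hρ.le _⟩
  have hΦ : ∀ v z, (Φ v).1 z = kconv κ (fun w => A w - N v.1 w) z := fun v z => rfl
  have hcontr : ContractingWith (1 / 2) Φ := by
    refine ⟨by norm_num, LipschitzWith.of_dist_le_mul fun v v' => ?_⟩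
    rw [Subtype.dist_eq, Subtype.dist_eq, BoundedContinuousFunction.dist_le (by positivity)]
    intro z
    rw [Real.dist_eq, hΦ, hΦ, hval _ v.1.continuous (hX v), hval _ v'.1.continuous (hX v')]
    have hd : ∀ z, |v'.1 z - v.1 z| ≤ dist v.1 v'.1 := fun z => by
      rw [dist_comm, ← Real.dist_eq]
      exact BoundedContinuousFunction.dist_coe_le_dist z
    have e : kconv κ A z - kconv κ (N v.1) z - (kconv κ A z - kconv κ (N v'.1) z) =
        kconv κ (fun w => N v'.1 w - N v.1 w) z := by
      rw [kconv_sub hκ (hNm _ v'.1.continuous) (hNb _ (hX v')) (hNm _ v.1.continuous)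
        (hNb _ (hX v))]
      ring
    rw [e]
    refine (abs_kconv_le hκ (hNlip _ _ (hX v') (hX v) _ hd) z).trans ?_
    rw [← mul_assoc]
    refine mul_le_mul_of_nonneg_right (hsmall.trans (le_of_eq ?_)) dist_nonneg
    rw [NNReal.coe_div]; rfl
  have : Nonempty X := ⟨⟨0, Metric.mem_closedBall_self hρ.le⟩⟩
  have : CompleteSpace X := (Metric.isClosed_closedBall.isComplete).completeSpace_coe
  refine ⟨(hcontr.fixedPoint Φ).1, (hcontr.fixedPoint Φ).1.continuous, hX _, fun z => ?_⟩
  have h1 : Φ (hcontr.fixedPoint Φ) = hcontr.fixedPoint Φ := hcontr.fixedPoint_isFixedPt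
  have h2 := hΦ (hcontr.fixedPoint Φ) z
  rw [h1] at h2
  rw [h2]
  congr 1; funext w; simp only [hN]; ring

end FixedPoint

/-! ### Continuity in time in L¹ of windows -/

section TimeContinuity

/-- Continuity in time on `(0, T]`, tested at times of `S`, in `L¹` of windows, uniformly in the
position of the window. -/
def TimeContinuous (T : ℝ) (S : Set ℝ) (f : ℝ × ℝ → ℝ) : Prop :=
  ∀ R η : ℝ, 0 < R → 0 < η → ∀ t₀ ∈ Set.Ioc 0 T, ∃ r > 0, ∀ s ∈ S, ∀ s₀ ∈ S,
    |s - t₀| < r → |s₀ - t₀| < r →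
    ∀ x : ℝ, ∫⁻ y in Set.Icc (x - R) (x + R), ‖f (s, y) - f (s₀, y)‖ₑ ≤ ENNReal.ofReal η

variable {T : ℝ} {S : Set ℝ} {f g : ℝ × ℝ → ℝ}

theorem TimeContinuous.mul (hf : TimeContinuous T S f) (hg : TimeContinuous T S g)
    (hfm : Measurable f) (hgm : Measurable g)
    {Cf Cg : ℝ} (hfC : ∀ z, |f z| ≤ Cf) (hgC : ∀ z, |g z| ≤ Cg) :
    TimeContinuous T S (fun z => f z * g z) := by
  intro R η hR hη t₀ ht₀
  have hCf : 0 ≤ Cf := (abs_nonneg _).trans (hfC 0)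
  have hCg : 0 ≤ Cg := (abs_nonneg _).trans (hgC 0)
  obtain ⟨r₁, hr₁, h₁⟩ := hf R (η / (2 * (Cg + 1))) hR (by positivity) t₀ ht₀
  obtain ⟨r₂, hr₂, h₂⟩ := hg R (η / (2 * (Cf + 1))) hR (by positivity) t₀ ht₀
  refine ⟨min r₁ r₂, by positivity, fun s hs s₀ hs₀ hss hss₀ x => ?_⟩
  have m1 : Measurable fun y => ‖f (s, y) - f (s₀, y)‖ₑ :=
    ((hfm.comp measurable_prodMk_left).sub (hfm.comp measurable_prodMk_left)).enorm
  have m2 : Measurable fun y => ‖g (s, y) - g (s₀, y)‖ₑ :=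
    ((hgm.comp measurable_prodMk_left).sub (hgm.comp measurable_prodMk_left)).enorm
  have hen : ∀ (u C : ℝ), |u| ≤ C → ‖u‖ₑ ≤ ENNReal.ofReal C := fun u C h => by
    rw [Real.enorm_eq_ofReal_abs]; exact ENNReal.ofReal_le_ofReal h
  calc ∫⁻ y in Set.Icc (x - R) (x + R), ‖f (s, y) * g (s, y) - f (s₀, y) * g (s₀, y)‖ₑ
      ≤ ∫⁻ y in Set.Icc (x - R) (x + R), (ENNReal.ofReal Cg * ‖f (s, y) - f (s₀, y)‖ₑ +
          ENNReal.ofReal Cf * ‖g (s, y) - g (s₀, y)‖ₑ) := by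
        refine lintegral_mono fun y => ?_
        have e : f (s, y) * g (s, y) - f (s₀, y) * g (s₀, y) =
            g (s, y) * (f (s, y) - f (s₀, y)) + f (s₀, y) * (g (s, y) - g (s₀, y)) := by ring
        simp only
        rw [e]
        refine (enorm_add_le _ _).trans ?_
        rw [enorm_mul, enorm_mul]
        gcongr
        · exact hen _ _ (hgC _)
        · exact hen _ _ (hfC _)
    _ = ENNReal.ofReal Cg * (∫⁻ y in Set.Icc (x - R) (x + R), ‖f (s, y) - f (s₀, y)‖ₑ) +
          ENNReal.ofReal Cf * ∫⁻ y in Set.Icc (x - R) (x + R), ‖g (s, y) - g (s₀, y)‖ₑ := by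
        rw [lintegral_add_left (m1.const_mul _), lintegral_const_mul _ m1, lintegral_const_mul _ m2]
    _ ≤ ENNReal.ofReal Cg * ENNReal.ofReal (η / (2 * (Cg + 1))) +
          ENNReal.ofReal Cf * ENNReal.ofReal (η / (2 * (Cf + 1))) := by
        gcongr
        · exact h₁ s hs s₀ hs₀ (hss.trans_le (min_le_left _ _)) (hss₀.trans_le (min_le_left _ _)) x
        · exact h₂ s hs s₀ hs₀ (hss.trans_le (min_le_right _ _)) (hss₀.trans_le (min_le_right _ _)) x
    _ ≤ ENNReal.ofReal η := by
        rw [← ENNReal.ofReal_mul hCg, ← ENNReal.ofReal_mul hCf,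
          ← ENNReal.ofReal_add (by positivity) (by positivity)]
        refine ENNReal.ofReal_le_ofReal ?_
        have k : ∀ C : ℝ, 0 ≤ C → C * (η / (2 * (C + 1))) ≤ η / 2 := by
          intro C hC
          rw [mul_div_assoc', div_le_div_iff₀ (by positivity) (by norm_num)]
          nlinarith
        linarith [k Cg hCg, k Cf hCf]

theorem TimeContinuous.add (hf : TimeContinuous T S f) (hg : TimeContinuous T S g)
    (hfm : Measurable f) : TimeContinuous T S (fun z => f z + g z) := by
  intro R η hR hη t₀ ht₀
  obtain ⟨r₁, hr₁, h₁⟩ := hf R (η / 2) hR (by positivity) t₀ ht₀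
  obtain ⟨r₂, hr₂, h₂⟩ := hg R (η / 2) hR (by positivity) t₀ ht₀
  refine ⟨min r₁ r₂, by positivity, fun s hs s₀ hs₀ hss hss₀ x => ?_⟩
  have m1 : Measurable fun y => ‖f (s, y) - f (s₀, y)‖ₑ :=
    ((hfm.comp measurable_prodMk_left).sub (hfm.comp measurable_prodMk_left)).enorm
  calc ∫⁻ y in Set.Icc (x - R) (x + R), ‖f (s, y) + g (s, y) - (f (s₀, y) + g (s₀, y))‖ₑ
      ≤ ∫⁻ y in Set.Icc (x - R) (x + R), (‖f (s, y) - f (s₀, y)‖ₑ +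
          ‖g (s, y) - g (s₀, y)‖ₑ) := by
        refine lintegral_mono fun y => ?_
        simp only
        rw [add_sub_add_comm]
        exact enorm_add_le _ _
    _ ≤ ENNReal.ofReal (η / 2) + ENNReal.ofReal (η / 2) := by
        rw [lintegral_add_left m1]
        exact add_le_add (h₁ s hs s₀ hs₀ (hss.trans_le (min_le_left _ _)) (hss₀.trans_le (min_le_left _ _)) x)
          (h₂ s hs s₀ hs₀ (hss.trans_le (min_le_right _ _)) (hss₀.trans_le (min_le_right _ _)) x)
    _ = ENNReal.ofReal η := by
        rw [← ENNReal.ofReal_add (by positivity) (by positivity)]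
        congr 1; ring

theorem TimeContinuous.of_uniform (h : ∀ η > 0, ∀ t₀ ∈ Set.Ioc 0 T, ∃ r > 0, ∀ s s₀ : ℝ,
    |s - t₀| < r → |s₀ - t₀| < r → ∀ y, |f (s, y) - f (s₀, y)| ≤ η) : TimeContinuous T S f := by
  intro R η hR hη t₀ ht₀
  obtain ⟨r, hr, hr'⟩ := h (η / (2 * R)) (by positivity) t₀ ht₀
  refine ⟨r, hr, fun s hs s₀ hs₀ hss hss₀ x => ?_⟩
  calc ∫⁻ y in Set.Icc (x - R) (x + R), ‖f (s, y) - f (s₀, y)‖ₑ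
      ≤ ∫⁻ y in Set.Icc (x - R) (x + R), ENNReal.ofReal (η / (2 * R)) := by
        refine lintegral_mono fun y => ?_
        rw [Real.enorm_eq_ofReal_abs]
        exact ENNReal.ofReal_le_ofReal (hr' s s₀ hss hss₀ y)
    _ = ENNReal.ofReal η := by
        rw [setLIntegral_const, Real.volume_Icc, ← ENNReal.ofReal_mul (by positivity)]
        congr 1
        field_simp
        ring

/-- A bounded function which is continuous in time, cut off outside `[0, T]`, has small time
increments in `L¹` of strips. -/
theorem TimeContinuous.exists_translate_le (hf : TimeContinuous T S f) (hfm : Measurable f)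
    (hS : ∀ᵐ s, s ∈ Set.Ioc 0 T → s ∈ S) {M : ℝ} (hM : ∀ z, |f z| ≤ M) (hsupp : ∀ z : ℝ × ℝ, z.1 ∉ Set.Icc 0 T → f z = 0)
    (R δ : ℝ) (hR : 0 < R) (hδ : 0 < δ) :
    ∃ τ₀ > 0, ∀ τ, 0 < τ → τ < τ₀ → ∀ x : ℝ,
      ∫⁻ z in (Set.univ : Set ℝ) ×ˢ Set.Icc (x - R) (x + R), ‖f (z.1 + τ, z.2) - f z‖ₑ ≤
        ENNReal.ofReal δ := by
  have hM0 : 0 ≤ M := (abs_nonneg _).trans (hM 0)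
  -- Nothing is known about uniformity as t tends to 0, so an initial layer of length d is estimated
  -- by the bound `M` alone. The bad times have measure d + 2τ ≤ 2d, and each costs at most 4RM,
  -- which totals at most δ/2.
  set d := δ / (16 * R * (M + 1)) with hd
  have hd0 : 0 < d := by positivity
  set η := δ / (2 * (|T| + 1)) with hη
  have hη0 : 0 < η := by positivity
  choose! r hr hr' using fun s₀ hs₀ => hf R η hR hη0 s₀ hs₀
  -- On the compact interval [d,T] the pointwise moduli of continuity are made uniform by a Lebesgue
  -- number.
  obtain ⟨δ₁, hδ₁, hleb⟩ := lebesgue_number_lemma_of_metric (s := Set.Icc d T)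
    (c := fun s₀ : Set.Ioc (0:ℝ) T => Metric.ball s₀.1 (r s₀.1)) isCompact_Icc
    (fun _ => Metric.isOpen_ball) (fun s hs => Set.mem_iUnion.2
      ⟨⟨s, hd0.trans_le hs.1, hs.2⟩, Metric.mem_ball_self (hr s ⟨hd0.trans_le hs.1, hs.2⟩)⟩)
  refine ⟨min δ₁ (d / 2), by positivity, fun τ hτ hττ x => ?_⟩
  have hτ1 : τ < δ₁ := hττ.trans_le (min_le_left _ _)
  have hτ2 : τ < d / 2 := hττ.trans_le (min_le_right _ _)
  have hfy : ∀ s, Measurable fun y => f (s, y) := fun s => hfm.comp measurable_prodMk_left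
  have hmeas : Measurable fun z : ℝ × ℝ => ‖f (z.1 + τ, z.2) - f z‖ₑ :=
    ((hfm.comp (by fun_prop)).sub hfm).enorm
  have hvol : volume (Set.Icc (x - R) (x + R)) = ENNReal.ofReal (2 * R) := by
    rw [Real.volume_Icc]; congr 1; ring
  have htriv : ∀ s, ∫⁻ y in Set.Icc (x - R) (x + R), ‖f (s + τ, y) - f (s, y)‖ₑ ≤
      ENNReal.ofReal (4 * R * M) := by
    intro s
    calc _ ≤ ∫⁻ y in Set.Icc (x - R) (x + R), ENNReal.ofReal (2 * M) := by
          refine lintegral_mono fun y => ?_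
          rw [Real.enorm_eq_ofReal_abs]
          exact ENNReal.ofReal_le_ofReal ((abs_sub _ _).trans (by linarith [hM (s + τ, y), hM (s, y)]))
      _ = _ := by
          rw [setLIntegral_const, hvol, ← ENNReal.ofReal_mul (by positivity)]
          congr 1; ring
  have hgood : ∀ s ∈ Set.Icc d (T - τ), s ∈ S → s + τ ∈ S →
      ∫⁻ y in Set.Icc (x - R) (x + R), ‖f (s + τ, y) - f (s, y)‖ₑ ≤ ENNReal.ofReal η := by
    intro s hs hsS hsS'
    obtain ⟨⟨s₀, hs₀⟩, hball⟩ := hleb s ⟨hs.1, by linarith [hs.2]⟩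
    have h1 := hball (Metric.mem_ball_self hδ₁)
    have h2 := hball (show s + τ ∈ Metric.ball s δ₁ by
      simpa [Real.dist_eq, abs_of_pos hτ] using hτ1)
    simp only [Metric.mem_ball, Real.dist_eq] at h1 h2
    exact hr' s₀ hs₀ (s + τ) hsS' s hsS h2 h1 x
  have hS' : ∀ᵐ s, s + τ ∈ Set.Ioc 0 T → s + τ ∈ S :=
    (measurePreserving_add_right volume τ).quasiMeasurePreserving.ae hS
  have hz : ∀ s, s ∉ Set.Icc (-τ) T → ∫⁻ y in Set.Icc (x - R) (x + R),
      ‖f (s + τ, y) - f (s, y)‖ₑ = 0 := by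
    intro s hs
    have h1 : s ∉ Set.Icc 0 T := fun h => hs ⟨by linarith [h.1], h.2⟩
    have h2 : s + τ ∉ Set.Icc 0 T := fun h => hs ⟨by linarith [h.1], by linarith [h.2]⟩
    simp [hsupp (s, _) h1, hsupp (s + τ, _) h2]
  rw [Measure.volume_eq_prod, ← Measure.prod_restrict, lintegral_prod _ hmeas.aemeasurable,
    Measure.restrict_univ]
  -- Times near 0 and near `T`, where the cutoff may jump, use the trivial bound; the remaining
  -- times in [0,T] use continuity; outside [−τ,T] both terms vanish.
  calc ∫⁻ s, ∫⁻ y in Set.Icc (x - R) (x + R), ‖f (s + τ, y) - f (s, y)‖ₑ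
      ≤ ∫⁻ s, ((Set.Icc (-τ) d ∪ Set.Icc (T - τ) T).indicator
            (fun _ => ENNReal.ofReal (4 * R * M)) s +
          (Set.Icc 0 T).indicator (fun _ => ENNReal.ofReal η) s) := by
        refine lintegral_mono_ae ?_
        filter_upwards [hS, hS'] with s hsS hsS'
        by_cases h1 : s ∈ Set.Icc (-τ) T
        · by_cases h2 : s ∈ Set.Icc (-τ) d ∪ Set.Icc (T - τ) T
          · rw [Set.indicator_of_mem h2]
            exact (htriv s).trans le_self_add
          · have h3 : d < s ∧ s < T - τ := by
              simp only [Set.mem_union, Set.mem_Icc, not_or, not_and_or, not_le] at h2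
              obtain ⟨h2, h2'⟩ := h2
              refine ⟨?_, ?_⟩
              · rcases h2 with h2 | h2
                · linarith [h1.1]
                · exact h2
              · rcases h2' with h2' | h2'
                · exact h2'
                · linarith [h1.2]
            rw [Set.indicator_of_mem (show s ∈ Set.Icc 0 T from ⟨by linarith, h1.2⟩)]
            exact (hgood s ⟨h3.1.le, h3.2.le⟩ (hsS ⟨by linarith, h1.2⟩)
              (hsS' ⟨by linarith, by linarith⟩)).trans le_add_self
        · simp only [hz s h1]
          exact zero_le
    _ ≤ ENNReal.ofReal (4 * R * M) * ENNReal.ofReal (d + 2 * τ) +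
          ENNReal.ofReal η * ENNReal.ofReal T := by
        rw [lintegral_add_left (measurable_const.indicator
          (measurableSet_Icc.union measurableSet_Icc)), lintegral_indicator
          (measurableSet_Icc.union measurableSet_Icc), lintegral_indicator measurableSet_Icc,
          setLIntegral_const, setLIntegral_const, Real.volume_Icc, sub_zero]
        gcongr
        refine (measure_union_le _ _).trans ?_
        rw [Real.volume_Icc, Real.volume_Icc, ← ENNReal.ofReal_add (by linarith) (by linarith)]
        exact ENNReal.ofReal_le_ofReal (by linarith)
    _ ≤ ENNReal.ofReal (δ / 2) + ENNReal.ofReal (δ / 2) := by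
        rw [← ENNReal.ofReal_mul (by positivity), ← ENNReal.ofReal_mul (by positivity)]
        refine add_le_add (ENNReal.ofReal_le_ofReal ?_) (ENNReal.ofReal_le_ofReal ?_)
        · calc 4 * R * M * (d + 2 * τ) ≤ 4 * R * M * (2 * d) := by
                gcongr; linarith
            _ ≤ δ / 2 := by
                rw [hd]
                rw [show 4 * R * M * (2 * (δ / (16 * R * (M + 1)))) = δ / 2 * (M / (M + 1)) by
                  field_simp; ring]
                exact mul_le_of_le_one_right (by positivity)
                  ((div_le_one (by positivity)).2 (by linarith))
        · calc η * T ≤ η * (|T| + 1) := by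
                gcongr; linarith [le_abs_self T]
            _ = δ / 2 := by rw [hη]; field_simp
    _ = ENNReal.ofReal δ := by
        rw [← ENNReal.ofReal_add (by positivity) (by positivity)]; congr 1; ring

end TimeContinuity

/-! ### Uniformly local square integrability on strips -/

section StripSq

variable {f g : ℝ × ℝ → ℝ≥0∞}

theorem ennreal_add_sq_le (a b : ℝ≥0∞) : (a + b) ^ 2 ≤ 2 * a ^ 2 + 2 * b ^ 2 := by
  have := ENNReal.rpow_add_le_mul_rpow_add_rpow a b (p := 2) (by norm_num)
  simp only [ENNReal.rpow_two] at this
  refine this.trans (le_of_eq ?_)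
  norm_num
  ring

theorem stripSq_mono (h : ∀ z, f z ≤ g z) : stripSq f ≤ stripSq g :=
  iSup_mono fun _ => lintegral_mono fun z => pow_le_pow_left₀ zero_le (h z) 2

theorem stripSq_add_le (hf : Measurable f) :
    stripSq (fun z => f z + g z) ≤ 2 * stripSq f + 2 * stripSq g := by
  refine iSup_le fun y => ?_
  calc _ ≤ ∫⁻ z in Set.univ ×ˢ Set.Icc y (y + 1), (2 * f z ^ 2 + 2 * g z ^ 2) :=
        lintegral_mono fun z => ennreal_add_sq_le _ _
    _ = 2 * (∫⁻ z in Set.univ ×ˢ Set.Icc y (y + 1), f z ^ 2) +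
          2 * (∫⁻ z in Set.univ ×ˢ Set.Icc y (y + 1), g z ^ 2) := by
        rw [lintegral_add_left (by fun_prop), lintegral_const_mul _ (by fun_prop),
          lintegral_const_mul' _ _ (by simp)]
    _ ≤ _ := by
        gcongr
        · exact le_iSup (fun y : ℝ => ∫⁻ z in Set.univ ×ˢ Set.Icc y (y + 1), f z ^ 2) y
        · exact le_iSup (fun y : ℝ => ∫⁻ z in Set.univ ×ˢ Set.Icc y (y + 1), g z ^ 2) y

theorem stripSq_const_mul {c : ℝ≥0∞} (hc : c ≠ ⊤) :
    stripSq (fun z => c * f z) = c ^ 2 * stripSq f := by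
  rw [stripSq, stripSq, ENNReal.mul_iSup]
  congr 1; funext y
  rw [← lintegral_const_mul' _ _ (by simp [hc])]
  simp only [mul_pow]

theorem stripSq_lt_top_of_bounded {T C : ℝ} (h : ∀ z, f z ≤ ENNReal.ofReal C)
    (hs : ∀ z, z.1 ∉ Set.Icc 0 T → f z = 0) : stripSq f < ⊤ := by
  refine lt_of_le_of_lt (b := ENNReal.ofReal C ^ 2 * ENNReal.ofReal T) (iSup_le fun y => ?_)
    (by finiteness)
  have hm : MeasurableSet (Set.Icc 0 T ×ˢ (Set.univ : Set ℝ)) :=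
    measurableSet_Icc.prod MeasurableSet.univ
  calc _ ≤ ∫⁻ z in Set.univ ×ˢ Set.Icc y (y + 1),
        (Set.Icc 0 T ×ˢ (Set.univ : Set ℝ)).indicator (fun _ => ENNReal.ofReal C ^ 2) z := by
        refine lintegral_mono fun z => ?_
        by_cases hz : z.1 ∈ Set.Icc 0 T
        · rw [Set.indicator_of_mem (by exact ⟨hz, trivial⟩)]
          exact pow_le_pow_left₀ zero_le (h z) 2
        · simp [hs z hz]
    _ = _ := by
        rw [lintegral_indicator hm, Measure.restrict_restrict hm, setLIntegral_const,
          Set.prod_inter_prod, Set.inter_univ, Set.univ_inter, Measure.volume_eq_prod,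
          Measure.prod_prod, Real.volume_Icc, Real.volume_Icc]
        simp

/-- On a bounded box |V| ≤ 1 + |V|², and every point has a neighbourhood contained in a strip of
unit width. -/
theorem locallyIntegrable_of_stripSq_lt_top {V : ℝ × ℝ → ℝ} (hV : Measurable V)
    (h : stripSq (fun z => ‖V z‖ₑ) < ⊤) : LocallyIntegrable V volume := by
  intro z
  refine ⟨Set.Icc (z.1 - 1) (z.1 + 1) ×ˢ Set.Icc (z.2 - 1 / 2) (z.2 - 1 / 2 + 1), ?_, ?_⟩
  · rw [nhds_prod_eq]
    exact prod_mem_prod (Icc_mem_nhds (by linarith) (by linarith))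
      (Icc_mem_nhds (by linarith) (by linarith))
  · set K := Set.Icc (z.1 - 1) (z.1 + 1) ×ˢ Set.Icc (z.2 - 1 / 2) (z.2 - 1 / 2 + 1) with hK
    refine ⟨hV.aestronglyMeasurable, ?_⟩
    have hfin : IsFiniteMeasure (volume.restrict K) :=
      isFiniteMeasure_restrict.2 (isCompact_Icc.prod isCompact_Icc).measure_lt_top.ne
    calc ∫⁻ w in K, ‖V w‖ₑ ≤ ∫⁻ w in K, (1 + ‖V w‖ₑ ^ 2) := by
          refine lintegral_mono fun w => ?_
          rcases le_total ‖V w‖ₑ 1 with h1 | h1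
          · exact h1.trans le_self_add
          · refine le_trans ?_ le_add_self
            rw [sq]
            exact le_mul_of_one_le_left' h1
      _ = volume K + ∫⁻ w in K, ‖V w‖ₑ ^ 2 := by
          rw [lintegral_add_left measurable_const]; simp
      _ < ⊤ := by
          refine ENNReal.add_lt_top.2 ⟨(isCompact_Icc.prod isCompact_Icc).measure_lt_top, ?_⟩
          refine lt_of_le_of_lt ?_ h
          refine le_trans (lintegral_mono_set (Set.prod_mono_left (Set.subset_univ _)))
            (le_iSup (fun y : ℝ => ∫⁻ z in Set.univ ×ˢ Set.Icc y (y + 1), ‖V z‖ₑ ^ 2) _)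

end StripSq

/-! ### Bounded functions with an x-derivative on the slab -/

/-- `V` is the `x`-derivative of the bounded function `U`; both live on the slab and `V` is
uniformly locally square integrable there. -/
structure XDiff (T : ℝ) (U V : ℝ × ℝ → ℝ) : Prop where
  meas : Measurable U
  meas' : Measurable V
  bdd : ∃ C, ∀ z, |U z| ≤ C
  supp : ∀ z : ℝ × ℝ, z.1 ∉ Set.Icc 0 T → U z = 0
  supp' : ∀ z : ℝ × ℝ, z.1 ∉ Set.Icc 0 T → V z = 0
  strip : stripSq (fun z => ‖V z‖ₑ) < ⊤
  prim : ∀ᵐ t, ∃ F, IsPrimitive F (fun x => V (t, x)) ∧ (fun x => U (t, x)) =ᵐ[volume] F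

theorem stripSq_enorm_mul_lt_top {U V : ℝ × ℝ → ℝ} {C : ℝ} (hU : ∀ z, |U z| ≤ C)
    (hV : stripSq (fun z => ‖V z‖ₑ) < ⊤) : stripSq (fun z => ‖U z * V z‖ₑ) < ⊤ := by
  refine lt_of_le_of_lt (stripSq_mono (g := fun z => ENNReal.ofReal C * ‖V z‖ₑ) fun z => ?_) ?_
  · rw [enorm_mul, Real.enorm_eq_ofReal_abs]
    gcongr
    exact hU z
  · rw [stripSq_const_mul (by simp)]
    exact ENNReal.mul_lt_top (by simp) hV

theorem stripSq_enorm_add_lt_top {U V : ℝ × ℝ → ℝ} (hUm : Measurable U)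
    (hU : stripSq (fun z => ‖U z‖ₑ) < ⊤) (hV : stripSq (fun z => ‖V z‖ₑ) < ⊤) :
    stripSq (fun z => ‖U z + V z‖ₑ) < ⊤ := by
  refine lt_of_le_of_lt (stripSq_mono (g := fun z => ‖U z‖ₑ + ‖V z‖ₑ) fun z => enorm_add_le _ _) ?_
  refine (stripSq_add_le hUm.enorm).trans_lt ?_
  exact ENNReal.add_lt_top.2 ⟨ENNReal.mul_lt_top (by simp) hU, ENNReal.mul_lt_top (by simp) hV⟩

namespace XDiff

variable {T : ℝ} {U V U' V' : ℝ × ℝ → ℝ}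

theorem add (h : XDiff T U V) (h' : XDiff T U' V') :
    XDiff T (fun z => U z + U' z) (fun z => V z + V' z) where
  meas := h.meas.add h'.meas
  meas' := h.meas'.add h'.meas'
  bdd := by
    obtain ⟨C, hC⟩ := h.bdd
    obtain ⟨C', hC'⟩ := h'.bdd
    exact ⟨C + C', fun z => (abs_add_le _ _).trans (add_le_add (hC z) (hC' z))⟩
  supp z hz := by rw [h.supp z hz, h'.supp z hz, add_zero]
  supp' z hz := by rw [h.supp' z hz, h'.supp' z hz, add_zero]
  strip := stripSq_enorm_add_lt_top h.meas' h.strip h'.strip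
  prim := by
    filter_upwards [h.prim, h'.prim] with t ⟨F, hF, hUF⟩ ⟨F', hF', hUF'⟩
    exact ⟨_, hF.add hF', hUF.add hUF'⟩

theorem mul (h : XDiff T U V) (h' : XDiff T U' V') :
    XDiff T (fun z => U z * U' z) (fun z => U' z * V z + U z * V' z) where
  meas := h.meas.mul h'.meas
  meas' := (h'.meas.mul h.meas').add (h.meas.mul h'.meas')
  bdd := by
    obtain ⟨C, hC⟩ := h.bdd
    obtain ⟨C', hC'⟩ := h'.bdd
    refine ⟨C * C', fun z => ?_⟩
    rw [abs_mul]
    exact mul_le_mul (hC z) (hC' z) (abs_nonneg _) ((abs_nonneg _).trans (hC z))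
  supp z hz := by rw [h.supp z hz, zero_mul]
  supp' z hz := by rw [h.supp z hz, h'.supp z hz, zero_mul, zero_mul, add_zero]
  strip := by
    obtain ⟨C, hC⟩ := h.bdd
    obtain ⟨C', hC'⟩ := h'.bdd
    exact stripSq_enorm_add_lt_top (h'.meas.mul h.meas') (stripSq_enorm_mul_lt_top hC' h.strip)
      (stripSq_enorm_mul_lt_top hC h'.strip)
  prim := by
    filter_upwards [h.prim, h'.prim] with t ⟨F, hF, hUF⟩ ⟨F', hF', hUF'⟩
    refine ⟨_, ?_, hUF.mul hUF'⟩
    have hP := hF.mul hF'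
    refine ⟨hP.locInt.congr ?_, fun a b => ?_⟩
    · filter_upwards [hUF, hUF'] with x h1 h2
      rw [h1, h2]; ring
    · refine (hP.sub_eq a b).trans ?_
      apply intervalIntegral.integral_congr_ae
      filter_upwards [hUF, hUF'] with x h1 h2 _
      rw [h1, h2]; ring

theorem congr (h : XDiff T U V) (e : ∀ z, U' z = U z) : XDiff T U' V := by
  rwa [show U' = U from funext e]

theorem locallyIntegrable (h : XDiff T U V) : LocallyIntegrable V volume :=
  locallyIntegrable_of_stripSq_lt_top h.meas' h.strip

theorem locallyIntegrable' (h : XDiff T U V) : LocallyIntegrable U volume := by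
  obtain ⟨C, hC⟩ := h.bdd
  refine (locallyIntegrable_const C).mono h.meas.aestronglyMeasurable (ae_of_all _ fun z => ?_)
  exact (hC z).trans (le_abs_self C)

theorem integrable_mul (hU : LocallyIntegrable U volume) {φ : ℝ × ℝ → ℝ} (hφ : Continuous φ)
    (hc : HasCompactSupport φ) : Integrable (fun z => U z * φ z) volume := by
  obtain ⟨C, R, hC, hR⟩ := exists_bound_support hφ hc
  exact integrable_mul_of_bounded_support hU hφ.measurable hC hR

theorem slice_hasCompactSupport {φ : ℝ × ℝ → ℝ} (hφ : Continuous φ)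
    (hc : HasCompactSupport φ) (t : ℝ) : HasCompactSupport fun x => φ (t, x) := by
  obtain ⟨C, R, hC, hR⟩ := exists_bound_support hφ hc
  refine HasCompactSupport.intro (isCompact_closedBall (0 : ℝ) R) fun x hx => hR _ ?_
  have : R < ‖x‖ := by simpa using hx
  exact this.trans_le (le_max_right _ _)

/-- Integration by parts on almost every slice, then Fubini. Nothing is differentiated in time, so φ
need not vanish at times 0 and `T`. -/
theorem integral_mul_partialX (h : XDiff T U V) {φ : ℝ × ℝ → ℝ} (hφ : ContDiff ℝ ∞ φ)
    (hc : HasCompactSupport φ) : ∫ z, U z * partialX φ z = - ∫ z, V z * φ z := by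
  have i1 := integrable_mul h.locallyIntegrable' (contDiff_partialX hφ).continuous hc.partialX
  have i2 := integrable_mul h.locallyIntegrable hφ.continuous hc
  rw [Measure.volume_eq_prod] at i1 i2 ⊢
  rw [integral_prod _ i1, integral_prod _ i2, ← integral_neg]
  apply integral_congr_ae
  filter_upwards [h.prim] with t ⟨F, hF, hUF⟩
  rw [← hF.integral_mul_deriv (fun x => hasDerivAt_partialX (hφ.differentiable (by simp)) t x)
    ((contDiff_partialX hφ).continuous.comp (by fun_prop))
    (slice_hasCompactSupport hφ.continuous hc t)]
  apply integral_congr_ae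
  filter_upwards [hUF] with x hx
  rw [hx]

end XDiff

/-- Continuous functions of `(t, x)` which are bounded together with their `x`-derivative. -/
structure BddC1x (g g' : ℝ × ℝ → ℝ) : Prop where
  cont : Continuous g
  cont' : Continuous g'
  bdd : ∃ C, ∀ z, |g z| ≤ C
  bdd' : ∃ C, ∀ z, |g' z| ≤ C
  deriv : ∀ t x, HasDerivAt (fun y => g (t, y)) (g' (t, x)) x

namespace BddC1x

variable {T : ℝ} {g g' f f' : ℝ × ℝ → ℝ}

theorem add (hf : BddC1x f f') (hg : BddC1x g g') :
    BddC1x (fun z => f z + g z) (fun z => f' z + g' z) := by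
  obtain ⟨C, hC⟩ := hf.bdd
  obtain ⟨C', hC'⟩ := hf.bdd'
  obtain ⟨D, hD⟩ := hg.bdd
  obtain ⟨D', hD'⟩ := hg.bdd'
  exact ⟨hf.cont.add hg.cont, hf.cont'.add hg.cont',
    ⟨C + D, fun z => (abs_add_le _ _).trans (add_le_add (hC z) (hD z))⟩,
    ⟨C' + D', fun z => (abs_add_le _ _).trans (add_le_add (hC' z) (hD' z))⟩,
    fun t x => (hf.deriv t x).add (hg.deriv t x)⟩

theorem mul (hf : BddC1x f f') (hg : BddC1x g g') :
    BddC1x (fun z => f z * g z) (fun z => f' z * g z + f z * g' z) := by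
  obtain ⟨C, hC⟩ := hf.bdd
  obtain ⟨C', hC'⟩ := hf.bdd'
  obtain ⟨D, hD⟩ := hg.bdd
  obtain ⟨D', hD'⟩ := hg.bdd'
  have hm : ∀ {a b A B : ℝ}, |a| ≤ A → |b| ≤ B → |a * b| ≤ A * B := fun h1 h2 => by
    rw [abs_mul]; exact mul_le_mul h1 h2 (abs_nonneg _) ((abs_nonneg _).trans h1)
  exact ⟨hf.cont.mul hg.cont, (hf.cont'.mul hg.cont).add (hf.cont.mul hg.cont'),
    ⟨C * D, fun z => hm (hC z) (hD z)⟩,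
    ⟨C' * D + C * D', fun z => (abs_add_le _ _).trans
      (add_le_add (hm (hC' z) (hD z)) (hm (hC z) (hD' z)))⟩,
    fun t x => (hf.deriv t x).mul (hg.deriv t x)⟩

theorem of_time {c : ℝ → ℝ} (hc : Continuous c) {C : ℝ} (hC : ∀ t, |c t| ≤ C) :
    BddC1x (fun z => c z.1) (fun _ => 0) :=
  ⟨by fun_prop, continuous_const, ⟨C, fun z => hC _⟩, ⟨0, fun z => by simp⟩,
    fun t x => hasDerivAt_const x (c t)⟩

theorem const_mul (c : ℝ) (hg : BddC1x g g') :
    BddC1x (fun z => c * g z) (fun z => c * g' z) := by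
  have := (of_time (c := fun _ => c) continuous_const (fun _ => le_rfl)).mul hg
  simpa using this

theorem sub (hf : BddC1x f f') (hg : BddC1x g g') :
    BddC1x (fun z => f z - g z) (fun z => f' z - g' z) := by
  have := hf.add (hg.const_mul (-1))
  simpa [sub_eq_add_neg] using this

/-- Restriction to the slab. -/
theorem xDiff (T : ℝ) (hg : BddC1x g g') :
    XDiff T ((slab T).indicator g) ((slab T).indicator g') := by
  have hm : MeasurableSet (slab T) := measurableSet_Icc.prod MeasurableSet.univ
  obtain ⟨C, hC⟩ := hg.bdd
  obtain ⟨C', hC'⟩ := hg.bdd'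
  have hz : ∀ (f : ℝ × ℝ → ℝ) (z : ℝ × ℝ), z.1 ∉ Set.Icc 0 T → (slab T).indicator f z = 0 :=
    fun f z h => Set.indicator_of_notMem (fun h' => h h'.1) _
  refine ⟨hg.cont.measurable.indicator hm, hg.cont'.measurable.indicator hm, ⟨C, fun z => ?_⟩,
    hz g, hz g', ?_, ae_of_all _ fun t => ?_⟩
  · exact (norm_indicator_le_norm_self g z).trans (hC z)
  · refine stripSq_lt_top_of_bounded (T := T) (C := C') (fun z => ?_) (fun z h => by simp [hz g' z h])
    rw [Real.enorm_eq_ofReal_abs]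
    exact ENNReal.ofReal_le_ofReal ((norm_indicator_le_norm_self g' z).trans (hC' z))
  · by_cases ht : t ∈ Set.Icc 0 T
    · have h1 : ∀ (f : ℝ × ℝ → ℝ) x, (slab T).indicator f (t, x) = f (t, x) := fun f x =>
        Set.indicator_of_mem (by exact ⟨ht, trivial⟩) _
      simp only [h1]
      exact ⟨_, IsPrimitive.of_hasDerivAt (hg.deriv t) (hg.cont'.comp (by fun_prop)),
        EventuallyEq.rfl⟩
    · simp only [hz _ (t, _) ht]
      exact ⟨fun _ => 0, IsPrimitive.of_hasDerivAt (fun _ => hasDerivAt_const _ _)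
        continuous_const, EventuallyEq.rfl⟩

end BddC1x

/-! ### Difference quotients as averages of the derivative -/

section Average

/-- The uniform probability measure on the segment from `(0, -h)` to `(0, 0)`. -/
noncomputable def avgX (h : ℝ) : Measure (ℝ × ℝ) :=
  ENNReal.ofReal h⁻¹ • (volume.restrict (Set.Ioc 0 h)).map fun y : ℝ => ((0 : ℝ), -y)

theorem mconv_avgX {f : ℝ × ℝ → ℝ≥0∞} (hf : Measurable f) (h : ℝ) (z : ℝ × ℝ) :
    mconv (avgX h) f z = ENNReal.ofReal h⁻¹ * ∫⁻ y in Set.Ioc 0 h, f (z.1, z.2 + y) := by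
  rw [mconv, avgX, lintegral_smul_measure, lintegral_map (f := fun w => f (z - w)) (hf.comp (by fun_prop)) (by fun_prop),
    smul_eq_mul]
  congr 1
  refine lintegral_congr fun y => ?_
  congr 1
  ext <;> simp

theorem avgX_univ_le {h : ℝ} (hh : 0 < h) : avgX h Set.univ ≤ 1 := by
  rw [avgX, Measure.smul_apply, Measure.map_apply (by fun_prop) MeasurableSet.univ,
    Set.preimage_univ, Measure.restrict_apply_univ, Real.volume_Ioc, smul_eq_mul,
    ← ENNReal.ofReal_mul (by positivity), sub_zero, inv_mul_cancel₀ hh.ne', ENNReal.ofReal_one]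

instance (h : ℝ) : IsFiniteMeasure (avgX h) := by
  unfold avgX
  refine Measure.smul_finite _ (by simp)

/-- Difference quotients in `x` are bounded by averages of the derivative. -/
theorem XDiff.ae_enorm_difference_quotient_le {T : ℝ} {U V : ℝ × ℝ → ℝ} (hU : XDiff T U V) {h : ℝ}
    (hh : 0 < h) :
    ∀ᵐ z : ℝ × ℝ, ‖h⁻¹ * (U (z.1, z.2 + h) - U z)‖ₑ ≤ mconv (avgX h) (fun z => ‖V z‖ₑ) z := by
  have hV := hU.meas'
  have hUm := hU.meas
  have hms : MeasurableSet {z : ℝ × ℝ | ‖h⁻¹ * (U (z.1, z.2 + h) - U z)‖ₑ ≤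
      mconv (avgX h) (fun z => ‖V z‖ₑ) z} :=
    measurableSet_le (((hUm.comp (by fun_prop)).sub hUm).const_mul _).enorm
      (measurable_mconv hV.enorm)
  have := (Measure.ae_prod_mem_iff_ae_ae_mem (μ := (volume : Measure ℝ))
    (ν := (volume : Measure ℝ)) hms).2 ?_
  · exact this
  filter_upwards [hU.prim] with t ⟨F, hF, hUF⟩
  have hUF' : ∀ᵐ x, U (t, x + h) = F (x + h) :=
    (measurePreserving_add_right volume h).quasiMeasurePreserving.ae hUF
  filter_upwards [hUF, hUF'] with x h1 h2
  rw [h1, h2, mconv_avgX hV.enorm, enorm_mul, hF.sub_eq]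
  refine mul_le_mul' (by rw [Real.enorm_eq_ofReal_abs, abs_of_pos (by positivity)]) ?_
  have e : ∫ y in x..x + h, V (t, y) = ∫ y in (0:ℝ)..h, V (t, x + y) := by
    rw [intervalIntegral.integral_comp_add_left (fun y => V (t, y)) x, add_zero]
  rw [e, intervalIntegral.integral_of_le hh.le]
  exact enorm_integral_le_lintegral_enorm _

end Average

/-! ### Regularity of solutions of the convolution equation -/

section Regularity

variable {T : ℝ} {κ A B A' B' v : ℝ × ℝ → ℝ} {D : ℝ → ℝ} {β : ℝ × ℝ → ℝ≥0∞} {c M L ρ : ℝ}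

theorem enorm_le_ofReal {u C : ℝ} (h : |u| ≤ C) : ‖u‖ₑ ≤ ENNReal.ofReal C := by
  rw [Real.enorm_eq_ofReal_abs]; exact ENNReal.ofReal_le_ofReal h

/-- The increments of the right side of the integral equation for `v`. -/
theorem ae_enorm_source_difference_quotient_le (hA : XDiff T A A') (hB : XDiff T B B')
    (hM : ∀ z, |B z| ≤ M) (hL : ∀ t, |D t| ≤ L) (hc : 1 ≤ c)
    (hMc : M + 2 * L * ρ ≤ c) (hv : ∀ z, |v z| ≤ ρ)
    (hle : ∀ z, ‖A' z‖ₑ + ENNReal.ofReal ρ * ‖B' z‖ₑ ≤ β z) {h : ℝ} (hh : 0 < h) :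
    ∀ᵐ z : ℝ × ℝ, ‖h⁻¹ * ((A (z.1, z.2 + h) - B (z.1, z.2 + h) * v (z.1, z.2 + h) -
        D z.1 * v (z.1, z.2 + h) ^ 2) - (A z - B z * v z - D z.1 * v z ^ 2))‖ₑ ≤
      ENNReal.ofReal c * (mconv (avgX h) β z + ‖h⁻¹ * (v (z.1, z.2 + h) - v z)‖ₑ) := by
  have hρ : 0 ≤ ρ := (abs_nonneg _).trans (hv 0)
  have hM0 : 0 ≤ M := (abs_nonneg _).trans (hM 0)
  have hL0 : 0 ≤ L := (abs_nonneg _).trans (hL 0)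
  filter_upwards [hA.ae_enorm_difference_quotient_le hh, hB.ae_enorm_difference_quotient_le hh]
    with z h1 h2
  set z' : ℝ × ℝ := (z.1, z.2 + h) with hz'
  -- A discrete product rule: increments of the data carry coefficients 1 and v, and the increment
  -- of v carries a coefficient bounded by c. The assumption 1 ≤ c lets the single factor c stand in
  -- front of both contributions.
  have e : h⁻¹ * ((A z' - B z' * v z' - D z.1 * v z' ^ 2) - (A z - B z * v z - D z.1 * v z ^ 2)) =
      h⁻¹ * (A z' - A z) + (-v z') * (h⁻¹ * (B z' - B z)) +
        (-(B z + D z.1 * (v z' + v z))) * (h⁻¹ * (v z' - v z)) := by ring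
  have hco : |-(B z + D z.1 * (v z' + v z))| ≤ c := by
    rw [abs_neg]
    refine (abs_add_le _ _).trans (le_trans (add_le_add (hM z) ?_) hMc)
    rw [abs_mul, mul_assoc]
    calc |D z.1| * |v z' + v z| ≤ L * (2 * ρ) := by
          gcongr
          · exact hL _
          · exact (abs_add_le _ _).trans (by linarith [hv z, hv z'])
      _ = 2 * (L * ρ) := by ring
  rw [e]
  calc _ ≤ ‖h⁻¹ * (A z' - A z)‖ₑ + ENNReal.ofReal ρ * ‖h⁻¹ * (B z' - B z)‖ₑ +
        ENNReal.ofReal c * ‖h⁻¹ * (v z' - v z)‖ₑ := by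
        refine (enorm_add_le _ _).trans (add_le_add ((enorm_add_le _ _).trans ?_) ?_)
        · rw [enorm_mul (-v z')]
          gcongr
          exact enorm_le_ofReal (by rw [abs_neg]; exact hv _)
        · rw [enorm_mul (-_)]
          gcongr
          exact enorm_le_ofReal hco
    _ ≤ mconv (avgX h) (fun z => ‖A' z‖ₑ + ENNReal.ofReal ρ * ‖B' z‖ₑ) z +
          ENNReal.ofReal c * ‖h⁻¹ * (v z' - v z)‖ₑ := by
        rw [mconv_add hA.meas'.enorm, mconv_const_mul _ hB.meas'.enorm]
        gcongr
    _ ≤ mconv (avgX h) β z + ENNReal.ofReal c * ‖h⁻¹ * (v z' - v z)‖ₑ := by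
        gcongr
        exact mconv_mono hle z
    _ ≤ _ := by
        rw [mul_add]
        gcongr
        refine le_mul_of_one_le_left' ?_
        rw [← ENNReal.ofReal_one]
        exact ENNReal.ofReal_le_ofReal hc

/-- A bounded solution of a quadratic convolution equation has square integrable `x`-derivatives,
with bounds in terms of a majorant `β` of the derivatives of the data. -/
theorem deriv_of_kconv_eq (hκ : Integrable κ volume) (hA : XDiff T A A') (hB : XDiff T B B')
    (hD : Measurable D) (hβ : Measurable β) (hM : ∀ z, |B z| ≤ M) (hL : ∀ t, |D t| ≤ L)
    (hc : 1 ≤ c) (hMc : M + 2 * L * ρ ≤ c) (hκc : (∫ w, |κ w|) * c ≤ 1 / 2)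
    (hvc : Continuous v) (hv : ∀ z, |v z| ≤ ρ)
    (hveq : ∀ z, v z = kconv κ (fun w => A w - B w * v w - D w.1 * v w ^ 2) z)
    (hle : ∀ z, ‖A' z‖ₑ + ENNReal.ofReal ρ * ‖B' z‖ₑ ≤ β z) :
    Measurable (fun z : ℝ × ℝ => deriv (fun x => v (z.1, x)) z.2) ∧
    stripSq (fun z : ℝ × ℝ => ‖deriv (fun x => v (z.1, x)) z.2‖ₑ) ≤ stripSq β ∧
    ∀ n : ℝ → ℝ≥0∞, Measurable n → (∀ s y, ∫⁻ x in Set.Icc y (y + 1), β (s, x) ^ 2 ≤ n s ^ 2) →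
      ∃ N : ℝ → ℝ≥0∞, Measurable N ∧ (∀ p : ℝ, 1 ≤ p → ∫⁻ t, N t ^ p ≤ ∫⁻ t, n t ^ p) ∧
        ∀ t, N t ≠ ⊤ → IsPrimitive (fun x => v (t, x)) (deriv fun x => v (t, x)) ∧
          ∀ y, ∫⁻ x in Set.Icc y (y + 1), ‖deriv (fun x => v (t, x)) x‖ₑ ^ 2 ≤ N t ^ 2 := by
  have hρ : 0 ≤ ρ := (abs_nonneg _).trans (hv 0)
  have hc0 : 0 ≤ c := by linarith
  set E : ℝ × ℝ → ℝ := fun w => A w - B w * v w - D w.1 * v w ^ 2 with hE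
  have hAm := hA.meas
  have hBm := hB.meas
  have hEm : Measurable E := by
    have := hvc.measurable
    fun_prop
  obtain ⟨CA, hCA⟩ := hA.bdd
  have hEb : ∀ w, |E w| ≤ CA + M * ρ + L * ρ ^ 2 := by
    intro w
    refine (abs_sub _ _).trans (add_le_add ((abs_sub _ _).trans (add_le_add (hCA w) ?_)) ?_)
    · rw [abs_mul]
      exact mul_le_mul (hM w) (hv w) (abs_nonneg _) ((abs_nonneg _).trans (hM 0))
    · rw [abs_mul, abs_pow]
      exact mul_le_mul (hL _) (pow_le_pow_left₀ (abs_nonneg _) (hv w) 2) (by positivity)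
        ((abs_nonneg _).trans (hL 0))
  set κ₀ : Measure (ℝ × ℝ) := volume.withDensity fun w => ‖κ w‖ₑ with hκ₀
  have hκ₀u : κ₀ Set.univ = ENNReal.ofReal (∫ w, |κ w|) := by
    rw [hκ₀, withDensity_apply _ MeasurableSet.univ, Measure.restrict_univ]
    exact (ofReal_integral_norm_eq_lintegral_enorm hκ).symm
  have hfin : IsFiniteMeasure (ENNReal.ofReal c • κ₀) := by
    constructor
    rw [Measure.smul_apply, hκ₀u, smul_eq_mul]
    finiteness
  -- The factor c is absorbed into the measure; the assumption on the kernel is exactly that c|κ|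
  -- has mass at most 1/2.
  obtain ⟨ν, hν1, hν⟩ := exists_resolvent (κ := ENNReal.ofReal c • κ₀) (by
    rw [Measure.smul_apply, hκ₀u, smul_eq_mul, ← ENNReal.ofReal_mul hc0, mul_comm]
    refine (ENNReal.ofReal_le_ofReal hκc).trans (le_of_eq ?_)
    rw [ENNReal.ofReal_div_of_pos (by norm_num)]; simp)
  have hνfin : IsFiniteMeasure ν := ⟨hν1.trans_lt ENNReal.one_lt_top⟩
  set q : ℕ → ℝ × ℝ → ℝ := fun n z =>
    ((n : ℝ) + 1) * (v (z.1, z.2 + 1 / ((n : ℝ) + 1)) - v z) with hq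
  have hqc : ∀ n, Continuous (q n) := fun n => by simp only [hq]; fun_prop
  -- Translating the equation and subtracting gives |q| ≤ c|κ| ∗ (averaged β + |q|). For fixed n the
  -- quotient is trivially bounded by 2ρ(n+1), which is all the resolvent requires; the resulting
  -- bound is uniform in n.
  have hqle : ∀ n z, ‖q n z‖ₑ ≤ mconv ν (mconv (avgX (1 / ((n : ℝ) + 1))) β) z := by
    intro n
    set h : ℝ := 1 / ((n : ℝ) + 1) with hh
    have hh0 : 0 < h := by positivity
    have hinv : h⁻¹ = (n : ℝ) + 1 := by rw [hh, one_div, inv_inv]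
    refine hν (fun z => ‖q n z‖ₑ) _ (hqc n).measurable.enorm (measurable_mconv hβ)
      (ENNReal.ofReal (((n : ℝ) + 1) * (2 * ρ))) (by simp) (fun z => ?_) (fun z => ?_)
    · refine enorm_le_ofReal ?_
      rw [abs_mul, abs_of_pos (by positivity : (0 : ℝ) < (n : ℝ) + 1)]
      gcongr
      refine (abs_sub _ _).trans ?_
      linarith [hv z, hv (z.1, z.2 + h)]
    · have hsh : ∀ w : ℝ × ℝ, w + (0, h) = (w.1, w.2 + h) := fun w => by ext <;> simp
      have e1 : q n z = kconv κ (fun w => h⁻¹ * (E (w + (0, h)) - E w)) z := by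
        have k1 := kconv_translate κ E z (0, h)
        have k2 := kconv_sub hκ (hEm.comp (measurable_id.add_const ((0:ℝ), h)))
          (fun w => hEb (w + (0, h))) hEm hEb z
        simp only [hq]
        rw [← hsh z, hveq, hveq z, k1, hinv]
        simp only [Function.comp_def, id] at k2
        rw [← k2]
        simp only [kconv]
        rw [← integral_const_mul]
        congr 1; funext w; ring
      rw [e1]
      refine (enorm_kconv_le hκ.aestronglyMeasurable.aemeasurable
        (((hEm.comp (measurable_id.add_const ((0:ℝ), h))).sub hEm).const_mul _) z).trans ?_
      have e2 : ∀ f : ℝ × ℝ → ℝ≥0∞, mconv (ENNReal.ofReal c • κ₀) f z =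
          ENNReal.ofReal c * mconv κ₀ f z := fun f => by
        rw [mconv, lintegral_smul_measure, smul_eq_mul]; rfl
      rw [e2, ← mconv_const_mul (f := fun z => mconv (avgX h) β z + ‖q n z‖ₑ) _ ((measurable_mconv hβ).add (hqc n).measurable.enorm)]
      have hae := ae_enorm_source_difference_quotient_le hA hB hM hL hc hMc hv hle hh0
      have hae' : ∀ᵐ w : ℝ × ℝ ∂κ₀, ‖h⁻¹ * (E (z - w + (0, h)) - E (z - w))‖ₑ ≤
          ENNReal.ofReal c * (mconv (avgX h) β (z - w) + ‖q n (z - w)‖ₑ) := by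
        refine (withDensity_absolutelyContinuous _ _).ae_le ?_
        have := (Measure.measurePreserving_sub_left volume z).quasiMeasurePreserving.ae hae
        filter_upwards [this] with w hw
        rw [hsh]
        simp only [hinv] at hw
        rw [hinv]
        exact hw
      exact lintegral_mono_ae hae'
  -- Fatou's lemma transfers the bounds to the derivative. Where v is not differentiable in x,
  -- `deriv` is 0 and the inequality is trivial.
  have hlim : ∀ z : ℝ × ℝ, ‖deriv (fun x => v (z.1, x)) z.2‖ₑ ≤
      liminf (fun n => ‖q n z‖ₑ) atTop := by
    intro z
    by_cases hd : DifferentiableAt ℝ (fun x => v (z.1, x)) z.2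
    · have h0 : Tendsto (fun n : ℕ => 1 / ((n : ℝ) + 1)) atTop (𝓝[≠] 0) :=
        tendsto_nhdsWithin_iff.2 ⟨tendsto_one_div_add_atTop_nhds_zero_nat,
          Eventually.of_forall fun n => (by positivity : (1 : ℝ) / ((n : ℝ) + 1) ≠ 0)⟩
      have h1 := (hasDerivAt_iff_tendsto_slope_zero.1 hd.hasDerivAt).comp h0
      have h2 : Tendsto (fun n => q n z) atTop (𝓝 (deriv (fun x => v (z.1, x)) z.2)) := by
        refine h1.congr fun n => ?_
        simp [hq]
      exact h2.enorm.liminf_eq.ge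
    · rw [deriv_zero_of_not_differentiableAt hd]
      simp
  have hdm : Measurable (fun z : ℝ × ℝ => deriv (fun x => v (z.1, x)) z.2) :=
    measurable_deriv_with_param (f := fun t x => v (t, x)) hvc
  have hlim2 : ∀ z : ℝ × ℝ, ‖deriv (fun x => v (z.1, x)) z.2‖ₑ ^ 2 ≤
      liminf (fun n => ‖q n z‖ₑ ^ 2) atTop := by
    intro z
    refine (pow_le_pow_left₀ zero_le (hlim z) 2).trans (le_of_eq ?_)
    exact (pow_left_mono 2).map_liminf_of_continuousAt (fun n => ‖q n z‖ₑ)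
      (ENNReal.continuous_pow 2).continuousAt
  refine ⟨hdm, iSup_le fun y => ?_, fun n hn hns => ?_⟩
  · calc _ ≤ ∫⁻ z in Set.univ ×ˢ Set.Icc y (y + 1), liminf (fun n => ‖q n z‖ₑ ^ 2) atTop :=
          lintegral_mono hlim2
      _ ≤ liminf (fun n => ∫⁻ z in Set.univ ×ˢ Set.Icc y (y + 1), ‖q n z‖ₑ ^ 2) atTop :=
          lintegral_liminf_le fun n => (hqc n).measurable.enorm.pow_const 2
      _ ≤ stripSq β := by
          refine liminf_le_of_frequently_le' (Frequently.of_forall fun n => ?_)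
          refine (le_iSup (fun y : ℝ => ∫⁻ z in Set.univ ×ˢ Set.Icc y (y + 1), ‖q n z‖ₑ ^ 2)
            y).trans ?_
          exact (stripSq_mono (hqle n)).trans ((stripSq_mconv_le hν1 (measurable_mconv hβ)).trans
            (stripSq_mconv_le (avgX_univ_le (by positivity)) hβ))
  · have hnm : Measurable fun z : ℝ × ℝ => n z.1 := hn.comp measurable_fst
    -- The time profile of the data convolved with the resolvent. Where it is finite, it bounds the
    -- difference quotients of the slice in L² of unit intervals, so the slice is absolutely
    -- continuous.
    refine ⟨fun t => mconv ν (fun z => n z.1) (t, 0),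
      (measurable_mconv hnm).comp (by fun_prop), fun p hp => lintegral_rpow_mconv_le hν1 hn hp,
      fun t ht => ?_⟩
    have hsl : ∀ k y, ∫⁻ x in Set.Icc y (y + 1), ‖q k (t, x)‖ₑ ^ 2 ≤
        mconv ν (fun z => n z.1) (t, 0) ^ 2 := by
      intro k y
      refine le_trans (lintegral_mono fun x => pow_le_pow_left₀ zero_le (hqle k (t, x)) 2) ?_
      refine slice_mconv_le (measurable_mconv hβ) hn (fun s y => ?_) t y
      refine (slice_mconv_le hβ hn hns s y).trans (pow_le_pow_left₀ zero_le ?_ 2)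
      rw [mconv_avgX hnm]
      simp only [lintegral_const, Measure.restrict_apply_univ, Real.volume_Ioc, sub_zero]
      rw [mul_comm, mul_assoc, ← ENNReal.ofReal_mul (by positivity),
        mul_inv_cancel₀ (by positivity), ENNReal.ofReal_one, mul_one]
    refine ⟨IsPrimitive.of_difference_quotients (hvc.comp (by fun_prop))
      (m := (mconv ν (fun z => n z.1) (t, 0) ^ 2).toReal) (fun k y => ?_), fun y => ?_⟩
    · rw [ENNReal.ofReal_toReal (by finiteness)]
      exact hsl k y
    · calc _ ≤ ∫⁻ x in Set.Icc y (y + 1), liminf (fun k => ‖q k (t, x)‖ₑ ^ 2) atTop :=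
            lintegral_mono fun x => hlim2 (t, x)
        _ ≤ liminf (fun k => ∫⁻ x in Set.Icc y (y + 1), ‖q k (t, x)‖ₑ ^ 2) atTop :=
            lintegral_liminf_le fun k =>
              ((hqc k).measurable.comp measurable_prodMk_left).enorm.pow_const 2
        _ ≤ _ := liminf_le_of_frequently_le' (Frequently.of_forall fun k => hsl k y)

end Regularity

/-! ### The uniformly local norms -/

section UniformNorm

variable {f g F v : ℝ → ℝ}

theorem HasWeakDeriv.ae_eq (h : HasWeakDeriv 0 f g) : f =ᵐ[volume] g := by
  refine ae_eq_of_integral_contDiff_smul_eq h.1 h.2.1 fun φ hφ hc => ?_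
  have := h.2.2 φ hφ hc
  simpa [mul_comm] using this

theorem hasWeakDeriv_zero (hf : LocallyIntegrable f volume) : HasWeakDeriv 0 f f :=
  ⟨hf, hf, fun φ _ _ => by simp⟩

theorem eLpNorm_two_eq {α : Type*} [MeasurableSpace α] (ν : Measure α) (f : α → ℝ) :
    eLpNorm f 2 ν = (∫⁻ x, ‖f x‖ₑ ^ 2 ∂ν) ^ (1 / 2 : ℝ) := by
  rw [eLpNorm_eq_lintegral_rpow_enorm_toReal (by simp) (by simp)]
  simp

theorem hulNorm_zero_eq (hf : LocallyIntegrable f volume) :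
    hulNorm 0 f = ⨆ y : ℝ, eLpNorm f 2 (volume.restrict (Set.Icc y (y + 1))) := by
  refine le_antisymm ?_ (le_iInf₂ fun g hg => ?_)
  · refine (iInf₂_le (fun _ => f) (fun k hk => by
      rw [Nat.le_zero.1 hk]; exact hasWeakDeriv_zero hf)).trans (le_of_eq ?_)
    simp [eLpNorm_two_eq]
  · have h := (hg 0 le_rfl).ae_eq
    refine le_of_eq (iSup_congr fun y => ?_)
    rw [eLpNorm_congr_ae (ae_restrict_of_ae h), eLpNorm_two_eq]
    simp

theorem locallyIntegrable_of_hulNorm_ne_top {s : ℕ} (h : hulNorm s f ≠ ⊤) :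
    LocallyIntegrable f volume := by
  by_contra hf
  refine h (iInf₂_eq_top.2 fun g hg => absurd (hg 0 (Nat.zero_le _)).1 hf)

/-- Only g has to be locally integrable: if f is not, its norm is infinite and the inequality is
trivial. -/
theorem hulNorm_zero_add_le (hg : LocallyIntegrable g volume) :
    hulNorm 0 (fun x => f x + g x) ≤ hulNorm 0 f + hulNorm 0 g := by
  by_cases hf : LocallyIntegrable f volume
  · have := hulNorm_zero_eq (hf.add hg)
    simp only [Pi.add_def] at this
    rw [this, hulNorm_zero_eq hf, hulNorm_zero_eq hg]
    refine iSup_le fun y => ?_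
    refine (eLpNorm_add_le hf.aestronglyMeasurable.restrict hg.aestronglyMeasurable.restrict
      (by norm_num)).trans (add_le_add ?_ ?_)
    · exact le_iSup (fun y : ℝ => eLpNorm f 2 (volume.restrict (Set.Icc y (y + 1)))) y
    · exact le_iSup (fun y : ℝ => eLpNorm g 2 (volume.restrict (Set.Icc y (y + 1)))) y
  · have : hulNorm 0 f = ⊤ := by
      by_contra h
      exact hf (locallyIntegrable_of_hulNorm_ne_top h)
    simp [this]

theorem hulNorm_zero_le (hg : LocallyIntegrable g volume) {C : ℝ} (hC : ∀ x, |g x| ≤ C) :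
    hulNorm 0 g ≤ ENNReal.ofReal C := by
  rw [hulNorm_zero_eq hg]
  refine iSup_le fun y => ?_
  refine (eLpNorm_le_of_ae_bound (ae_of_all _ hC)).trans (le_of_eq ?_)
  simp

theorem IsPrimitive.ae_eq_of_ae_eq {G w : ℝ → ℝ} (hF : IsPrimitive F v) (hG : IsPrimitive G w)
    (h : F =ᵐ[volume] G) : v =ᵐ[volume] w := by
  have e : F = G := (hF.continuous.ae_eq_iff_eq volume hG.continuous).1 h
  subst e
  filter_upwards [hF.ae_hasDerivAt, hG.ae_hasDerivAt] with x h1 h2 using h1.unique h2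

/-- Every weak derivative admitted in the infimum agrees almost everywhere with v, because
primitives that agree almost everywhere are equal. -/
theorem lintegral_sq_le_hulNorm_one (hF : IsPrimitive F v) (hf : f =ᵐ[volume] F) (y : ℝ) :
    ∫⁻ x in Set.Icc y (y + 1), ‖v x‖ₑ ^ 2 ≤ hulNorm 1 f ^ 2 := by
  have key : (∫⁻ x in Set.Icc y (y + 1), ‖v x‖ₑ ^ 2) ^ (1 / 2 : ℝ) ≤ hulNorm 1 f := by
    refine le_iInf₂ fun g hg => ?_
    obtain ⟨G, hG, hfG⟩ := (hg 1 le_rfl).exists_isPrimitive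
    have hvg : v =ᵐ[volume] g 1 := hF.ae_eq_of_ae_eq hG (hf.symm.trans hfG)
    refine le_trans ?_ (le_iSup _ y)
    refine ENNReal.rpow_le_rpow ?_ (by norm_num)
    rw [Finset.sum_range_succ]
    refine le_trans (le_of_eq ?_) le_add_self
    apply lintegral_congr_ae
    filter_upwards [ae_restrict_of_ae hvg] with x hx
    rw [hx]
  calc _ = ((∫⁻ x in Set.Icc y (y + 1), ‖v x‖ₑ ^ 2) ^ (1 / 2 : ℝ)) ^ 2 := by
        rw [← ENNReal.rpow_two, ← ENNReal.rpow_mul]; norm_num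
    _ ≤ _ := pow_le_pow_left₀ zero_le key 2

theorem hulNorm_one_le (hF : IsPrimitive F v) (hf : f =ᵐ[volume] F) {a b : ℝ≥0∞}
    (ha : ∀ y, ∫⁻ x in Set.Icc y (y + 1), ‖f x‖ₑ ^ 2 ≤ a ^ 2)
    (hb : ∀ y, ∫⁻ x in Set.Icc y (y + 1), ‖v x‖ₑ ^ 2 ≤ b ^ 2) : hulNorm 1 f ≤ a + b := by
  have hw := hF.hasWeakDeriv hf
  refine (iInf₂_le (fun k => if k = 0 then f else v) (fun k hk => ?_)).trans
    (iSup_le fun y => ?_)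
  · rcases Nat.le_one_iff_eq_zero_or_eq_one.1 hk with rfl | rfl
    · simpa using hasWeakDeriv_zero hw.1
    · simpa using hw
  · calc _ ≤ ((a + b) ^ 2) ^ (1 / 2 : ℝ) := by
          refine ENNReal.rpow_le_rpow ?_ (by norm_num)
          simp only [Finset.sum_range_succ, Finset.range_zero, Finset.sum_empty, zero_add]
          refine (add_le_add (ha y) (hb y)).trans ?_
          rw [add_sq]
          gcongr
          exact le_self_add
      _ = a + b := by rw [← ENNReal.rpow_two, ← ENNReal.rpow_mul]; norm_num

end UniformNorm

/-! ### Regular representatives on the slab -/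

section Slab

variable {T : ℝ}

theorem measurableSet_slab (T : ℝ) : MeasurableSet (slab T) :=
  measurableSet_Icc.prod MeasurableSet.univ

theorem mem_slab {z : ℝ × ℝ} : z ∈ slab T ↔ z.1 ∈ Set.Icc 0 T := by simp [slab]

theorem restrict_slab (T : ℝ) : (volume : Measure (ℝ × ℝ)).restrict (slab T) =
    ((volume : Measure ℝ).restrict (Set.Icc 0 T)).prod volume := by
  rw [slab, Measure.volume_eq_prod, ← Measure.prod_restrict, Measure.restrict_univ]

theorem setIntegral_slab_eq {F : ℝ × ℝ → ℝ} (h : ∀ z : ℝ × ℝ, z.1 ∉ Set.Icc 0 T → F z = 0) :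
    ∫ z in slab T, F z = ∫ z, F z :=
  setIntegral_eq_integral_of_forall_compl_eq_zero fun z hz => h z (fun h' => hz (mem_slab.2 h'))

/-- `f` can be integrated against test functions. -/
def SlabLocallyIntegrable (T : ℝ) (f : ℝ → ℝ → ℝ) : Prop :=
  ∀ φ : ℝ × ℝ → ℝ, IsTestFunction T φ → IntegrableOn (fun z => f z.1 z.2 * φ z) (slab T) volume

/-- The `L²` norms of the slices of `β` on unit intervals are in `L^p` for `p < 4/3`. -/
def SliceBdd (β : ℝ × ℝ → ℝ≥0∞) : Prop :=
  ∀ p : ℝ, 1 ≤ p → p < 4 / 3 → ∃ n : ℝ → ℝ≥0∞, Measurable n ∧ ∫⁻ t, n t ^ p < ⊤ ∧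
    ∀ s y, ∫⁻ x in Set.Icc y (y + 1), β (s, x) ^ 2 ≤ n s ^ 2

theorem SliceBdd.mono {β γ : ℝ × ℝ → ℝ≥0∞} (h : SliceBdd γ) (hle : ∀ z, β z ≤ γ z) :
    SliceBdd β := fun p hp hp' => by
  obtain ⟨n, hn, hnp, hns⟩ := h p hp hp'
  exact ⟨n, hn, hnp, fun s y =>
    (lintegral_mono fun x => pow_le_pow_left₀ zero_le (hle (s, x)) 2).trans (hns s y)⟩

theorem SliceBdd.const_mul {β : ℝ × ℝ → ℝ≥0∞} (h : SliceBdd β) {c : ℝ≥0∞} (hc : c ≠ ⊤) :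
    SliceBdd fun z => c * β z := fun p hp hp' => by
  obtain ⟨n, hn, hnp, hns⟩ := h p hp hp'
  have hp0 : 0 ≤ p := by linarith
  refine ⟨fun t => c * n t, by fun_prop, ?_, fun s y => ?_⟩
  · simp only [ENNReal.mul_rpow_of_nonneg _ _ hp0]
    rw [lintegral_const_mul _ (by fun_prop)]
    exact ENNReal.mul_lt_top (ENNReal.rpow_lt_top_of_nonneg hp0 hc) hnp
  · simp only [mul_pow]
    rw [lintegral_const_mul' _ _ (by finiteness)]
    gcongr
    exact hns s y

theorem SliceBdd.add {β γ : ℝ × ℝ → ℝ≥0∞} (h : SliceBdd β) (h' : SliceBdd γ)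
    (hβ : Measurable β) : SliceBdd fun z => β z + γ z := fun p hp hp' => by
  obtain ⟨n, hn, hnp, hns⟩ := h p hp hp'
  obtain ⟨n', hn', hnp', hns'⟩ := h' p hp hp'
  have hp0 : 0 ≤ p := by linarith
  -- The factor 2 is generous: it absorbs the constants in 2n² + 2n'² ≤ (2(n + n'))².
  refine ⟨fun t => 2 * (n t + n' t), by fun_prop, ?_, fun s y => ?_⟩
  · calc _ ≤ ∫⁻ t, 2 ^ p * (2 ^ (p - 1) * (n t ^ p + n' t ^ p)) := by
          refine lintegral_mono fun t => ?_
          simp only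
          rw [ENNReal.mul_rpow_of_nonneg _ _ hp0]
          gcongr
          exact ENNReal.rpow_add_le_mul_rpow_add_rpow _ _ hp
      _ < ⊤ := by
          rw [lintegral_const_mul _ (by fun_prop), lintegral_const_mul _ (by fun_prop),
            lintegral_add_left (by fun_prop)]
          exact ENNReal.mul_lt_top (by finiteness) (ENNReal.mul_lt_top (by finiteness)
            (ENNReal.add_lt_top.2 ⟨hnp, hnp'⟩))
  · calc _ ≤ ∫⁻ x in Set.Icc y (y + 1), (2 * β (s, x) ^ 2 + 2 * γ (s, x) ^ 2) :=
          lintegral_mono fun x => ennreal_add_sq_le _ _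
      _ ≤ 2 * n s ^ 2 + 2 * n' s ^ 2 := by
          have m1 : Measurable fun x => β (s, x) ^ 2 :=
            (hβ.comp measurable_prodMk_left).pow_const 2
          rw [lintegral_add_left (m1.const_mul _), lintegral_const_mul _ m1,
            lintegral_const_mul' _ _ (by simp)]
          gcongr
          · exact hns s y
          · exact hns' s y
      _ ≤ (2 * (n s + n' s)) ^ 2 := by
          have e : (2 * (n s + n' s)) ^ 2 = (2 * n s ^ 2 + 2 * n' s ^ 2) +
            (2 * n s ^ 2 + 2 * n' s ^ 2 + 8 * (n s * n' s)) := by ring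
          rw [e]
          exact le_self_add

theorem sliceBdd_of_bounded {β : ℝ × ℝ → ℝ≥0∞} {C : ℝ} (h : ∀ z, β z ≤ ENNReal.ofReal C)
    (hs : ∀ z, z.1 ∉ Set.Icc 0 T → β z = 0) : SliceBdd β := fun p hp hp' => by
  have hp0 : 0 < p := by linarith
  refine ⟨(Set.Icc 0 T).indicator fun _ => ENNReal.ofReal C,
    measurable_const.indicator measurableSet_Icc, ?_, fun s y => ?_⟩
  · calc _ = ∫⁻ t, (Set.Icc 0 T).indicator (fun _ => ENNReal.ofReal C ^ p) t := by
          refine lintegral_congr fun t => ?_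
          by_cases ht : t ∈ Set.Icc 0 T
          · rw [Set.indicator_of_mem ht, Set.indicator_of_mem ht]
          · rw [Set.indicator_of_notMem ht, Set.indicator_of_notMem ht,
              ENNReal.zero_rpow_of_pos hp0]
      _ < ⊤ := by
          rw [lintegral_indicator measurableSet_Icc, setLIntegral_const, Real.volume_Icc]
          exact ENNReal.mul_lt_top (ENNReal.rpow_lt_top_of_nonneg hp0.le (by simp)) (by simp)
  · by_cases hst : s ∈ Set.Icc 0 T
    · rw [Set.indicator_of_mem hst]
      calc _ ≤ ∫⁻ x in Set.Icc y (y + 1), ENNReal.ofReal C ^ 2 :=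
            lintegral_mono fun x => pow_le_pow_left₀ zero_le (h _) 2
        _ = _ := by simp
    · simp [hs (s, _) hst]

/-- `U` and `V` represent `u` and `∂_x u`, with all the bounds required of a solution. -/
structure RegularRep (T : ℝ) (u : ℝ → ℝ → ℝ) (U V : ℝ × ℝ → ℝ) : Prop extends XDiff T U V where
  slices : SliceBdd fun z => ‖V z‖ₑ
  ae_eq : (fun z : ℝ × ℝ => u z.1 z.2) =ᵐ[volume.restrict (slab T)] U

namespace RegularRep

variable {u : ℝ → ℝ → ℝ} {U V : ℝ × ℝ → ℝ}

theorem ae_slice_eq (h : RegularRep T u U V) :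
    ∀ᵐ t ∂volume.restrict (Set.Icc 0 T), u t =ᵐ[volume] fun x => U (t, x) := by
  have := h.ae_eq
  rw [restrict_slab] at this
  exact Measure.ae_ae_of_ae_prod this

theorem memLp_top (h : RegularRep T u U V) :
    MemLp (fun z : ℝ × ℝ => u z.1 z.2) ⊤ (volume.restrict (slab T)) := by
  obtain ⟨C, hC⟩ := h.bdd
  exact (memLp_congr_ae h.ae_eq).2
    (memLp_top_of_bound h.meas.aestronglyMeasurable C (ae_of_all _ hC))

theorem memLpHul (h : RegularRep T u U V) {p : ℝ} (hp : 1 ≤ p) (hp' : p < 4 / 3) :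
    MemLpHul (ENNReal.ofReal p) 1 T u := by
  obtain ⟨C, hC⟩ := h.bdd
  obtain ⟨n, hn, hnp, hns⟩ := h.slices p hp hp'
  have hp0 : 0 < p := by linarith
  refine ⟨h.memLp_top.1, fun t => (ENNReal.ofReal C + n t).toReal, ⟨?_, ?_⟩, ?_⟩
  · exact (measurable_const.add hn).ennreal_toReal.aestronglyMeasurable
  · refine (eLpNorm_lt_top_iff_lintegral_rpow_enorm_lt_top (by simpa using hp0) (by simp)).2 ?_
    rw [ENNReal.toReal_ofReal hp0.le]
    calc _ ≤ ∫⁻ t in Set.Icc 0 T, 2 ^ (p - 1) * (ENNReal.ofReal C ^ p + n t ^ p) := by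
          refine lintegral_mono fun t => ?_
          refine le_trans (ENNReal.rpow_le_rpow ?_ hp0.le)
            (ENNReal.rpow_add_le_mul_rpow_add_rpow _ _ hp)
          rw [Real.enorm_eq_ofReal ENNReal.toReal_nonneg]
          exact ENNReal.ofReal_toReal_le
      _ < ⊤ := by
          rw [lintegral_const_mul _ (by fun_prop), lintegral_add_left (by fun_prop),
            setLIntegral_const, Real.volume_Icc]
          refine ENNReal.mul_lt_top (by finiteness) (ENNReal.add_lt_top.2 ⟨?_, ?_⟩)
          · exact ENNReal.mul_lt_top (ENNReal.rpow_lt_top_of_nonneg hp0.le (by simp)) (by simp)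
          · exact (setLIntegral_le_lintegral _ _).trans_lt hnp
  · have hfin : ∀ᵐ t, n t < ⊤ := by
      filter_upwards [ae_lt_top (hn.pow_const p) hnp.ne] with t ht
      exact (ENNReal.rpow_lt_top_iff_of_pos hp0).1 ht
    filter_upwards [ae_restrict_of_ae hfin, h.ae_slice_eq, ae_restrict_of_ae h.prim]
      with t h1 h2 ⟨F, hF, hUF⟩
    rw [ENNReal.ofReal_toReal (by finiteness)]
    refine hulNorm_one_le hF (h2.trans hUF) (fun y => ?_) (hns t)
    calc _ ≤ ∫⁻ x in Set.Icc y (y + 1), ENNReal.ofReal C ^ 2 := by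
          refine lintegral_mono_ae ?_
          filter_upwards [ae_restrict_of_ae h2] with x hx
          rw [hx]
          exact pow_le_pow_left₀ zero_le (enorm_le_ofReal (hC _)) 2
      _ = _ := by simp

theorem hasSquareIntegrableWeakDerivX (h : RegularRep T u U V) :
    HasSquareIntegrableWeakDerivX T u (fun t x => V (t, x)) := by
  refine ⟨h.meas'.aestronglyMeasurable, ?_, fun φ hφ => ?_⟩
  · refine lt_of_le_of_lt (iSup_mono fun y => ?_) h.strip
    exact lintegral_mono_set (Set.prod_mono_left (Set.subset_univ _))
  · have e : ∫ z in slab T, u z.1 z.2 * deriv (fun x => φ (z.1, x)) z.2 =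
        ∫ z in slab T, U z * partialX φ z := by
      apply integral_congr_ae
      filter_upwards [h.ae_eq] with z hz
      rw [hz, (hasDerivAt_partialX (hφ.1.differentiable (by simp)) z.1 z.2).deriv]
    rw [e, setIntegral_slab_eq (fun z hz => by rw [h.supp z hz, zero_mul]),
      h.integral_mul_partialX hφ.1 hφ.2.1,
      setIntegral_slab_eq (fun z hz => mul_eq_zero_of_left (h.supp' z hz) _)]

theorem add {u' : ℝ → ℝ → ℝ} {U' V' : ℝ × ℝ → ℝ} (h : RegularRep T u U V)
    (h' : RegularRep T u' U' V') :
    RegularRep T (fun t x => u t x + u' t x) (fun z => U z + U' z) (fun z => V z + V' z) where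
  toXDiff := h.toXDiff.add h'.toXDiff
  slices := (h.slices.add h'.slices h.meas'.enorm).mono fun z => enorm_add_le _ _
  ae_eq := by
    filter_upwards [h.ae_eq, h'.ae_eq] with z h1 h2
    rw [h1, h2]

end RegularRep

theorem BddC1x.regularRep {g g' : ℝ × ℝ → ℝ} (hg : BddC1x g g') (T : ℝ) :
    RegularRep T (fun t x => g (t, x)) ((slab T).indicator g) ((slab T).indicator g') where
  toXDiff := hg.xDiff T
  slices := by
    obtain ⟨C, hC⟩ := hg.bdd'
    refine sliceBdd_of_bounded (T := T) (C := C) (fun z => enorm_le_ofReal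
      ((norm_indicator_le_norm_self g' z).trans (hC z))) (fun z hz => ?_)
    rw [Set.indicator_of_notMem (fun h => hz (mem_slab.1 h)), enorm_zero]
  ae_eq := by
    filter_upwards [ae_restrict_mem (measurableSet_slab T)] with z hz
    rw [Set.indicator_of_mem hz]

end Slab

/-! ### Conservation form of the equation -/

section Solutions

variable {μ T : ℝ} {f : ℝ → ℝ → ℝ} {u₀ : ℝ → ℝ} {u : ℝ → ℝ → ℝ} {U V g g' : ℝ × ℝ → ℝ}

/-- With W = U + g, the product rule on slices makes 2W∂_xW the derivative of W²; integration by
parts then gives half of it. -/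
theorem XDiff.integral_nonlinearity (hU : XDiff T U V) (hg : BddC1x g g') {φ : ℝ × ℝ → ℝ}
    (hφ : IsTestFunction T φ) :
    IntegrableOn (fun z => (U z + g z) * (V z + g' z) * φ z) (slab T) volume ∧
    ∫ z in slab T, (U z + g z) * (V z + g' z) * φ z =
      - ∫ z in slab T, (U z + g z) ^ 2 / 2 * partialX φ z := by
  have hW := hU.add (hg.xDiff T)
  have hP := hW.mul hW
  have hm := measurableSet_slab T
  have key := hP.integral_mul_partialX hφ.1 hφ.2.1
  have hint := XDiff.integrable_mul hP.locallyIntegrable hφ.1.continuous hφ.2.1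
  rw [← setIntegral_slab_eq (T := T) (fun z hz => by rw [hP.supp z hz, zero_mul]),
    ← setIntegral_slab_eq (T := T) (fun z hz => mul_eq_zero_of_left (hP.supp' z hz) _)] at key
  refine ⟨?_, ?_⟩
  · refine (IntegrableOn.congr_fun (hint.integrableOn.const_mul (1 / 2)) (fun z hz => ?_) hm)
    simp only [Set.indicator_of_mem hz]
    ring
  · have e1 : ∫ z in slab T, (U z + g z) * (V z + g' z) * φ z = 1 / 2 * ∫ z in slab T,
        ((U z + (slab T).indicator g z) * (V z + (slab T).indicator g' z) +
          (U z + (slab T).indicator g z) * (V z + (slab T).indicator g' z)) * φ z := by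
      rw [← integral_const_mul]
      refine setIntegral_congr_fun hm fun z hz => ?_
      simp only [Set.indicator_of_mem hz]
      ring
    have e2 : ∫ z in slab T, (U z + g z) ^ 2 / 2 * partialX φ z = 1 / 2 * ∫ z in slab T,
        (U z + (slab T).indicator g z) * (U z + (slab T).indicator g z) * partialX φ z := by
      rw [← integral_const_mul]
      refine setIntegral_congr_fun hm fun z hz => ?_
      simp only [Set.indicator_of_mem hz]
      ring
    rw [e1, e2, key]
    ring

/-- The weak formulation with all derivatives on the test function. -/
def FluxForm (μ T : ℝ) (f : ℝ → ℝ → ℝ) (g U : ℝ × ℝ → ℝ) : Prop :=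
  ∀ φ : ℝ × ℝ → ℝ, IsTestFunction T φ →
    ∫ z in slab T, (- U z * partialT φ z - μ * (U z + g z) * partialX (partialX φ) z -
      (U z + g z) ^ 2 / 2 * partialX φ z) = ∫ z in slab T, f z.1 z.2 * φ z

theorem integrableOn_bounded_mul {ψ : ℝ × ℝ → ℝ} (hU : LocallyIntegrable U volume)
    (hψ : Continuous ψ) (hc : HasCompactSupport ψ) :
    IntegrableOn (fun z => U z * ψ z) (slab T) volume :=
  (XDiff.integrable_mul hU hψ hc).integrableOn

theorem XDiff.fluxForm_identity (hU : XDiff T U V) (hg : BddC1x g g') (huU : (fun z : ℝ × ℝ =>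
    u z.1 z.2) =ᵐ[volume.restrict (slab T)] U) {v : ℝ → ℝ → ℝ} (hvV : (fun z : ℝ × ℝ =>
    v z.1 z.2) =ᵐ[volume.restrict (slab T)] V) {k : ℝ → ℝ → ℝ}
    (hk : ∀ t ∈ Set.Icc 0 T, ∀ x, k t x = g (t, x)) {φ : ℝ × ℝ → ℝ} (hφ : IsTestFunction T φ) :
    ∫ z in slab T, (- u z.1 z.2 * deriv (fun t => φ (t, z.2)) z.1
          - μ * (u z.1 z.2 + k z.1 z.2) * iteratedDeriv 2 (fun x => φ (z.1, x)) z.2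
          + (u z.1 z.2 + k z.1 z.2) * (v z.1 z.2 + deriv (k z.1) z.2) * φ z) =
    ∫ z in slab T, (- U z * partialT φ z - μ * (U z + g z) * partialX (partialX φ) z -
      (U z + g z) ^ 2 / 2 * partialX φ z) := by
  have hd := hφ.1.differentiable (by simp)
  have hT := contDiff_partialT hφ.1
  have hX := contDiff_partialX hφ.1
  have hXX := contDiff_partialX hX
  have hUl := hU.locallyIntegrable'
  have hgl : LocallyIntegrable g volume := hg.cont.locallyIntegrable
  have e1 : ∀ᵐ z ∂volume.restrict (slab T), (- u z.1 z.2 * deriv (fun t => φ (t, z.2)) z.1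
          - μ * (u z.1 z.2 + k z.1 z.2) * iteratedDeriv 2 (fun x => φ (z.1, x)) z.2
          + (u z.1 z.2 + k z.1 z.2) * (v z.1 z.2 + deriv (k z.1) z.2) * φ z) =
      (- U z * partialT φ z - μ * (U z + g z) * partialX (partialX φ) z) +
        (U z + g z) * (V z + g' z) * φ z := by
    filter_upwards [huU, hvV, ae_restrict_mem (measurableSet_slab T)] with z h1 h2 hz
    have hk' : k z.1 = fun x => g (z.1, x) := funext fun x => hk z.1 (mem_slab.1 hz) x
    rw [h1, h2, (hasDerivAt_partialT hd z.1 z.2).deriv, iteratedDeriv_two_eq_partialX hφ.1, hk',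
      (hg.deriv z.1 z.2).deriv]
  have i1 : IntegrableOn (fun z => - U z * partialT φ z -
      μ * (U z + g z) * partialX (partialX φ) z) (slab T) volume := by
    refine Integrable.sub ?_ ?_
    · exact integrableOn_bounded_mul hUl.neg hT.continuous hφ.2.1.partialT
    · have := integrableOn_bounded_mul (T := T) ((hUl.add hgl).smul μ) hXX.continuous
        hφ.2.1.partialX.partialX
      exact this
  have i2 : IntegrableOn (fun z => (U z + g z) ^ 2 / 2 * partialX φ z) (slab T) volume := by
    obtain ⟨C, hC⟩ := hU.bdd
    obtain ⟨D, hD⟩ := hg.bdd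
    refine integrableOn_bounded_mul (LocallyIntegrable.mono (locallyIntegrable_const ((C + D) ^ 2 / 2))
      (by have := hU.meas; have := hg.cont.measurable; fun_prop) (ae_of_all _ fun z => ?_))
      hX.continuous hφ.2.1.partialX
    rw [norm_div, norm_pow]
    refine le_trans ?_ (le_abs_self _)
    rw [Real.norm_eq_abs, Real.norm_eq_abs, abs_of_pos (by norm_num : (0 : ℝ) < 2)]
    gcongr
    exact (abs_add_le _ _).trans (add_le_add (hC z) (hD z))
  obtain ⟨i3, h3⟩ := hU.integral_nonlinearity hg hφ
  rw [integral_congr_ae e1, integral_add i1 i3, h3, integral_sub i1 i2, sub_eq_add_neg]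

/-- A sufficient set of conditions for being a solution. -/
theorem RegularRep.isBurgersSolution (h : RegularRep T u U V) (hu : MemCStarWithInitial T u₀ u)
    (hg : BddC1x g g') {k : ℝ → ℝ → ℝ} (hk : ∀ t ∈ Set.Icc 0 T, ∀ x, k t x = g (t, x))
    (hflux : FluxForm μ T f g U) : IsBurgersSolution μ T f k u₀ u := by
  refine ⟨h.memLp_top, hu, fun p hp hp' => h.memLpHul hp hp', fun t x => V (t, x),
    h.hasSquareIntegrableWeakDerivX, fun φ hφ => ?_⟩
  exact (h.toXDiff.fluxForm_identity (v := fun t x => V (t, x)) hg h.ae_eq EventuallyEq.rfl hk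
    hφ).trans (hflux φ hφ)

/-- Solutions have regular representatives. -/
theorem IsBurgersSolution.exists_regularRep {k : ℝ → ℝ → ℝ} (hu : IsBurgersSolution μ T f k u₀ u)
    {M : ℝ} (hM : ∀ᵐ z ∂volume.restrict (slab T), |u z.1 z.2| ≤ M) (hM0 : 0 ≤ M) :
    ∃ U V, RegularRep T u U V ∧ (∀ z, |U z| ≤ M) ∧
      ∀ g g', BddC1x g g' → (∀ t ∈ Set.Icc 0 T, ∀ x, k t x = g (t, x)) → FluxForm μ T f g U := by
  obtain ⟨hu1, hu2, hu3, v, ⟨hv1, hv2, hv3⟩, hu4⟩ := hu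
  have hm := measurableSet_slab T
  -- Truncation at ±M makes the bound valid at every point rather than almost everywhere, without
  -- changing the class of the function on the slab.
  set U : ℝ × ℝ → ℝ := (slab T).indicator fun z => max (-M) (min M (hu1.1.mk _ z)) with hU
  set V : ℝ × ℝ → ℝ := (slab T).indicator (hv1.mk _) with hV
  have hUm : Measurable U := (measurable_const.max
    (measurable_const.min hu1.1.stronglyMeasurable_mk.measurable)).indicator hm
  have hVm : Measurable V := hv1.stronglyMeasurable_mk.measurable.indicator hm
  have hUM : ∀ z, |U z| ≤ M := by
    intro z
    by_cases hz : z ∈ slab T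
    · rw [hU, Set.indicator_of_mem hz, abs_le]
      exact ⟨le_max_left _ _, max_le (by linarith) (min_le_left _ _)⟩
    · rw [hU, Set.indicator_of_notMem hz, abs_zero]; exact hM0
  have hs : ∀ (F : ℝ × ℝ → ℝ) (z : ℝ × ℝ), z.1 ∉ Set.Icc 0 T → (slab T).indicator F z = 0 :=
    fun F z hz => Set.indicator_of_notMem (fun h => hz (mem_slab.1 h)) _
  have huU : (fun z : ℝ × ℝ => u z.1 z.2) =ᵐ[volume.restrict (slab T)] U := by
    filter_upwards [hM, hu1.1.ae_eq_mk, ae_restrict_mem hm] with z h1 h2 h3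
    rw [hU, Set.indicator_of_mem h3, ← h2]
    rw [min_eq_right (abs_le.1 h1).2, max_eq_right (abs_le.1 h1).1]
  have hvV : (fun z : ℝ × ℝ => v z.1 z.2) =ᵐ[volume.restrict (slab T)] V := by
    filter_upwards [hv1.ae_eq_mk, ae_restrict_mem hm] with z h2 h3
    rw [hV, Set.indicator_of_mem h3, ← h2]
  have hstrip : stripSq (fun z => ‖V z‖ₑ) < ⊤ := by
    refine lt_of_le_of_lt (iSup_mono fun y => ?_) hv2
    have hms : MeasurableSet (Set.Icc 0 T ×ˢ Set.Icc y (y + 1)) :=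
      measurableSet_Icc.prod measurableSet_Icc
    have e : ∫⁻ z in Set.Icc 0 T ×ˢ Set.Icc y (y + 1), ‖v z.1 z.2‖ₑ ^ 2 =
        ∫⁻ z in Set.Icc 0 T ×ˢ Set.Icc y (y + 1), ‖V z‖ₑ ^ 2 := by
      apply lintegral_congr_ae
      have hsub : Set.Icc 0 T ×ˢ Set.Icc y (y + 1) ⊆ slab T := Set.prod_mono_right (Set.subset_univ _)
      filter_upwards [ae_restrict_of_ae_restrict_of_subset hsub hvV] with z hz
      rw [hz]
    rw [e, ← lintegral_indicator hms, ← lintegral_indicator (MeasurableSet.univ.prod measurableSet_Icc)]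
    refine lintegral_mono fun z => ?_
    by_cases hz : z.1 ∈ Set.Icc 0 T
    · by_cases hz' : z.2 ∈ Set.Icc y (y + 1)
      · rw [Set.indicator_of_mem (by exact ⟨trivial, hz'⟩), Set.indicator_of_mem (by exact ⟨hz, hz'⟩)]
      · rw [Set.indicator_of_notMem (by exact fun h => hz' h.2)]
        exact zero_le
    · refine (Set.indicator_le_self _ _ z).trans ?_
      simp [hV, hs _ z hz]
  have hUl : LocallyIntegrable U volume :=
    (locallyIntegrable_const M).mono hUm.aestronglyMeasurable
      (ae_of_all _ fun z => (hUM z).trans (le_abs_self M))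
  have hVl := locallyIntegrable_of_stripSq_lt_top hVm hstrip
  have hweak : ∀ φ, IsTestFunction T φ → ∫ z, U z * partialX φ z = - ∫ z, V z * φ z := by
    intro φ hφ
    rw [← setIntegral_slab_eq (T := T) (fun z hz => by rw [hU, hs _ z hz, zero_mul]),
      ← setIntegral_slab_eq (T := T) (fun z hz => by rw [hV, hs _ z hz, zero_mul])]
    have e1 : ∫ z in slab T, u z.1 z.2 * deriv (fun x => φ (z.1, x)) z.2 =
        ∫ z in slab T, U z * partialX φ z := by
      apply integral_congr_ae
      filter_upwards [huU] with z hz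
      rw [hz, (hasDerivAt_partialX (hφ.1.differentiable (by simp)) z.1 z.2).deriv]
    have e2 : ∫ z in slab T, v z.1 z.2 * φ z = ∫ z in slab T, V z * φ z := by
      apply integral_congr_ae
      filter_upwards [hvV] with z hz
      rw [hz]
    rw [← e1, ← e2]
    exact hv3 φ hφ
  have hprim : ∀ᵐ t, ∃ F, IsPrimitive F (fun x => V (t, x)) ∧ (fun x => U (t, x)) =ᵐ[volume] F := by
    have h0 : ∀ᵐ t : ℝ, t ≠ 0 := by simp [ae_iff]
    have h1 : ∀ᵐ t : ℝ, t ≠ T := by simp [ae_iff]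
    filter_upwards [ae_slice_isPrimitive hUl hUm hVl hVm hweak, h0, h1] with t ht ht0 htT
    by_cases htI : t ∈ Set.Icc 0 T
    · exact ht ⟨lt_of_le_of_ne htI.1 ht0.symm, lt_of_le_of_ne htI.2 htT⟩
    · refine ⟨fun _ => 0, ?_, ?_⟩
      · simp only [hV, hs _ (t, _) htI]
        exact IsPrimitive.of_hasDerivAt (fun _ => hasDerivAt_const _ _) continuous_const
      · simp only [hU, hs _ (t, _) htI]
        exact EventuallyEq.rfl
  have hX : XDiff T U V := ⟨hUm, hVm, ⟨M, hUM⟩, hs _, hs _, hstrip, hprim⟩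
  refine ⟨U, V, ⟨hX, fun p hp hp' => ?_, huU⟩, hUM, fun g g' hg hk φ hφ => ?_⟩
  · obtain ⟨-, m, hmp, hmle⟩ := hu3 p hp hp'
    have hp0 : 0 < p := by linarith
    have hsl : ∀ᵐ t ∂volume.restrict (Set.Icc 0 T), u t =ᵐ[volume] fun x => U (t, x) := by
      rw [restrict_slab] at huU
      exact Measure.ae_ae_of_ae_prod huU
    set m' := hmp.1.mk m with hm'
    have hm'm : Measurable m' := hmp.1.stronglyMeasurable_mk.measurable
    have hgood : ∀ᵐ t, t ∈ Set.Icc 0 T → ∀ y, ∫⁻ x in Set.Icc y (y + 1), ‖V (t, x)‖ₑ ^ 2 ≤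
        ENNReal.ofReal (m' t) ^ 2 := by
      rw [← ae_restrict_iff' measurableSet_Icc]
      filter_upwards [hsl, hmle, hmp.1.ae_eq_mk, ae_restrict_of_ae hprim]
        with t h1 h2 h3 ⟨F, hF, hUF⟩ y
      refine (lintegral_sq_le_hulNorm_one hF (h1.trans hUF) y).trans ?_
      rw [hm', ← h3]
      exact pow_le_pow_left₀ zero_le h2 2
    -- The slice bounds hold for almost every time only. The majorant is set to ∞ on a measurable
    -- null set containing the exceptional times, so that they hold for all times without affecting
    -- the integral.
    set B := toMeasurable volume {t | ¬ (t ∈ Set.Icc 0 T → ∀ y, ∫⁻ x in Set.Icc y (y + 1),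
      ‖V (t, x)‖ₑ ^ 2 ≤ ENNReal.ofReal (m' t) ^ 2)} with hB
    have hB0 : volume B = 0 := by rw [hB, measure_toMeasurable]; exact hgood
    have hBm : MeasurableSet B := measurableSet_toMeasurable _ _
    refine ⟨fun t => (Set.Icc 0 T).indicator (fun t => ENNReal.ofReal (m' t)) t +
      B.indicator (fun _ => ⊤) t, (hm'm.ennreal_ofReal.indicator measurableSet_Icc).add
      (measurable_const.indicator hBm), ?_, fun s y => ?_⟩
    · have hBae : ∀ᵐ t, t ∉ B := measure_eq_zero_iff_ae_notMem.1 hB0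
      calc _ = ∫⁻ t in Set.Icc 0 T, ENNReal.ofReal (m' t) ^ p := by
            rw [← lintegral_indicator measurableSet_Icc]
            apply lintegral_congr_ae
            filter_upwards [hBae] with t ht
            rw [Set.indicator_of_notMem ht, add_zero]
            by_cases h : t ∈ Set.Icc 0 T
            · rw [Set.indicator_of_mem h, Set.indicator_of_mem h]
            · rw [Set.indicator_of_notMem h, Set.indicator_of_notMem h, ENNReal.zero_rpow_of_pos hp0]
        _ ≤ ∫⁻ t in Set.Icc 0 T, ‖m t‖ₑ ^ p := by
            apply lintegral_mono_ae
            filter_upwards [hmp.1.ae_eq_mk] with t ht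
            refine ENNReal.rpow_le_rpow ?_ hp0.le
            rw [hm', ← ht, Real.enorm_eq_ofReal_abs]
            exact ENNReal.ofReal_le_ofReal (le_abs_self _)
        _ < ⊤ := by
            have := (eLpNorm_lt_top_iff_lintegral_rpow_enorm_lt_top (by simpa using hp0)
              (by simp)).1 hmp.2
            rwa [ENNReal.toReal_ofReal hp0.le] at this
    · by_cases hsB : s ∈ B
      · simp [hsB]
      · have h1 : s ∈ Set.Icc 0 T → ∀ y, ∫⁻ x in Set.Icc y (y + 1), ‖V (s, x)‖ₑ ^ 2 ≤
            ENNReal.ofReal (m' s) ^ 2 := by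
          by_contra h
          exact hsB (subset_toMeasurable _ _ h)
        simp only [Set.indicator_of_notMem hsB, add_zero]
        by_cases hsT : s ∈ Set.Icc 0 T
        · rw [Set.indicator_of_mem hsT]
          exact h1 hsT y
        · have : ∀ x, V (s, x) = 0 := fun x => hs _ (s, x) hsT
          simp [this]
  · rw [← hX.fluxForm_identity hg huU hvV hk hφ]
    exact hu4 φ hφ

end Solutions

/-! ### Duhamel's formula in weak form -/

section HeatEquation

/-- The convolution with the kernel `∂_x k` solves the heat equation with source `∂_x E`. -/
theorem integral_kconv_heatK {μ lam : ℝ} (hμ : 0 < μ) (hlam : 0 < lam) {E : ℝ × ℝ → ℝ}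
    (hE : Measurable E) {C : ℝ} (hC : ∀ z, |E z| ≤ C) {φ : ℝ × ℝ → ℝ} (hφ : ContDiff ℝ ∞ φ)
    (hc : HasCompactSupport φ) :
    ∫ z : ℝ × ℝ, (Real.exp (lam * z.1) * kconv (heatK μ lam) E z) *
        (partialT φ z + μ * partialX (partialX φ) z) =
      ∫ z : ℝ × ℝ, Real.exp (lam * z.1) * E z * partialX φ z := by
  set κ := heatK μ lam with hκ
  have hκi : Integrable κ volume := integrable_heatK hμ hlam
  set ψ : ℝ × ℝ → ℝ := fun z => Real.exp (lam * z.1) *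
    (partialT φ z + μ * partialX (partialX φ) z) with hψ
  have hT := contDiff_partialT hφ
  have hXX := contDiff_partialX (contDiff_partialX hφ)
  have hψc : Continuous ψ := by
    have := hT.continuous
    have := hXX.continuous
    fun_prop
  have hψs : HasCompactSupport ψ :=
    (hc.partialT.add (hc.partialX.partialX.mul_left (f := fun _ => μ))).mul_left
  have hψi : Integrable ψ volume := hψc.integrable_of_hasCompactSupport hψs
  have hint : Integrable (Function.uncurry fun w z : ℝ × ℝ => E w * (κ (z - w) * ψ z))
      (volume.prod volume) := by
    have h1 := Integrable.convolution_integrand (ContinuousLinearMap.mul ℝ ℝ) hψi hκi.comp_neg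
    have h2 := h1.bdd_mul (c := C) (f := fun p : (ℝ × ℝ) × (ℝ × ℝ) => E p.1)
      (hE.comp measurable_fst).aestronglyMeasurable (ae_of_all _ fun p => hC _)
    refine h2.congr (ae_of_all _ fun p => ?_)
    simp only [ContinuousLinearMap.mul_apply', Function.uncurry, neg_sub]
    ring
  calc _ = ∫ z, ∫ w, E w * (κ (z - w) * ψ z) := by
        congr 1; funext z
        rw [kconv, hψ]
        simp only
        rw [mul_right_comm, mul_comm, ← integral_mul_const]
        congr 1; funext w
        ring
    _ = ∫ w, ∫ z, E w * (κ (z - w) * ψ z) := (integral_integral_swap hint).symm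
    _ = _ := by
        congr 1; funext w
        obtain ⟨-, h2⟩ := integral_heatK_mul_heat_operator hμ hφ hc w.1 w.2
        rw [integral_const_mul, ← integral_add_right_eq_self _ w]
        have e : ∀ y : ℝ × ℝ, κ (y + w - w) * ψ (y + w) = Real.exp (lam * w.1) *
            (heatK μ 0 y * (partialT φ (w.1 + y.1, w.2 + y.2) +
              μ * partialX (partialX φ) (w.1 + y.1, w.2 + y.2))) := by
          intro y
          have hyw : y + w = (w.1 + y.1, w.2 + y.2) := by ext <;> simp [add_comm]
          -- The growth factor at time w₁ + y₁ cancels the damping over the elapsed time y₁, leaving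
          -- the undamped kernel and the factor at the source time w₁.
          have hexp : Real.exp (lam * (w.1 + y.1)) * Real.exp ((0 - lam) * y.1) =
              Real.exp (lam * w.1) := by
            rw [← Real.exp_add]; congr 1; ring
          rw [add_sub_cancel_right, hκ, heatK_eq_exp_mul 0 y, hψ, hyw]
          simp only
          rw [← hexp]
          ring
        simp only [e]
        rw [integral_const_mul, h2]
        ring

end HeatEquation

/-! ### Uniformly small continuous corrections -/

section AddPerturbation

variable {T : ℝ} {u₀ : ℝ → ℝ} {u w : ℝ → ℝ → ℝ}

/-- Adding a uniformly continuous function which vanishes at the initial time. -/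
theorem MemCStarWithInitial.add (hu : MemCStarWithInitial T u₀ u) (hT : 0 < T)
    (hu₀ : Continuous u₀) (hwc : ∀ t, Continuous (w t))
    {C : ℝ} (hC : 0 ≤ C) (hw : ∀ t ∈ Set.Ioc 0 T, ∀ x, |w t x| ≤ C)
    (hcont : ∀ t₀ ∈ Set.Ioc 0 T, ∀ η > 0, ∀ᶠ t in 𝓝[Set.Ioc 0 T] t₀, ∀ x, |w t x - w t₀ x| ≤ η)
    (hinit : ∀ η > 0, ∀ᶠ t in 𝓝[>] (0 : ℝ), ∀ x, |w t x| ≤ η) :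
    MemCStarWithInitial T u₀ (fun t x => u t x + w t x) := by
  obtain ⟨⟨K, hK⟩, h2, h3⟩ := hu
  refine ⟨⟨|K| + C, fun t ht => ?_⟩, fun t₀ ht₀ => ?_, fun R hR => ?_⟩
  · rw [ENNReal.ofReal_add (abs_nonneg _) hC]
    refine (hulNorm_zero_add_le (hwc t).locallyIntegrable).trans (add_le_add ?_ ?_)
    · exact (hK t ht).trans (ENNReal.ofReal_le_ofReal (le_abs_self _))
    · exact hulNorm_zero_le (hwc t).locallyIntegrable (hw t ht)
  · have hlim : Tendsto (fun t => hulNorm 0 (fun x => w t x - w t₀ x)) (𝓝[Set.Ioc 0 T] t₀)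
        (𝓝 0) := by
      rw [ENNReal.tendsto_nhds_zero]
      intro e he
      by_cases he' : e = ⊤
      · simp [he']
      · filter_upwards [hcont t₀ ht₀ e.toReal (ENNReal.toReal_pos he.ne' he')] with t ht
        refine (hulNorm_zero_le ((hwc t).sub (hwc t₀)).locallyIntegrable ht).trans ?_
        rw [ENNReal.ofReal_toReal he']
    have := (h2 t₀ ht₀).add hlim
    rw [add_zero] at this
    refine tendsto_of_tendsto_of_tendsto_of_le_of_le tendsto_const_nhds this (fun _ => zero_le)
      fun t => ?_
    have e : (fun x => u t x + w t x - (u t₀ x + w t₀ x)) =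
        fun x => (u t x - u t₀ x) + (w t x - w t₀ x) := by funext x; ring
    simp only [e]
    exact hulNorm_zero_add_le ((hwc t).sub (hwc t₀)).locallyIntegrable
  · set ν := volume.restrict (Set.Icc (-R) R) with hν
    have hfin : IsFiniteMeasure ν := isFiniteMeasure_restrict.2 (by simp)
    have hlim : Tendsto (fun t => eLpNorm (w t) 2 ν) (𝓝[>] 0) (𝓝 0) := by
      rw [ENNReal.tendsto_nhds_zero]
      intro e he
      by_cases he' : e = ⊤
      · simp [he']
      · set m := (ν Set.univ ^ ((2 : ℝ≥0∞).toReal)⁻¹).toReal with hm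
        filter_upwards [hinit (e.toReal / (m + 1))
          (div_pos (ENNReal.toReal_pos he.ne' he') (by positivity))] with t ht
        refine (eLpNorm_le_of_ae_bound (ae_of_all _ ht)).trans ?_
        rw [← ENNReal.ofReal_toReal (a := ν Set.univ ^ ((2 : ℝ≥0∞).toReal)⁻¹) (by finiteness),
          ← ENNReal.ofReal_mul ENNReal.toReal_nonneg]
        refine (ENNReal.ofReal_le_ofReal ?_).trans (ENNReal.ofReal_toReal he').le
        rw [← hm, mul_div_assoc', div_le_iff₀ (by positivity)]
        nlinarith [ENNReal.toReal_nonneg (a := e)]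
    have := (h3 R hR).add hlim
    rw [add_zero] at this
    have hK' : ∀ᶠ t in 𝓝[>] (0 : ℝ), eLpNorm (fun x => u t x + w t x - u₀ x) 2 ν ≤
        eLpNorm (fun x => u t x - u₀ x) 2 ν + eLpNorm (w t) 2 ν := by
      filter_upwards [Ioc_mem_nhdsGT hT] with t ht
      have hut : LocallyIntegrable (u t) volume := locallyIntegrable_of_hulNorm_ne_top (s := 0)
        ((hK t ht).trans_lt ENNReal.ofReal_lt_top).ne
      have e : (fun x => u t x + w t x - u₀ x) = (fun x => u t x - u₀ x) + w t := by
        funext x; simp only [Pi.add_apply]; ring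
      rw [e]
      exact eLpNorm_add_le (hut.aestronglyMeasurable.sub hu₀.aestronglyMeasurable).restrict
        (hwc t).aestronglyMeasurable (by norm_num)
    exact tendsto_of_tendsto_of_tendsto_of_le_of_le' tendsto_const_nhds this
      (Eventually.of_forall fun _ => zero_le) hK'

end AddPerturbation

/-! ### The equation for the difference of two solutions -/

section Perturbation

/-- The source in the equation for the difference of two solutions, when the forces differ by
`∂_x b` and the extended controls are `g` and `k`. -/
noncomputable def perturbSource (μ T lam : ℝ) (U g g' k k' b : ℝ × ℝ → ℝ) : ℝ × ℝ → ℝ :=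
  (slab T).indicator fun s => Real.exp (-(lam * s.1)) *
    (b s + μ * (k' s - g' s) - (k s - g s) * (U s + (k s + g s) / 2))

variable {μ T lam : ℝ} {U V g g' g'' k k' k'' b b' : ℝ × ℝ → ℝ}

/-- The absolute value keeps the damping bounded on the whole plane; on the slab it changes nothing.
-/
theorem BddC1x.exp_neg (hlam : 0 ≤ lam) :
    BddC1x (fun z => Real.exp (-(lam * |z.1|))) (fun _ => 0) :=
  BddC1x.of_time (c := fun t => Real.exp (-(lam * |t|))) (by fun_prop) (C := 1) fun t => by
    rw [Real.abs_exp, Real.exp_le_one_iff]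
    have := mul_nonneg hlam (abs_nonneg t)
    linarith

/-- The source is assembled from smooth bounded data and `U`, so its x-derivative grows at most
linearly in |V|. This bound is what enters the regularity theorem as majorant. -/
theorem exists_xDiff_perturbSource (hlam : 0 ≤ lam) (hU : XDiff T U V) (hg : BddC1x g g')
    (hg' : BddC1x g' g'') (hk : BddC1x k k') (hk' : BddC1x k' k'') (hb : BddC1x b b') :
    ∃ A', XDiff T (perturbSource μ T lam U g g' k k' b) A' ∧ ∃ C, 0 ≤ C ∧ ∀ z,
      ‖A' z‖ₑ ≤ ENNReal.ofReal C * ((slab T).indicator 1 z + ‖V z‖ₑ) := by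
  have he := BddC1x.exp_neg hlam
  have hP := he.mul (hb.add ((hk'.sub hg').const_mul μ))
  have hQ := he.mul ((hk.sub hg).const_mul (-1))
  have hR := (hk.add hg).const_mul (1 / 2)
  have hA := (hP.xDiff T).add ((hQ.xDiff T).mul (hU.add (hR.xDiff T)))
  obtain ⟨CP, hCP⟩ := hP.bdd'
  obtain ⟨CQ, hCQ⟩ := hQ.bdd
  obtain ⟨CQ', hCQ'⟩ := hQ.bdd'
  obtain ⟨CR, hCR⟩ := hR.bdd
  obtain ⟨CR', hCR'⟩ := hR.bdd'
  obtain ⟨M, hM⟩ := hU.bdd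
  have h0 : ∀ {F : ℝ × ℝ → ℝ} {C : ℝ}, (∀ z, |F z| ≤ C) → 0 ≤ C := fun h =>
    (abs_nonneg _).trans (h 0)
  have := h0 hCP
  have := h0 hCQ
  have := h0 hCQ'
  have := h0 hCR
  have := h0 hCR'
  have := h0 hM
  refine ⟨_, hA.congr fun z => ?_, CP + (M + CR) * CQ' + CQ * CR' + CQ, by positivity,
    fun z => ?_⟩
  · by_cases hz : z ∈ slab T
    · have hz0 : |z.1| = z.1 := abs_of_nonneg (mem_slab.1 hz).1
      simp only [perturbSource, Set.indicator_of_mem hz, hz0]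
      ring
    · simp only [perturbSource, Set.indicator_of_notMem hz]
      ring
  · by_cases hz : z ∈ slab T
    · simp only [Set.indicator_of_mem hz, Pi.one_apply]
      have hP' := hCP z
      have hQ1 := hCQ z
      have hQ2 := hCQ' z
      have hR1 := hCR z
      have hR2 := hCR' z
      rw [Real.enorm_eq_ofReal_abs (V z), ← ENNReal.ofReal_one,
        ← ENNReal.ofReal_add zero_le_one (abs_nonneg _), ← ENNReal.ofReal_mul (by positivity)]
      refine enorm_le_ofReal ?_
      refine (abs_add_le _ _).trans ((add_le_add hP' ((abs_add_le _ _).trans (add_le_add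
        (b := (M + CR) * CQ') (d := CQ * (|V z| + CR')) ?_ ?_))).trans ?_)
      · rw [abs_mul]
        exact mul_le_mul ((abs_add_le _ _).trans (add_le_add (hM z) hR1)) hQ2 (abs_nonneg _)
          (by positivity)
      · rw [abs_mul]
        exact mul_le_mul hQ1 ((abs_add_le _ _).trans (add_le_add le_rfl hR2)) (abs_nonneg _)
          (by positivity)
      · have := abs_nonneg (V z)
        nlinarith [mul_nonneg ‹0 ≤ CP› (abs_nonneg (V z)), mul_nonneg (mul_nonneg
          (add_nonneg ‹0 ≤ M› ‹0 ≤ CR›) ‹0 ≤ CQ'›) (abs_nonneg (V z)),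
          mul_nonneg (mul_nonneg ‹0 ≤ CQ› ‹0 ≤ CR'›) (abs_nonneg (V z))]
    · simp [Set.indicator_of_notMem hz]

theorem integrableOn_slab_mul {F ψ : ℝ × ℝ → ℝ} (hF : Measurable F) {C : ℝ} (hC : ∀ z, |F z| ≤ C)
    (hψ : Continuous ψ) (hc : HasCompactSupport ψ) :
    IntegrableOn (fun z => F z * ψ z) (slab T) volume :=
  integrableOn_bounded_mul ((locallyIntegrable_const C).mono hF.aestronglyMeasurable
    (ae_of_all _ fun z => (hC z).trans (le_abs_self C))) hψ hc

theorem BddC1x.integral_by_parts (hb : BddC1x b b') {φ : ℝ × ℝ → ℝ} (hφ : ContDiff ℝ ∞ φ)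
    (hc : HasCompactSupport φ) :
    ∫ z in slab T, (b z * partialX φ z + b' z * φ z) = 0 := by
  obtain ⟨C, hC⟩ := hb.bdd
  obtain ⟨C', hC'⟩ := hb.bdd'
  rw [integral_add (integrableOn_slab_mul hb.cont.measurable hC (contDiff_partialX hφ).continuous
    hc.partialX) (integrableOn_slab_mul hb.cont'.measurable hC' hφ.continuous hc)]
  have key := (hb.xDiff T).integral_mul_partialX hφ hc
  have e : ∀ F ψ : ℝ × ℝ → ℝ, ∫ z, (slab T).indicator F z * ψ z = ∫ z in slab T, F z * ψ z := by
    intro F ψ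
    rw [← integral_indicator (measurableSet_slab T)]
    congr 1; funext z
    by_cases hz : z ∈ slab T
    · simp only [Set.indicator_of_mem hz]
    · simp only [Set.indicator_of_notMem hz, zero_mul]
  rw [e, e] at key
  rw [key]
  ring

/-- The weak form of the equation for the sum of a solution and a solution of the equation for the
difference. -/
theorem FluxForm.add_perturbation {f : ℝ → ℝ → ℝ} {W : ℝ × ℝ → ℝ} (h : FluxForm μ T f g U)
    (hf : SlabLocallyIntegrable T f) (hU : XDiff T U V) (hg : BddC1x g g')
    (hk : BddC1x k k') (hb : BddC1x b b') (hWm : Measurable W) {C : ℝ} (hWC : ∀ z, |W z| ≤ C)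
    (hW : ∀ φ, IsTestFunction T φ → ∫ z in slab T, W z * (partialT φ z + μ * partialX (partialX φ) z)
      = ∫ z in slab T, (b z + μ * (k' z - g' z) -
        ((U z + W z + k z) ^ 2 - (U z + g z) ^ 2) / 2) * partialX φ z) :
    FluxForm μ T (fun t x => f t x + b' (t, x)) k (fun z => U z + W z) := by
  intro φ hφ
  have hT := (contDiff_partialT hφ.1).continuous
  have hX := contDiff_partialX hφ.1
  have hXX := (contDiff_partialX hX).continuous
  have hcT := hφ.2.1.partialT
  have hcX := hφ.2.1.partialX
  have hcXX := hφ.2.1.partialX.partialX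
  obtain ⟨CU, hCU⟩ := hU.bdd
  obtain ⟨Cg, hCg⟩ := hg.bdd
  obtain ⟨Ck, hCk⟩ := hk.bdd
  obtain ⟨Cg', hCg'⟩ := hg.bdd'
  obtain ⟨Ck', hCk'⟩ := hk.bdd'
  obtain ⟨Cb, hCb⟩ := hb.bdd
  obtain ⟨Cb', hCb'⟩ := hb.bdd'
  have mU := hU.meas
  have mg := hg.cont.measurable
  have mk := hk.cont.measurable
  have mg' := hg.cont'.measurable
  have mk' := hk.cont'.measurable
  have mb := hb.cont.measurable
  set H : ℝ × ℝ → ℝ := fun z => b z + μ * (k' z - g' z) -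
        ((U z + W z + k z) ^ 2 - (U z + g z) ^ 2) / 2 with hH
  have hHm : Measurable H := by fun_prop
  have hsum : ∀ {p q P Q : ℝ}, |p| ≤ P → |q| ≤ Q → |p + q| ≤ P + Q := fun h1 h2 =>
    (abs_add_le _ _).trans (add_le_add h1 h2)
  have hdif : ∀ {p q P Q : ℝ}, |p| ≤ P → |q| ≤ Q → |p - q| ≤ P + Q := fun h1 h2 =>
    (abs_sub _ _).trans (add_le_add h1 h2)
  have hsq : ∀ {p P : ℝ}, |p| ≤ P → |p ^ 2| ≤ P ^ 2 := fun h1 => by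
    rw [abs_pow]; exact pow_le_pow_left₀ (abs_nonneg _) h1 2
  have hHC : ∀ z, |H z| ≤ Cb + |μ| * (Ck' + Cg') + ((CU + C + Ck) ^ 2 + (CU + Cg) ^ 2) / 2 := by
    intro z
    refine hdif (hsum (hCb z) ?_) ?_
    · rw [abs_mul]
      exact mul_le_mul_of_nonneg_left (hdif (hCk' z) (hCg' z)) (abs_nonneg _)
    · rw [abs_div, abs_of_pos (by norm_num : (0 : ℝ) < 2)]
      gcongr
      exact hdif (hsq (hsum (hsum (hCU z) (hWC z)) (hCk z))) (hsq (hsum (hCU z) (hCg z)))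
  have i1 : IntegrableOn (fun z => - U z * partialT φ z - μ * (U z + g z) * partialX (partialX φ) z -
      (U z + g z) ^ 2 / 2 * partialX φ z) (slab T) volume := by
    refine Integrable.sub (Integrable.sub ?_ ?_) ?_
    · exact integrableOn_slab_mul (by fun_prop) (C := CU) (fun z => by rw [abs_neg]; exact hCU z)
        hT hcT
    · exact integrableOn_slab_mul (by fun_prop) (C := |μ| * (CU + Cg)) (fun z => by
        rw [abs_mul]
        exact mul_le_mul_of_nonneg_left (hsum (hCU z) (hCg z)) (abs_nonneg _)) hXX hcXX
    · exact integrableOn_slab_mul (by fun_prop) (C := (CU + Cg) ^ 2 / 2) (fun z => by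
        rw [abs_div, abs_of_pos (by norm_num : (0 : ℝ) < 2)]
        gcongr
        exact hsq (hsum (hCU z) (hCg z))) hX.continuous hcX
  have i2 : IntegrableOn (fun z => W z * (partialT φ z + μ * partialX (partialX φ) z)) (slab T)
      volume := integrableOn_slab_mul hWm hWC (by fun_prop) (hcT.add (hcXX.mul_left (f := fun _ => μ)))
  have i3 : IntegrableOn (fun z => H z * partialX φ z) (slab T) volume :=
    integrableOn_slab_mul hHm hHC hX.continuous hcX
  have i4 : IntegrableOn (fun z => b z * partialX φ z + b' z * φ z) (slab T) volume :=
    (integrableOn_slab_mul mb hCb hX.continuous hcX).add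
      (integrableOn_slab_mul hb.cont'.measurable hCb' hφ.1.continuous hφ.2.1)
  have i5 : IntegrableOn (fun z => b' z * φ z) (slab T) volume :=
    integrableOn_slab_mul hb.cont'.measurable hCb' hφ.1.continuous hφ.2.1
  have i6 : IntegrableOn (fun z => (k z - g z) * partialX (partialX φ) z +
      (k' z - g' z) * partialX φ z) (slab T) volume :=
    (integrableOn_slab_mul (mk.sub mg) (fun z => hdif (hCk z) (hCg z)) hXX hcXX).add
      (integrableOn_slab_mul (mk'.sub mg') (fun z => hdif (hCk' z) (hCg' z)) hX.continuous hcX)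
  -- The two expressions added and subtracted here, for b and for k − g, are integrations by parts
  -- with integral 0. They exchange the force ∂_x b for a flux b, and the second-order term in k − g
  -- for the flux μ∂_x(k − g).
  have e : (fun z => - (U z + W z) * partialT φ z - μ * (U z + W z + k z) *
      partialX (partialX φ) z - (U z + W z + k z) ^ 2 / 2 * partialX φ z) =
      (fun z => - U z * partialT φ z - μ * (U z + g z) * partialX (partialX φ) z -
        (U z + g z) ^ 2 / 2 * partialX φ z) -
      (fun z => W z * (partialT φ z + μ * partialX (partialX φ) z)) +
      (fun z => H z * partialX φ z) - (fun z => b z * partialX φ z + b' z * φ z) +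
      (fun z => b' z * φ z) -
      (fun z => μ * ((k z - g z) * partialX (partialX φ) z + (k' z - g' z) * partialX φ z)) := by
    funext z; simp only [hH, Pi.add_apply, Pi.sub_apply]; ring
  rw [e, integral_sub' ((((i1.sub i2).add i3).sub i4).add i5) (i6.const_mul μ),
    integral_add' (((i1.sub i2).add i3).sub i4) i5, integral_sub' ((i1.sub i2).add i3) i4,
    integral_add' (i1.sub i2) i3, integral_sub' i1 i2, h φ hφ, hW φ hφ, integral_const_mul,
    hb.integral_by_parts hφ.1 hφ.2.1, (hk.sub hg).integral_by_parts hX hcX]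
  simp only [add_mul]
  rw [integral_add (hf φ hφ) i5]
  ring

end Perturbation

/-! ### Stability of solutions under perturbations small after convolution -/

section Perturbation

variable {μ T lam : ℝ} {U V g g' g'' k k' k'' b b' : ℝ × ℝ → ℝ}

/-- Causality: the kernel vanishes at nonpositive times and the source at negative ones, so the two
never meet at time 0. -/
theorem kconv_heatK_initial {E : ℝ × ℝ → ℝ} (hE : ∀ z : ℝ × ℝ, z.1 < 0 → E z = 0) (x : ℝ) :
    kconv (heatK μ lam) E (0, x) = 0 := by
  refine integral_eq_zero_of_ae (ae_of_all _ fun w => ?_)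
  change heatK μ lam ((0, x) - w) * E w = 0
  rcases lt_or_ge w.1 0 with h | h
  · rw [hE w h, mul_zero]
  · have : ¬ 0 < ((0, x) - w : ℝ × ℝ).1 := by simpa using h
    rw [heatK, if_neg this, zero_mul]

/-- A solution persists, up to a small continuous error, under perturbations of the force and of
the extended control for which the source of the equation for the difference is small after
convolution with the derivative of the heat kernel. -/
theorem exists_perturbed_solution (hμ : 0 < μ) (hT : 0 < T) {M ε : ℝ} (hM : 0 ≤ M) (hε : 0 < ε) :
    ∃ lam > 0, ∃ δ > 0, ∀ {f : ℝ → ℝ → ℝ} {u₀ : ℝ → ℝ} {u : ℝ → ℝ → ℝ}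
      {U V g g' g'' k k' k'' b b' : ℝ × ℝ → ℝ}, SlabLocallyIntegrable T f → Continuous u₀ →
      BddC1x g g' → BddC1x g' g'' → BddC1x k k' → BddC1x k' k'' → BddC1x b b' →
      (∀ z ∈ slab T, |k z| ≤ M) → RegularRep T u U V → (∀ z, |U z| ≤ M) → FluxForm μ T f g U →
      MemCStarWithInitial T u₀ u →
      (∀ z, |kconv (heatK μ lam) (perturbSource μ T lam U g g' k k' b) z| ≤ δ) →
      ∃ w : ℝ × ℝ → ℝ, Continuous w ∧ (∀ t ∈ Set.Icc 0 T, ∀ x, |w (t, x)| ≤ ε) ∧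
        IsBurgersSolution μ T (fun t x => f t x + b' (t, x)) (fun t x => k (t, x)) u₀
          (fun t x => u t x + w (t, x)) := by
  -- In 2M + 1, the summand 2M bounds `B` = U + k and the summand 1 bounds the quadratic coefficient
  -- 2Lρ.
  obtain ⟨lam, hlam, hκs⟩ := exists_integral_heatK_le hμ (ε := 1 / (2 * (2 * M + 1))) (by positivity)
  set κ := heatK μ lam with hκdef
  have hκ : Integrable κ volume := integrable_heatK hμ hlam
  -- Undoing the damping multiplies by at most e^{λT}, so this radius gives |w| ≤ ε; the minimum
  -- with 1 gives 2Lρ ≤ 1. The admissible source size is then ρ/2, as the contraction demands.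
  set ρ := min ε 1 * Real.exp (-(lam * T)) with hρdef
  have hρ : 0 < ρ := by positivity
  refine ⟨lam, hlam, ρ / 2, by positivity, ?_⟩
  intro f u₀ u U V g g' g'' k k' k'' b b' hf hu₀ hg hg' hk hk' hb hkM hU hUM hflux hcs hsm
  set A := perturbSource μ T lam U g g' k k' b with hA
  obtain ⟨A', hAA', C₀, hC₀, hA'C⟩ := exists_xDiff_perturbSource (μ := μ) hlam.le hU.toXDiff hg hg'
    hk hk' hb
  rw [← hA] at hAA'
  set B : ℝ × ℝ → ℝ := fun z => U z + (slab T).indicator k z with hB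
  have hBB' := hU.toXDiff.add (hk.xDiff T)
  obtain ⟨Ck', hCk'⟩ := hk.bdd'
  have hCk'0 : 0 ≤ Ck' := (abs_nonneg _).trans (hCk' 0)
  have hBM : ∀ z, |B z| ≤ 2 * M := by
    intro z
    have h1 : |(slab T).indicator k z| ≤ M := by
      by_cases hz : z ∈ slab T
      · rw [Set.indicator_of_mem hz]; exact hkM z hz
      · rw [Set.indicator_of_notMem hz, abs_zero]; exact hM
    exact (abs_add_le _ _).trans (by linarith [hUM z])
  set D : ℝ → ℝ := (Set.Icc 0 T).indicator fun t => Real.exp (lam * t) / 2 with hD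
  have hDm : Measurable D := (by fun_prop : Measurable fun t => Real.exp (lam * t) / 2).indicator
    measurableSet_Icc
  set L := Real.exp (lam * T) / 2 with hL
  have hDL : ∀ t, |D t| ≤ L := by
    intro t
    by_cases ht : t ∈ Set.Icc 0 T
    · rw [hD, Set.indicator_of_mem ht, abs_of_pos (by positivity), hL]
      gcongr
      exact ht.2
    · rw [hD, Set.indicator_of_notMem ht, abs_zero]; positivity
  have hLρ : 2 * L * ρ ≤ 1 := by
    have : 2 * L * ρ = min ε 1 * (Real.exp (lam * T) * Real.exp (-(lam * T))) := by
      rw [hL, hρdef]; ring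
    rw [this, ← Real.exp_add, add_neg_cancel, Real.exp_zero, mul_one]
    exact min_le_right _ _
  have hκc : (∫ w, |κ w|) * (2 * M + 1) ≤ 1 / 2 := by
    calc _ ≤ 1 / (2 * (2 * M + 1)) * (2 * M + 1) := by gcongr
      _ = 1 / 2 := by field_simp
  have hκ0 : 0 ≤ ∫ w, |κ w| := integral_nonneg fun _ => abs_nonneg _
  obtain ⟨CA, hCA⟩ := hAA'.bdd
  obtain ⟨v, hvc, hvρ, hveq⟩ := exists_kconv_fixedPoint hκ hAA'.meas hBB'.meas
    (D := fun z => D z.1) (hDm.comp measurable_fst) hCA hBM (fun z => hDL z.1) hρ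
    ((mul_le_mul_of_nonneg_left (by linarith) hκ0).trans hκc) hsm
  set β : ℝ × ℝ → ℝ≥0∞ := fun z => ENNReal.ofReal (C₀ + ρ * (1 + Ck')) *
    ((slab T).indicator 1 z + ‖V z‖ₑ) with hβ
  have hVm := hU.meas'
  have hind : Measurable ((slab T).indicator (1 : ℝ × ℝ → ℝ≥0∞)) :=
    measurable_one.indicator (measurableSet_slab T)
  have hβm : Measurable β := (hind.add hVm.enorm).const_mul _
  have hβle : ∀ z, ‖A' z‖ₑ + ENNReal.ofReal ρ * ‖V z + (slab T).indicator k' z‖ₑ ≤ β z := by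
    intro z
    have h1 : ‖V z + (slab T).indicator k' z‖ₑ ≤
        ENNReal.ofReal (1 + Ck') * ((slab T).indicator 1 z + ‖V z‖ₑ) := by
      have h2 : ‖(slab T).indicator k' z‖ₑ ≤ ENNReal.ofReal Ck' * (slab T).indicator 1 z := by
        by_cases hz : z ∈ slab T
        · rw [Set.indicator_of_mem hz, Set.indicator_of_mem hz, Pi.one_apply, mul_one]
          exact enorm_le_ofReal (hCk' z)
        · simp [Set.indicator_of_notMem hz]
      rw [ENNReal.ofReal_add zero_le_one hCk'0, ENNReal.ofReal_one]
      calc _ ≤ ‖V z‖ₑ + ENNReal.ofReal Ck' * (slab T).indicator 1 z :=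
            (enorm_add_le _ _).trans (add_le_add le_rfl h2)
        _ ≤ (‖V z‖ₑ + ENNReal.ofReal Ck' * (slab T).indicator 1 z) +
            ((slab T).indicator 1 z + ENNReal.ofReal Ck' * ‖V z‖ₑ) := le_self_add
        _ = _ := by ring
    calc _ ≤ ENNReal.ofReal C₀ * ((slab T).indicator 1 z + ‖V z‖ₑ) + ENNReal.ofReal ρ *
          (ENNReal.ofReal (1 + Ck') * ((slab T).indicator 1 z + ‖V z‖ₑ)) := by
          gcongr
          exact hA'C z
      _ = β z := by
          rw [hβ]
          simp only
          rw [ENNReal.ofReal_add hC₀ (by positivity), ENNReal.ofReal_mul hρ.le]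
          ring
  have hind1 : ∀ z, (slab T).indicator (1 : ℝ × ℝ → ℝ≥0∞) z ≤ ENNReal.ofReal 1 := fun z => by
    rw [ENNReal.ofReal_one]
    exact Set.indicator_le_self' (fun _ _ => zero_le) z
  have hind0 : ∀ z : ℝ × ℝ, z.1 ∉ Set.Icc 0 T → (slab T).indicator (1 : ℝ × ℝ → ℝ≥0∞) z = 0 :=
    fun z hz => Set.indicator_of_notMem (fun h => hz (mem_slab.1 h)) _
  have hβslice : SliceBdd β := ((sliceBdd_of_bounded hind1 hind0).add hU.slices hind).const_mul
    (by simp)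
  have hβstrip : stripSq β < ⊤ := by
    rw [hβ, stripSq_const_mul (by simp)]
    refine ENNReal.mul_lt_top (by simp) ((stripSq_add_le hind).trans_lt (ENNReal.add_lt_top.2 ⟨?_, ?_⟩))
    · exact ENNReal.mul_lt_top (by simp) (stripSq_lt_top_of_bounded hind1 hind0)
    · exact ENNReal.mul_lt_top (by simp) hU.strip
  obtain ⟨hvxm, hvxs, hvxn⟩ := deriv_of_kconv_eq hκ hAA' hBB' hDm hβm hBM hDL
    (by linarith : (1 : ℝ) ≤ 2 * M + 1) (by linarith) hκc hvc hvρ hveq hβle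
  set vx : ℝ × ℝ → ℝ := fun z => deriv (fun x => v (z.1, x)) z.2 with hvx
  have hvxslice : SliceBdd fun z => ‖vx z‖ₑ := by
    intro p hp hp'
    obtain ⟨n, hn, hnp, hns⟩ := hβslice p hp hp'
    obtain ⟨N, hN, hNp, hNs⟩ := hvxn n hn hns
    refine ⟨N, hN, (hNp p hp).trans_lt hnp, fun s y => ?_⟩
    by_cases hs : N s = ⊤
    · simp [hs]
    · exact (hNs s hs).2 y
  have hvprim : ∀ᵐ t, IsPrimitive (fun x => v (t, x)) (fun x => vx (t, x)) := by
    obtain ⟨n, hn, hnp, hns⟩ := hβslice 1 le_rfl (by norm_num)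
    obtain ⟨N, hN, hNp, hNs⟩ := hvxn n hn hns
    have h1 := (hNp 1 le_rfl).trans_lt hnp
    simp only [ENNReal.rpow_one] at h1
    filter_upwards [ae_lt_top hN h1.ne] with t ht
    exact (hNs t ht.ne).1
  set w : ℝ × ℝ → ℝ := fun z => Real.exp (lam * z.1) * v z with hw
  have hwc : Continuous w := by fun_prop
  have hexp : ∀ t ∈ Set.Icc 0 T, Real.exp (lam * t) ≤ Real.exp (lam * T) := fun t ht => by
    gcongr; exact ht.2
  have hwε : ∀ t ∈ Set.Icc 0 T, ∀ x, |w (t, x)| ≤ ε := by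
    intro t ht x
    rw [hw]
    simp only
    rw [abs_mul, Real.abs_exp]
    calc _ ≤ Real.exp (lam * T) * ρ := by
          gcongr
          · exact ht.2
          · exact hvρ _
      _ = min ε 1 * (Real.exp (lam * T) * Real.exp (-(lam * T))) := by rw [hρdef]; ring
      _ ≤ ε := by
          rw [← Real.exp_add, add_neg_cancel, Real.exp_zero, mul_one]
          exact min_le_left _ _
  set W := (slab T).indicator w with hW
  set Ω := (slab T).indicator fun z => Real.exp (lam * z.1) * vx z with hΩ
  have hms := measurableSet_slab T
  have hs0 : ∀ (F : ℝ × ℝ → ℝ) (z : ℝ × ℝ), z.1 ∉ Set.Icc 0 T → (slab T).indicator F z = 0 :=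
    fun F z hz => Set.indicator_of_notMem (fun h => hz (mem_slab.1 h)) _
  have hWε : ∀ z, |W z| ≤ ε := by
    intro z
    by_cases hz : z ∈ slab T
    · rw [hW, Set.indicator_of_mem hz]; exact hwε z.1 (mem_slab.1 hz) z.2
    · rw [hW, Set.indicator_of_notMem hz, abs_zero]; exact hε.le
  have hΩvx : ∀ z, ‖Ω z‖ₑ ≤ ENNReal.ofReal (Real.exp (lam * T)) * ‖vx z‖ₑ := by
    intro z
    by_cases hz : z ∈ slab T
    · rw [hΩ, Set.indicator_of_mem hz, enorm_mul]
      gcongr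
      exact enorm_le_ofReal (by rw [Real.abs_exp]; exact hexp _ (mem_slab.1 hz))
    · rw [hΩ, Set.indicator_of_notMem hz, enorm_zero]; exact zero_le
  have hΩm : Measurable Ω := Measurable.indicator (by fun_prop) hms
  have hWrep : RegularRep T (fun t x => w (t, x)) W Ω := by
    refine ⟨⟨hwc.measurable.indicator hms, hΩm, ⟨ε, hWε⟩, hs0 _, hs0 _, ?_, ?_⟩,
      (hvxslice.const_mul (by simp)).mono hΩvx, ?_⟩
    · refine (stripSq_mono hΩvx).trans_lt ?_
      rw [stripSq_const_mul (by simp)]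
      exact ENNReal.mul_lt_top (by simp) (hvxs.trans_lt hβstrip)
    · filter_upwards [hvprim] with t ht
      by_cases htT : t ∈ Set.Icc 0 T
      · have hin : ∀ (F : ℝ × ℝ → ℝ) x, (slab T).indicator F (t, x) = F (t, x) := fun F x =>
          Set.indicator_of_mem (mem_slab.2 htT) _
        simp only [hW, hΩ, hin]
        exact ⟨_, ht.const_mul (Real.exp (lam * t)), EventuallyEq.rfl⟩
      · simp only [hW, hΩ, hs0 _ (t, _) htT]
        exact ⟨fun _ => 0, IsPrimitive.of_hasDerivAt (fun _ => hasDerivAt_const _ _)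
          continuous_const, EventuallyEq.rfl⟩
    · filter_upwards [ae_restrict_mem hms] with z hz
      rw [hW, Set.indicator_of_mem hz]
  set E : ℝ × ℝ → ℝ := fun z => A z - B z * v z - D z.1 * v z ^ 2 with hE
  have hEm : Measurable E := by
    have := hAA'.meas
    have := hBB'.meas
    have := hvc.measurable
    fun_prop
  have hEC : ∀ z, |E z| ≤ CA + 2 * M * ρ + L * ρ ^ 2 := by
    intro w
    refine (abs_sub _ _).trans (add_le_add ((abs_sub _ _).trans (add_le_add (hCA w) ?_)) ?_)
    · rw [abs_mul]
      exact mul_le_mul (hBM w) (hvρ w) (abs_nonneg _) (by positivity)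
    · rw [abs_mul, abs_pow]
      exact mul_le_mul (hDL _) (pow_le_pow_left₀ (abs_nonneg _) (hvρ w) 2) (by positivity)
        (by positivity)
  have hE0 : ∀ z : ℝ × ℝ, z.1 ∉ Set.Icc 0 T → E z = 0 := by
    intro z hz
    simp only [hE, hAA'.supp z hz, hBB'.supp z hz, hD, Set.indicator_of_notMem hz, hB]
    ring
  -- As a convolution of an integrable kernel with a bounded function, v is uniformly continuous on
  -- the plane. This yields continuity of w in time, uniformly in x, including at t = 0, where w
  -- vanishes.
  have huc : UniformContinuous v := by
    have := uniformContinuous_kconv hκ hEm hEC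
    rwa [show v = kconv κ E from funext hveq]
  have hw0 : ∀ x, w (0, x) = 0 := fun x => by
    rw [hw]
    simp only
    rw [hveq, hκdef, kconv_heatK_initial (fun z hz => hE0 z fun h => by linarith [h.1]), mul_zero]
  have hwunif : ∀ t₀ : ℝ, ∀ η > 0, ∀ᶠ t in 𝓝 t₀, ∀ x, |w (t, x) - w (t₀, x)| ≤ η := by
    intro t₀ η hη
    have h1 : ∀ᶠ t in 𝓝 t₀, |Real.exp (lam * t) - Real.exp (lam * t₀)| < min 1 (η / (2 * ρ)) := by
      have : Continuous fun t => Real.exp (lam * t) := by fun_prop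
      exact Metric.tendsto_nhds.1 (this.tendsto t₀) _ (by positivity)
    obtain ⟨r, hr, hr'⟩ := Metric.uniformContinuous_iff.1 huc
      (η / (2 * (Real.exp (lam * t₀) + 1))) (by positivity)
    filter_upwards [h1, Metric.ball_mem_nhds t₀ hr] with t h1 h2 x
    have h3 := hr' (a := (t, x)) (b := (t₀, x)) (by
      rw [Prod.dist_eq]; simpa using h2)
    rw [Real.dist_eq] at h3
    have e : w (t, x) - w (t₀, x) = Real.exp (lam * t) * (v (t, x) - v (t₀, x)) +
        (Real.exp (lam * t) - Real.exp (lam * t₀)) * v (t₀, x) := by simp only [hw]; ring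
    have h4 : Real.exp (lam * t) ≤ Real.exp (lam * t₀) + 1 := by
      linarith [(abs_lt.1 (h1.trans_le (min_le_left _ _))).2]
    rw [e]
    calc _ ≤ Real.exp (lam * t) * |v (t, x) - v (t₀, x)| +
          |Real.exp (lam * t) - Real.exp (lam * t₀)| * |v (t₀, x)| := by
          refine (abs_add_le _ _).trans (le_of_eq ?_)
          rw [abs_mul, abs_mul, Real.abs_exp]
      _ ≤ (Real.exp (lam * t₀) + 1) * (η / (2 * (Real.exp (lam * t₀) + 1))) +
          η / (2 * ρ) * ρ := by
          gcongr
          · exact (h1.trans_le (min_le_right _ _)).le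
          · exact hvρ _
      _ = η := by field_simp; ring
  refine ⟨w, hwc, hwε, (hU.add hWrep).isBurgersSolution ?_ hk (fun _ _ _ => rfl) ?_⟩
  · refine hcs.add hT hu₀ (fun t => by fun_prop) hε.le
      (fun t ht => hwε t ⟨ht.1.le, ht.2⟩) (fun t₀ _ η hη => ?_) (fun η hη => ?_)
    · exact (hwunif t₀ η hη).filter_mono nhdsWithin_le_nhds
    · have := (hwunif 0 η hη).filter_mono (nhdsWithin_le_nhds (s := Set.Ioi 0))
      simpa only [hw0, sub_zero] using this
  · refine hflux.add_perturbation hf hU.toXDiff hg hk hb hWrep.meas hWε fun φ hφ => ?_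
    have key := integral_kconv_heatK hμ hlam hEm hEC hφ.1 hφ.2.1
    simp only [← hκdef, ← hveq] at key
    have hz1 : ∀ z : ℝ × ℝ, z.1 ∉ Set.Icc 0 T → partialT φ z = 0 ∧ partialX φ z = 0 ∧
        partialX (partialX φ) z = 0 := fun z hz => by
      have hz' : z.1 ∉ Set.Ioo 0 T := fun h => hz ⟨h.1.le, h.2.le⟩
      exact ⟨hφ.partialT.eq_zero hz', hφ.partialX.eq_zero hz', hφ.partialX.partialX.eq_zero hz'⟩
    rw [← setIntegral_slab_eq (T := T) (fun z hz => by
        rw [(hz1 z hz).1, (hz1 z hz).2.2]; ring), ← setIntegral_slab_eq (T := T) (fun z hz => by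
        rw [hE0 z hz]; ring)] at key
    calc _ = ∫ z in slab T, (Real.exp (lam * z.1) * v z) *
          (partialT φ z + μ * partialX (partialX φ) z) := by
          refine setIntegral_congr_fun hms fun z hz => ?_
          simp only [hW, Set.indicator_of_mem hz, hw]
      _ = _ := key
      _ = _ := by
          refine setIntegral_congr_fun hms fun z hz => ?_
          congr 1
          have hzT := mem_slab.1 hz
          have he : Real.exp (lam * z.1) * Real.exp (-(lam * z.1)) = 1 := by
            rw [← Real.exp_add, add_neg_cancel, Real.exp_zero]
          simp only [hE, hA, perturbSource, hB, hD, hW, Set.indicator_of_mem hz,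
            Set.indicator_of_mem hzT, hw]
          -- Undoing the damping turns A − Bv − Dv² into the required flux, because ((U+W+k)² −
          -- (U+g)²)/2 = W²/2 + (U+k)W + (k−g)(U + (k+g)/2).
          linear_combination (b z + μ * (k' z - g' z) - (k z - g z) * (U z + (k z + g z) / 2)) * he

end Perturbation

/-! ### Time continuity uniform in space, and time continuity of solutions -/

section TimeUniform

/-- Continuity in time, uniformly in space. -/
def TimeUnif (g : ℝ × ℝ → ℝ) : Prop :=
  ∀ t₀ : ℝ, ∀ η > 0, ∀ᶠ t in 𝓝 t₀, ∀ x, |g (t, x) - g (t₀, x)| ≤ η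

variable {f g : ℝ × ℝ → ℝ}

theorem TimeUnif.add (hf : TimeUnif f) (hg : TimeUnif g) : TimeUnif fun z => f z + g z := by
  intro t₀ η hη
  filter_upwards [hf t₀ (η / 2) (by positivity), hg t₀ (η / 2) (by positivity)] with t h1 h2 x
  have e : f (t, x) + g (t, x) - (f (t₀, x) + g (t₀, x)) =
      (f (t, x) - f (t₀, x)) + (g (t, x) - g (t₀, x)) := by ring
  rw [e]
  exact (abs_add_le _ _).trans (by linarith [h1 x, h2 x])

theorem TimeUnif.mul (hf : TimeUnif f) (hg : TimeUnif g) {C D : ℝ} (hC : ∀ z, |f z| ≤ C)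
    (hD : ∀ z, |g z| ≤ D) : TimeUnif fun z => f z * g z := by
  intro t₀ η hη
  have hC0 : 0 ≤ C := (abs_nonneg _).trans (hC 0)
  have hD0 : 0 ≤ D := (abs_nonneg _).trans (hD 0)
  filter_upwards [hf t₀ (η / (2 * (D + 1))) (by positivity),
    hg t₀ (η / (2 * (C + 1))) (by positivity)] with t h1 h2 x
  have e : f (t, x) * g (t, x) - f (t₀, x) * g (t₀, x) =
      (f (t, x) - f (t₀, x)) * g (t, x) + f (t₀, x) * (g (t, x) - g (t₀, x)) := by ring
  rw [e]
  calc _ ≤ |f (t, x) - f (t₀, x)| * |g (t, x)| + |f (t₀, x)| * |g (t, x) - g (t₀, x)| := by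
        refine (abs_add_le _ _).trans (le_of_eq ?_)
        rw [abs_mul, abs_mul]
    _ ≤ η / (2 * (D + 1)) * (D + 1) + (C + 1) * (η / (2 * (C + 1))) := by
        gcongr
        · exact h1 x
        · linarith [hD (t, x)]
        · linarith [hC (t₀, x)]
        · exact h2 x
    _ = η := by field_simp; ring

theorem timeUnif_of_time {c : ℝ → ℝ} (hc : Continuous c) : TimeUnif fun z => c z.1 := by
  intro t₀ η hη
  filter_upwards [Metric.tendsto_nhds.1 (hc.tendsto t₀) η hη] with t ht x
  exact ht.le

theorem timeUnif_of_space (e : ℝ → ℝ) : TimeUnif fun z => e z.2 := by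
  intro t₀ η hη
  exact Eventually.of_forall fun t x => by simpa using hη.le

theorem TimeUnif.timeContinuous (hf : TimeUnif f) (T : ℝ) (S : Set ℝ) : TimeContinuous T S f := by
  refine TimeContinuous.of_uniform fun η hη t₀ _ => ?_
  obtain ⟨r, hr, h⟩ := Metric.eventually_nhds_iff.1 (hf t₀ (η / 2) (by positivity))
  refine ⟨r, hr, fun s s₀ hs hs₀ y => ?_⟩
  have h1 := h (y := s) (by rwa [Real.dist_eq]) y
  have h2 := h (y := s₀) (by rwa [Real.dist_eq]) y
  have e : f (s, y) - f (s₀, y) = (f (s, y) - f (t₀, y)) - (f (s₀, y) - f (t₀, y)) := by ring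
  rw [e]
  exact (abs_sub _ _).trans (by linarith)

theorem TimeContinuous.congr {T : ℝ} {S : Set ℝ} (hf : TimeContinuous T S f)
    (h : ∀ s ∈ S, ∀ y, g (s, y) = f (s, y)) : TimeContinuous T S g := by
  intro R η hR hη t₀ ht₀
  obtain ⟨r, hr, h'⟩ := hf R η hR hη t₀ ht₀
  refine ⟨r, hr, fun s hs s₀ hs₀ h1 h2 x => ?_⟩
  simp only [h s hs, h s₀ hs₀]
  exact h' s hs s₀ hs₀ h1 h2 x

/-- An integral over a long interval is bounded by the integrals over unit intervals. -/
theorem lintegral_Icc_le_of_unit_le {F : ℝ → ℝ≥0∞} {d : ℝ≥0∞}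
    (h : ∀ y : ℝ, ∫⁻ x in Set.Icc y (y + 1), F x ≤ d) (R x : ℝ) :
    ∫⁻ y in Set.Icc (x - R) (x + R), F y ≤ (⌈2 * R⌉₊ + 1 : ℕ) * d := by
  set m : ℕ := ⌈2 * R⌉₊ with hm
  have hsub : Set.Icc (x - R) (x + R) ⊆ ⋃ j : Fin (m + 1), Set.Icc (x - R + j) (x - R + j + 1) := by
    intro y hy
    have h0 : 0 ≤ y - (x - R) := by linarith [hy.1]
    have hj : ⌊y - (x - R)⌋₊ < m + 1 := by
      have : ⌊y - (x - R)⌋₊ ≤ m := by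
        refine (Nat.floor_le_floor (by linarith [hy.2] : y - (x - R) ≤ 2 * R)).trans ?_
        exact (Nat.floor_le_ceil _)
      omega
    refine Set.mem_iUnion.2 ⟨⟨_, hj⟩, ?_, ?_⟩
    · have := Nat.floor_le h0
      simp only
      linarith
    · have := Nat.lt_floor_add_one (y - (x - R))
      simp only
      linarith
  calc _ ≤ ∫⁻ y in ⋃ j : Fin (m + 1), Set.Icc (x - R + j) (x - R + j + 1), F y :=
        lintegral_mono_set hsub
    _ ≤ ∑' j : Fin (m + 1), ∫⁻ y in Set.Icc (x - R + j) (x - R + j + 1), F y :=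
        lintegral_iUnion_le _ _
    _ ≤ ∑' j : Fin (m + 1), d := ENNReal.tsum_le_tsum fun j => h _
    _ = _ := by
        rw [tsum_fintype, Finset.sum_const, Finset.card_univ, Fintype.card_fin, nsmul_eq_mul]

/-- Bounded solutions are continuous in time in the sense of `TimeContinuous`. -/
theorem MemCStarWithInitial.timeContinuous {T : ℝ} {u₀ : ℝ → ℝ} {u : ℝ → ℝ → ℝ} {U : ℝ × ℝ → ℝ}
    (hu : MemCStarWithInitial T u₀ u) :
    TimeContinuous T {t | t ∈ Set.Ioc 0 T ∧ u t =ᵐ[volume] fun x => U (t, x)} U := by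
  obtain ⟨⟨K, hK⟩, h2, -⟩ := hu
  intro R η hR hη t₀ ht₀
  set m : ℕ := ⌈2 * R⌉₊ with hm
  set d : ℝ := η / (2 * (m + 1)) with hd
  have hd0 : 0 < d := by positivity
  have hloc : ∀ t ∈ Set.Ioc 0 T, LocallyIntegrable (u t) volume := fun t ht =>
    locallyIntegrable_of_hulNorm_ne_top (s := 0) ((hK t ht).trans_lt ENNReal.ofReal_lt_top).ne
  have hev := (h2 t₀ ht₀).eventually_lt_const (ENNReal.ofReal_pos.2 hd0)
  rw [eventually_nhdsWithin_iff, Metric.eventually_nhds_iff] at hev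
  obtain ⟨r, hr, hev⟩ := hev
  -- Unit intervals have measure 1, so the L² norm dominates the L¹ norm there; a window of width 2R
  -- is covered by m + 1 of them.
  have hwin : ∀ s ∈ Set.Ioc 0 T, |s - t₀| < r → ∀ y : ℝ,
      ∫⁻ x in Set.Icc y (y + 1), ‖u s x - u t₀ x‖ₑ ≤ ENNReal.ofReal d := by
    intro s hs hsr y
    have h1 := hev (by rwa [Real.dist_eq]) hs
    have hl : LocallyIntegrable (fun x => u s x - u t₀ x) volume := (hloc s hs).sub (hloc t₀ ht₀)
    rw [hulNorm_zero_eq hl] at h1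
    rw [← eLpNorm_one_eq_lintegral_enorm]
    refine le_trans ?_ h1.le
    refine le_trans ?_ (le_iSup _ y)
    have : IsProbabilityMeasure (volume.restrict (Set.Icc y (y + 1))) := ⟨by simp⟩
    exact eLpNorm_le_eLpNorm_of_exponent_le (by norm_num) hl.aestronglyMeasurable.restrict
  have hbig : ∀ s ∈ Set.Ioc 0 T, |s - t₀| < r → ∀ x : ℝ,
      ∫⁻ y in Set.Icc (x - R) (x + R), ‖u s y - u t₀ y‖ₑ ≤ ENNReal.ofReal (η / 2) := by
    intro s hs hsr x
    refine (lintegral_Icc_le_of_unit_le (hwin s hs hsr) R x).trans (le_of_eq ?_)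
    rw [← hm, ← ENNReal.ofReal_natCast, ← ENNReal.ofReal_mul (by positivity)]
    congr 1
    rw [hd]
    push_cast
    field_simp
  refine ⟨r, hr, fun s hs s₀ hs₀ hsr hs₀r x => ?_⟩
  calc ∫⁻ y in Set.Icc (x - R) (x + R), ‖U (s, y) - U (s₀, y)‖ₑ
      ≤ ∫⁻ y in Set.Icc (x - R) (x + R), (‖u s y - u t₀ y‖ₑ + ‖u s₀ y - u t₀ y‖ₑ) := by
        refine lintegral_mono_ae ?_
        filter_upwards [ae_restrict_of_ae hs.2, ae_restrict_of_ae hs₀.2] with y h1 h2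
        rw [← h1, ← h2, ← sub_sub_sub_cancel_right _ _ (u t₀ y)]
        exact enorm_sub_le
    _ = (∫⁻ y in Set.Icc (x - R) (x + R), ‖u s y - u t₀ y‖ₑ) +
          ∫⁻ y in Set.Icc (x - R) (x + R), ‖u s₀ y - u t₀ y‖ₑ := by
        refine lintegral_add_left' ?_ _
        exact (((hloc s hs.1).sub (hloc t₀ ht₀)).aestronglyMeasurable.restrict).enorm
    _ ≤ ENNReal.ofReal (η / 2) + ENNReal.ofReal (η / 2) :=
        add_le_add (hbig s hs.1 hsr x) (hbig s₀ hs₀.1 hs₀r x)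
    _ = ENNReal.ofReal η := by
        rw [← ENNReal.ofReal_add (by positivity) (by positivity)]; congr 1; ring

end TimeUniform

/-! ### Smooth controls and their representatives -/

section Controls

theorem IsCbInf.deriv {e : ℝ → ℝ} (he : IsCbInf e) : IsCbInf (deriv e) := by
  refine ⟨(contDiff_infty_iff_deriv.1 he.1).2, fun k => ?_⟩
  obtain ⟨C, hC⟩ := he.2 (k + 1)
  exact ⟨C, fun x => by rw [← iteratedDeriv_succ']; exact hC x⟩

theorem IsCbInf.bdd {e : ℝ → ℝ} (he : IsCbInf e) : ∃ C, ∀ x, |e x| ≤ C := by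
  simpa using he.2 0

theorem IsCbInf.bddC1x {e : ℝ → ℝ} (he : IsCbInf e) :
    BddC1x (fun z => e z.2) (fun z => _root_.deriv e z.2) := by
  obtain ⟨C, hC⟩ := he.bdd
  obtain ⟨C', hC'⟩ := he.deriv.bdd
  exact ⟨he.1.continuous.comp continuous_snd, he.deriv.1.continuous.comp continuous_snd,
    ⟨C, fun z => hC _⟩, ⟨C', fun z => hC' _⟩,
    fun t x => ((he.1.differentiable (by simp)) x).hasDerivAt⟩

/-- `k` is a control with continuous `x`-derivatives `k'` and `k''` and time derivative `kt`. -/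
structure CtrlRep (T : ℝ) (k k' k'' kt : ℝ × ℝ → ℝ) : Prop where
  c1 : BddC1x k k'
  c2 : BddC1x k' k''
  unif : TimeUnif k
  unif' : TimeUnif k'
  tcont : Continuous kt
  tbdd : ∃ C, ∀ z, |kt z| ≤ C
  tderiv : ∀ t ∈ Set.Ioo 0 T, ∀ x, HasDerivAt (fun s => k (s, x)) (kt (t, x)) t

variable {T : ℝ} {G : Submodule ℝ (ℝ → ℝ)}

theorem CtrlRep.add {k k' k'' kt l l' l'' lt : ℝ × ℝ → ℝ} (hk : CtrlRep T k k' k'' kt)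
    (hl : CtrlRep T l l' l'' lt) : CtrlRep T (fun z => k z + l z) (fun z => k' z + l' z)
      (fun z => k'' z + l'' z) (fun z => kt z + lt z) where
  c1 := hk.c1.add hl.c1
  c2 := hk.c2.add hl.c2
  unif := hk.unif.add hl.unif
  unif' := hk.unif'.add hl.unif'
  tcont := hk.tcont.add hl.tcont
  tbdd := by
    obtain ⟨C, hC⟩ := hk.tbdd
    obtain ⟨D, hD⟩ := hl.tbdd
    exact ⟨C + D, fun z => (abs_add_le _ _).trans (add_le_add (hC z) (hD z))⟩
  tderiv t ht x := (hk.tderiv t ht x).add (hl.tderiv t ht x)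

theorem exists_bound_IccExtend (hT : 0 ≤ T) {c : ℝ → ℝ} (hc : ContinuousOn c (Set.Icc 0 T)) :
    Continuous (Set.IccExtend hT (fun t => c t)) ∧
      ∃ C, ∀ t, |Set.IccExtend hT (fun t : Set.Icc 0 T => c t) t| ≤ C := by
  refine ⟨(continuousOn_iff_continuous_domRestrict.1 hc).Icc_extend', ?_⟩
  obtain ⟨C, hC⟩ := isCompact_Icc.exists_bound_of_continuousOn hc
  exact ⟨C, fun t => hC _ (Set.projIcc 0 T hT t).2⟩

/-- The coefficient is smooth only on [0,T]. It and its derivative are each extended by constants,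
which keeps both continuous and bounded on the line; the second remains the derivative of the first
on (0,T), and nothing more is claimed. -/
theorem exists_ctrlRep_single (hT : 0 < T) {c e : ℝ → ℝ}
    (hc : ContDiffOn ℝ ∞ c (Set.Icc 0 T)) (he : IsCbInf e) :
    ∃ k k' k'' kt, CtrlRep T k k' k'' kt ∧ (∀ t ∈ Set.Icc 0 T, ∀ x, c t * e x = k (t, x)) ∧
      ∀ t ∈ Set.Icc 0 T, ∀ x, kt (t, x) = derivWithin c (Set.Icc 0 T) t * e x := by
  have huniq : UniqueDiffOn ℝ (Set.Icc 0 T) := uniqueDiffOn_Icc hT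
  have hc' : ContDiffOn ℝ ∞ (derivWithin c (Set.Icc 0 T)) (Set.Icc 0 T) :=
    hc.derivWithin huniq (by simp)
  obtain ⟨hcc, C, hC⟩ := exists_bound_IccExtend hT.le hc.continuousOn
  obtain ⟨hcc', C', hC'⟩ := exists_bound_IccExtend hT.le hc'.continuousOn
  set a := Set.IccExtend hT.le (fun t : Set.Icc 0 T => c t) with ha
  set a' := Set.IccExtend hT.le (fun t : Set.Icc 0 T => derivWithin c (Set.Icc 0 T) t) with ha'
  have haeq : ∀ t ∈ Set.Icc 0 T, a t = c t := fun t ht => Set.IccExtend_of_mem _ _ ht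
  have haeq' : ∀ t ∈ Set.Icc 0 T, a' t = derivWithin c (Set.Icc 0 T) t := fun t ht =>
    Set.IccExtend_of_mem hT.le (fun t : Set.Icc 0 T => derivWithin c (Set.Icc 0 T) t) ht
  obtain ⟨D, hD⟩ := he.bdd
  obtain ⟨D', hD'⟩ := he.deriv.bdd
  have h1 := (BddC1x.of_time hcc hC).mul he.bddC1x
  have h2 := (BddC1x.of_time hcc hC).mul he.deriv.bddC1x
  simp only [zero_mul, zero_add] at h1 h2
  refine ⟨_, _, _, fun z => a' z.1 * e z.2, ⟨h1, h2,
    (timeUnif_of_time hcc).mul (timeUnif_of_space e) (fun z => hC _) (fun z => hD _),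
    (timeUnif_of_time hcc).mul (timeUnif_of_space _) (fun z => hC _) (fun z => hD' _), ?_,
    ⟨C' * D, fun z => ?_⟩, fun t ht x => ?_⟩, fun t ht x => ?_, fun t ht x => ?_⟩
  · exact (hcc'.comp continuous_fst).mul (he.1.continuous.comp continuous_snd)
  · rw [abs_mul]
    exact mul_le_mul (hC' _) (hD _) (abs_nonneg _) ((abs_nonneg _).trans (hC' 0))
  · have htI : t ∈ Set.Icc 0 T := ⟨ht.1.le, ht.2.le⟩
    have hnhds : Set.Icc 0 T ∈ 𝓝 t := Icc_mem_nhds ht.1 ht.2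
    have hd : HasDerivAt c (a' t) t := by
      rw [haeq' t htI]
      exact ((hc.differentiableOn (by simp)) t htI).hasDerivWithinAt.hasDerivAt hnhds
    have hd' : HasDerivAt a (a' t) t := hd.congr_of_eventuallyEq (by
      filter_upwards [hnhds] with s hs using haeq s hs)
    exact hd'.mul_const (e x)
  · simp only [haeq t ht]
  · simp only [haeq' t ht]

theorem IsSmoothControl.congr {η η' : ℝ → ℝ → ℝ} (h : IsSmoothControl T G η)
    (he : ∀ t ∈ Set.Icc 0 T, ∀ x, η' t x = η t x) : IsSmoothControl T G η' := by
  obtain ⟨n, e, c, h1, h2, h3⟩ := h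
  exact ⟨n, e, c, h1, h2, fun t ht x => (he t ht x).trans (h3 t ht x)⟩

theorem isSmoothControl_of_fintype {ι : Type*} [Fintype ι] {η : ℝ → ℝ → ℝ} (e c : ι → ℝ → ℝ)
    (he : ∀ i, e i ∈ G) (hc : ∀ i, ContDiffOn ℝ ∞ (c i) (Set.Icc 0 T))
    (h : ∀ t ∈ Set.Icc 0 T, ∀ x, η t x = ∑ i, c i t * e i x) : IsSmoothControl T G η := by
  let E := (Fintype.equivFin ι).symm
  refine ⟨Fintype.card ι, fun i => e (E i), fun i => c (E i), fun i => he _, fun i => hc _,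
    fun t ht x => ?_⟩
  rw [h t ht x]
  exact (Equiv.sum_comp E fun i => c i t * e i x).symm

theorem IsSmoothControl.single {c e : ℝ → ℝ} (he : e ∈ G) (hc : ContDiffOn ℝ ∞ c (Set.Icc 0 T)) :
    IsSmoothControl T G fun t x => c t * e x :=
  isSmoothControl_of_fintype (ι := Unit) (fun _ => e) (fun _ => c) (fun _ => he) (fun _ => hc)
    fun t _ x => by simp

theorem IsSmoothControl.zero : IsSmoothControl T G fun _ _ => 0 :=
  isSmoothControl_of_fintype (ι := Empty) (fun _ => 0) (fun _ => 0) (fun i => i.elim)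
    (fun i => i.elim) fun t _ x => by simp

theorem IsSmoothControl.add {η η' : ℝ → ℝ → ℝ} (h : IsSmoothControl T G η)
    (h' : IsSmoothControl T G η') : IsSmoothControl T G fun t x => η t x + η' t x := by
  obtain ⟨n, e, c, h1, h2, h3⟩ := h
  obtain ⟨n', e', c', h1', h2', h3'⟩ := h'
  refine isSmoothControl_of_fintype (ι := Fin n ⊕ Fin n') (Sum.elim e e') (Sum.elim c c')
    (fun i => ?_) (fun i => ?_) fun t ht x => ?_
  · cases i
    · exact h1 _
    · exact h1' _
  · cases i
    · exact h2 _
    · exact h2' _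
  · simp [Fintype.sum_sum_type, h3 t ht x, h3' t ht x]

theorem IsSmoothControl.time_mul {η : ℝ → ℝ → ℝ} (h : IsSmoothControl T G η) {χ : ℝ → ℝ}
    (hχ : ContDiff ℝ ∞ χ) : IsSmoothControl T G fun t x => χ t * η t x := by
  obtain ⟨n, e, c, h1, h2, h3⟩ := h
  refine ⟨n, e, fun i t => χ t * c i t, h1, fun i => hχ.contDiffOn.mul (h2 i), fun t ht x => ?_⟩
  simp only [h3 t ht x, Finset.mul_sum]
  exact Finset.sum_congr rfl fun i _ => (mul_assoc _ _ _).symm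

theorem IsSmoothControl.mono {G' : Submodule ℝ (ℝ → ℝ)} (hGG' : G ≤ G') {η : ℝ → ℝ → ℝ}
    (h : IsSmoothControl T G η) : IsSmoothControl T G' η := by
  obtain ⟨n, e, c, h1, h2, h3⟩ := h
  exact ⟨n, e, c, fun i => hGG' (h1 i), h2, h3⟩

/-- Induction over the number of terms of a control. -/
theorem IsSmoothControl.induction {P : (ℝ → ℝ → ℝ) → Prop} (zero : P fun _ _ => 0)
    (single : ∀ c e, ContDiffOn ℝ ∞ c (Set.Icc 0 T) → e ∈ G → P fun t x => c t * e x)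
    (add : ∀ a b, P a → P b → P fun t x => a t x + b t x)
    (congr : ∀ a b, P a → (∀ t ∈ Set.Icc 0 T, ∀ x, b t x = a t x) → P b) {η : ℝ → ℝ → ℝ}
    (h : IsSmoothControl T G η) : P η := by
  obtain ⟨n, e, c, h1, h2, h3⟩ := h
  refine congr (fun t x => ∑ i, c i t * e i x) _ ?_ h3
  clear h3
  induction n with
  | zero => simpa using zero
  | succ n ih =>
    simp only [Fin.sum_univ_castSucc]
    exact add _ _ (ih _ _ (fun i => h1 _) fun i => h2 _) (single _ _ (h2 _) (h1 _))

/-- That the time derivative is again a control with values in `G` is what makes absorbing an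
extended control into the solution admissible. -/
theorem IsSmoothControl.exists_ctrlRep (hT : 0 < T) (hG : ∀ w ∈ G, IsCbInf w) {η : ℝ → ℝ → ℝ}
    (h : IsSmoothControl T G η) : ∃ k k' k'' kt, CtrlRep T k k' k'' kt ∧
      (∀ t ∈ Set.Icc 0 T, ∀ x, η t x = k (t, x)) ∧ IsSmoothControl T G fun t x => kt (t, x) := by
  refine IsSmoothControl.induction (P := fun η => ∃ k k' k'' kt, CtrlRep T k k' k'' kt ∧
      (∀ t ∈ Set.Icc 0 T, ∀ x, η t x = k (t, x)) ∧ IsSmoothControl T G fun t x => kt (t, x))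
    ?_ ?_ ?_ ?_ h
  · have h0 : IsCbInf fun _ => 0 := hG _ G.zero_mem
    obtain ⟨k, k', k'', kt, h1, h2, h3⟩ := exists_ctrlRep_single hT (c := fun _ => 0)
      contDiffOn_const h0
    exact ⟨k, k', k'', kt, h1, fun t ht x => by rw [← h2 t ht x, zero_mul],
      IsSmoothControl.zero.congr fun t ht x => by rw [h3 t ht x, mul_zero]⟩
  · intro c e hc he
    obtain ⟨k, k', k'', kt, h1, h2, h3⟩ := exists_ctrlRep_single hT hc (hG e he)
    exact ⟨k, k', k'', kt, h1, h2,
      (IsSmoothControl.single he (hc.derivWithin (uniqueDiffOn_Icc hT) (by simp))).congr h3⟩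
  · rintro a b ⟨k, k', k'', kt, h1, h2, h3⟩ ⟨l, l', l'', lt, h1', h2', h3'⟩
    exact ⟨_, _, _, _, h1.add h1', fun t ht x => by simp only [h2 t ht x, h2' t ht x], h3.add h3'⟩
  · rintro a b ⟨k, k', k'', kt, h1, h2, h3⟩ hab
    exact ⟨k, k', k'', kt, h1, fun t ht x => (hab t ht x).trans (h2 t ht x), h3⟩

end Controls

/-! ### Integrability of forces against test functions -/

section Auxiliary

variable {μ T : ℝ} {f g : ℝ → ℝ → ℝ} {u₀ : ℝ → ℝ} {u : ℝ → ℝ → ℝ}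

theorem IsBurgersSolution.congr (hu : IsBurgersSolution μ T f g u₀ u) {f' g' : ℝ → ℝ → ℝ}
    (hf : ∀ t ∈ Set.Icc 0 T, ∀ x, f' t x = f t x) (hg : ∀ t ∈ Set.Icc 0 T, ∀ x, g' t x = g t x) :
    IsBurgersSolution μ T f' g' u₀ u := by
  obtain ⟨h1, h2, h3, v, h4, h5⟩ := hu
  refine ⟨h1, h2, h3, v, h4, fun φ hφ => ?_⟩
  have hm := measurableSet_slab T
  refine Eq.trans ?_ ((h5 φ hφ).trans ?_)
  · refine setIntegral_congr_fun hm fun z hz => ?_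
    have hz' := mem_slab.1 hz
    have : g' z.1 = g z.1 := funext (hg z.1 hz')
    simp only [this]
  · refine setIntegral_congr_fun hm fun z hz => ?_
    simp only [hf z.1 (mem_slab.1 hz)]

theorem IsBurgersSolution.exists_bound (hu : IsBurgersSolution μ T f g u₀ u) :
    ∃ M, 0 ≤ M ∧ ∀ᵐ z ∂volume.restrict (slab T), |u z.1 z.2| ≤ M := by
  refine ⟨(eLpNorm (fun z : ℝ × ℝ => u z.1 z.2) ⊤ (volume.restrict (slab T))).toReal,
    ENNReal.toReal_nonneg, ?_⟩
  have hfin := hu.1.2.ne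
  rw [eLpNorm_exponent_top] at hfin ⊢
  filter_upwards [ae_le_eLpNormEssSup (f := fun z : ℝ × ℝ => u z.1 z.2)] with z hz
  have := ENNReal.toReal_mono hfin hz
  simpa using this

theorem SlabLocallyIntegrable.add (hf : SlabLocallyIntegrable T f)
    (hg : SlabLocallyIntegrable T g) : SlabLocallyIntegrable T fun t x => f t x + g t x := by
  intro φ hφ
  have := (hf φ hφ).add (hg φ hφ)
  refine this.congr (ae_of_all _ fun z => ?_)
  simp only [Pi.add_apply]
  ring

theorem SlabLocallyIntegrable.of_continuous {k : ℝ × ℝ → ℝ} (hk : Continuous k)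
    (hg : ∀ t ∈ Set.Icc 0 T, ∀ x, g t x = k (t, x)) : SlabLocallyIntegrable T g := by
  intro φ hφ
  have h1 := integrableOn_bounded_mul (T := T) hk.locallyIntegrable hφ.1.continuous hφ.2.1
  refine h1.congr_fun (fun z hz => ?_) (measurableSet_slab T)
  simp only [hg z.1 (mem_slab.1 hz) z.2]

/-- On the support of a test function the L¹ norm in x is bounded by finitely many L² norms on unit
intervals, and these are integrable in time. -/
theorem slabLocallyIntegrable_of_memLpHul {h : ℝ → ℝ → ℝ} (hh : MemLpHul 2 0 T h) :
    SlabLocallyIntegrable T h := by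
  intro φ hφ
  obtain ⟨hm, m, hmp, hmle⟩ := hh
  obtain ⟨C, R, hC, hR⟩ := exists_bound_support hφ.1.continuous hφ.2.1
  refine ⟨hm.mul hφ.1.continuous.aestronglyMeasurable, ?_⟩
  have hfin : IsFiniteMeasure (volume.restrict (Set.Icc 0 T)) := isFiniteMeasure_restrict.2 (by simp)
  have hmi : Integrable m (volume.restrict (Set.Icc 0 T)) := hmp.integrable (by norm_num)
  have hms : MeasurableSet ((Set.univ : Set ℝ) ×ˢ Set.Icc (0 - R) (0 + R)) :=
    MeasurableSet.univ.prod measurableSet_Icc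
  set F : ℝ × ℝ → ℝ≥0∞ := ((Set.univ : Set ℝ) ×ˢ Set.Icc (0 - R) (0 + R)).indicator
    fun z => ENNReal.ofReal C * ‖h z.1 z.2‖ₑ with hF
  have hFm : AEMeasurable F (volume.restrict (slab T)) := (hm.enorm.const_mul _).indicator hms
  calc ∫⁻ z in slab T, ‖h z.1 z.2 * φ z‖ₑ ≤ ∫⁻ z in slab T, F z := by
        refine lintegral_mono fun z => ?_
        by_cases hz : z.2 ∈ Set.Icc (0 - R) (0 + R)
        · rw [hF, Set.indicator_of_mem (by exact ⟨trivial, hz⟩), enorm_mul, mul_comm]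
          gcongr
          exact enorm_le_ofReal (hC z)
        · have : φ z = 0 := hR z (by
            refine lt_of_lt_of_le ?_ (norm_snd_le z)
            rw [Real.norm_eq_abs]
            by_contra hle
            rw [not_lt, abs_le] at hle
            exact hz ⟨by linarith, by linarith⟩)
          simp [this]
    _ = ∫⁻ t in Set.Icc 0 T, ∫⁻ x, F (t, x) := by
        rw [restrict_slab] at hFm ⊢
        exact lintegral_prod _ hFm
    _ ≤ ∫⁻ t in Set.Icc 0 T, ENNReal.ofReal C * ((⌈2 * R⌉₊ + 1 : ℕ) * ENNReal.ofReal (m t)) := by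
        refine lintegral_mono_ae ?_
        filter_upwards [hmle] with t ht
        have hl : LocallyIntegrable (h t) volume :=
          locallyIntegrable_of_hulNorm_ne_top (ht.trans_lt ENNReal.ofReal_lt_top).ne
        have e : ∫⁻ x, F (t, x) = ENNReal.ofReal C * ∫⁻ x in Set.Icc (0 - R) (0 + R), ‖h t x‖ₑ := by
          rw [← lintegral_const_mul' _ _ (by simp), ← lintegral_indicator measurableSet_Icc]
          refine lintegral_congr fun x => ?_
          simp [hF, Set.indicator]
        rw [e]
        gcongr
        refine lintegral_Icc_le_of_unit_le (fun y => ?_) R 0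
        rw [← eLpNorm_one_eq_lintegral_enorm]
        have : IsProbabilityMeasure (volume.restrict (Set.Icc y (y + 1))) := ⟨by simp⟩
        refine (eLpNorm_le_eLpNorm_of_exponent_le (q := 2) (by norm_num)
          hl.aestronglyMeasurable.restrict).trans (le_trans ?_ ht)
        rw [hulNorm_zero_eq hl]
        exact le_iSup (fun y : ℝ => eLpNorm (h t) 2 (volume.restrict (Set.Icc y (y + 1)))) y
    _ < ⊤ := by
        rw [lintegral_const_mul' _ _ (by simp), lintegral_const_mul' _ _ (by simp)]
        refine ENNReal.mul_lt_top (by simp) (ENNReal.mul_lt_top (by simp) ?_)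
        refine lt_of_le_of_lt (lintegral_mono fun t => ?_) hmi.2
        rw [Real.enorm_eq_ofReal_abs]
        exact ENNReal.ofReal_le_ofReal (le_abs_self _)

/-- A function on the slab, bounded by a function of time, in `L¹` of strips. -/
theorem lintegral_strip_le {F : ℝ × ℝ → ℝ} {r : ℝ → ℝ} (hr : Measurable r)
    (hF : ∀ z : ℝ × ℝ, z.1 ∈ Set.Icc 0 T → |F z| ≤ r z.1)
    (hF0 : ∀ z : ℝ × ℝ, z.1 ∉ Set.Icc 0 T → F z = 0) (R x : ℝ) :
    ∫⁻ z in (Set.univ : Set ℝ) ×ˢ Set.Icc (x - R) (x + R), ‖F z‖ₑ ≤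
      (∫⁻ t in Set.Icc 0 T, ENNReal.ofReal (r t)) * ENNReal.ofReal (2 * R) := by
  calc _ ≤ ∫⁻ z in (Set.univ : Set ℝ) ×ˢ Set.Icc (x - R) (x + R),
        (Set.Icc 0 T).indicator (fun t => ENNReal.ofReal (r t)) z.1 * 1 := by
        refine lintegral_mono fun z => ?_
        by_cases hz : z.1 ∈ Set.Icc 0 T
        · rw [Set.indicator_of_mem hz, mul_one]; exact enorm_le_ofReal (hF z hz)
        · simp [hF0 z hz]
    _ = _ := by
        rw [Measure.volume_eq_prod, ← Measure.prod_restrict, Measure.restrict_univ,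
          lintegral_prod_mul (f := (Set.Icc 0 T).indicator fun t => ENNReal.ofReal (r t))
            (g := fun _ => 1) (hr.ennreal_ofReal.indicator measurableSet_Icc).aemeasurable
            aemeasurable_const, lintegral_indicator measurableSet_Icc, setLIntegral_one,
          Real.volume_Icc]
        congr 2
        ring

end Auxiliary

/-! ### Absorbing an extended control into the solution -/

section Shift

variable {μ T : ℝ} {f : ℝ → ℝ → ℝ} {u₀ : ℝ → ℝ} {u : ℝ → ℝ → ℝ} {k k' k'' kt : ℝ × ℝ → ℝ}

/-- The integrand is ∂_t(kφ), and φ vanishes at both ends of the time interval, so k itself need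
not. -/
theorem CtrlRep.integral_partialT (hk : CtrlRep T k k' k'' kt) (hT : 0 < T) {φ : ℝ × ℝ → ℝ}
    (hφ : IsTestFunction T φ) :
    IntegrableOn (fun z => k z * partialT φ z + kt z * φ z) (slab T) volume ∧
    ∫ z in slab T, (k z * partialT φ z + kt z * φ z) = 0 := by
  obtain ⟨C, hC⟩ := hk.c1.bdd
  obtain ⟨C', hC'⟩ := hk.tbdd
  have hTc := (contDiff_partialT hφ.1).continuous
  have hint : IntegrableOn (fun z => k z * partialT φ z + kt z * φ z) (slab T) volume :=
    (integrableOn_slab_mul hk.c1.cont.measurable hC hTc hφ.2.1.partialT).add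
      (integrableOn_slab_mul hk.tcont.measurable hC' hφ.1.continuous hφ.2.1)
  refine ⟨hint, ?_⟩
  rw [IntegrableOn, restrict_slab] at hint
  rw [restrict_slab, integral_prod_symm _ hint]
  refine integral_eq_zero_of_ae (ae_of_all _ fun x => ?_)
  simp only [Pi.zero_apply]
  rw [integral_Icc_eq_integral_Ioc, ← intervalIntegral.integral_of_le hT.le]
  have h0 : ∀ t, t ∉ Set.Ioo 0 T → φ (t, x) = 0 := fun t ht => hφ.eq_zero ht
  have hkc := hk.c1.cont
  have hkt := hk.tcont
  have hφc := hφ.1.continuous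
  rw [intervalIntegral.integral_eq_sub_of_hasDerivAt_of_le hT.le
    (f := fun t => k (t, x) * φ (t, x)) (by fun_prop) (fun t ht => ?_)
    (Continuous.intervalIntegrable (by fun_prop) _ _)]
  · rw [h0 T (by simp), h0 0 (by simp)]; ring
  · have := (hk.tderiv t ht x).mul (hasDerivAt_partialT (hφ.1.differentiable (by simp)) t x)
    exact this.congr_deriv (by rw [add_comm])

/-- Absorbing the extended control into the solution. -/
theorem IsBurgersSolution.shift (hT : 0 < T) (hu₀ : Continuous u₀)
    (hf : SlabLocallyIntegrable T f) (hk : CtrlRep T k k' k'' kt) (h0 : ∀ x, k (0, x) = 0)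
    (hu : IsBurgersSolution μ T f (fun t x => k (t, x)) u₀ u) :
    IsBurgersSolution μ T (fun t x => f t x + kt (t, x)) (fun _ _ => 0) u₀
      (fun t x => u t x + k (t, x)) := by
  obtain ⟨M, hM0, hM⟩ := hu.exists_bound
  obtain ⟨U, V, hU, -, hflux⟩ := hu.exists_regularRep hM hM0
  have hflux := hflux k k' hk.c1 (fun _ _ _ => rfl)
  have hz : BddC1x (fun _ => (0 : ℝ)) (fun _ => 0) :=
    BddC1x.of_time (c := fun _ => 0) continuous_const (C := 0) (by simp)
  obtain ⟨C, hC⟩ := hk.c1.bdd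
  have hkc := hk.c1.cont
  refine (hU.add (hk.c1.regularRep T)).isBurgersSolution ?_ hz (fun _ _ _ => rfl) fun φ hφ => ?_
  · refine hu.2.1.add hT hu₀ (fun t => by fun_prop) (C := C) ((abs_nonneg _).trans (hC 0))
      (fun t _ x => hC _) (fun t₀ _ η hη => (hk.unif t₀ η hη).filter_mono nhdsWithin_le_nhds)
      fun η hη => ?_
    have := (hk.unif 0 η hη).filter_mono (nhdsWithin_le_nhds (s := Set.Ioi 0))
    simpa only [h0, sub_zero] using this
  · obtain ⟨i1, h1⟩ := hk.integral_partialT hT hφ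
    obtain ⟨CU, hCU⟩ := hU.bdd
    obtain ⟨Ct, hCt⟩ := hk.tbdd
    have hX := contDiff_partialX hφ.1
    have hXX := (contDiff_partialX hX).continuous
    have mU := hU.meas
    have mk := hkc.measurable
    have hsum : ∀ z, |U z + k z| ≤ CU + C := fun z =>
      (abs_add_le _ _).trans (add_le_add (hCU z) (hC z))
    have i2 : IntegrableOn (fun z => - U z * partialT φ z - μ * (U z + k z) * partialX (partialX φ) z -
        (U z + k z) ^ 2 / 2 * partialX φ z) (slab T) volume := by
      refine Integrable.sub (Integrable.sub ?_ ?_) ?_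
      · exact integrableOn_slab_mul (by fun_prop) (C := CU)
          (fun z => by rw [abs_neg]; exact hCU z) (contDiff_partialT hφ.1).continuous
          hφ.2.1.partialT
      · exact integrableOn_slab_mul (by fun_prop) (C := |μ| * (CU + C)) (fun z => by
          rw [abs_mul]
          exact mul_le_mul_of_nonneg_left (hsum z) (abs_nonneg _)) hXX hφ.2.1.partialX.partialX
      · exact integrableOn_slab_mul (by fun_prop) (C := (CU + C) ^ 2 / 2) (fun z => by
          rw [abs_div, abs_of_pos (by norm_num : (0 : ℝ) < 2), abs_pow]
          gcongr
          exact hsum z) hX.continuous hφ.2.1.partialX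
    have i3 : IntegrableOn (fun z => kt z * φ z) (slab T) volume :=
      integrableOn_slab_mul hk.tcont.measurable hCt hφ.1.continuous hφ.2.1
    have e : ∫ z in slab T, (- (U z + (slab T).indicator k z) * partialT φ z -
        μ * (U z + (slab T).indicator k z + 0) * partialX (partialX φ) z -
        (U z + (slab T).indicator k z + 0) ^ 2 / 2 * partialX φ z) =
        (∫ z in slab T, (- U z * partialT φ z - μ * (U z + k z) * partialX (partialX φ) z -
        (U z + k z) ^ 2 / 2 * partialX φ z)) -
        (∫ z in slab T, (k z * partialT φ z + kt z * φ z)) + ∫ z in slab T, kt z * φ z := by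
      rw [← integral_sub' i2 i1, ← integral_add' (i2.sub i1) i3]
      refine setIntegral_congr_fun (measurableSet_slab T) fun z hz => ?_
      simp only [Set.indicator_of_mem hz, Pi.add_apply, Pi.sub_apply]
      ring
    rw [e, h1, hflux φ hφ, sub_zero]
    simp only [add_mul]
    rw [integral_add (hf φ hφ) i3]

end Shift

/-! ### Removing the extended control by a cutoff in time -/

section Cutoff

variable {μ T : ℝ} {f : ℝ → ℝ → ℝ} {u₀ : ℝ → ℝ} {u : ℝ → ℝ → ℝ} {G : Submodule ℝ (ℝ → ℝ)}

/-- A cutoff in time which vanishes at `0` and at `T`. -/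
noncomputable def timeCutoff (T : ℝ) (n : ℕ) (t : ℝ) : ℝ :=
  (1 - (t / T) ^ (n + 1)) * (1 - (1 - t / T) ^ (n + 1))

theorem contDiff_timeCutoff (T : ℝ) (n : ℕ) : ContDiff ℝ ∞ (timeCutoff T n) := by
  unfold timeCutoff
  fun_prop

theorem timeCutoff_mem (hT : 0 < T) (n : ℕ) {t : ℝ} (ht : t ∈ Set.Icc 0 T) :
    0 ≤ timeCutoff T n t ∧ timeCutoff T n t ≤ 1 ∧
      1 - timeCutoff T n t ≤ (t / T) ^ (n + 1) + (1 - t / T) ^ (n + 1) := by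
  have h1 : 0 ≤ t / T := div_nonneg ht.1 hT.le
  have h2 : t / T ≤ 1 := (div_le_one hT).2 ht.2
  have a1 : 0 ≤ (t / T) ^ (n + 1) := by positivity
  have a2 : (t / T) ^ (n + 1) ≤ 1 := pow_le_one₀ h1 h2
  have b1 : 0 ≤ (1 - t / T) ^ (n + 1) := pow_nonneg (by linarith) _
  have b2 : (1 - t / T) ^ (n + 1) ≤ 1 := pow_le_one₀ (by linarith) (by linarith)
  unfold timeCutoff
  refine ⟨mul_nonneg (by linarith) (by linarith), ?_, ?_⟩
  · exact mul_le_one₀ (by linarith) (by linarith) (by linarith)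
  · nlinarith [mul_nonneg a1 b1]

/-- The cutoff tends to 1 in L¹ at rate 1/n, although it vanishes at both ends. L¹ smallness is all
that the kernel estimate needs. -/
theorem lintegral_timeCutoff_le (hT : 0 < T) (n : ℕ) {C : ℝ} (hC : 0 ≤ C) :
    ∫⁻ t in Set.Icc 0 T, ENNReal.ofReal (C * ((t / T) ^ (n + 1) + (1 - t / T) ^ (n + 1))) ≤
      ENNReal.ofReal (C * (2 * T / ((n : ℝ) + 2))) := by
  have hc : Continuous fun t => C * ((t / T) ^ (n + 1) + (1 - t / T) ^ (n + 1)) := by fun_prop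
  rw [← ofReal_integral_eq_lintegral_ofReal hc.continuousOn.integrableOn_Icc]
  · refine ENNReal.ofReal_le_ofReal (le_of_eq ?_)
    rw [integral_Icc_eq_integral_Ioc, ← intervalIntegral.integral_of_le hT.le,
      intervalIntegral.integral_const_mul, intervalIntegral.integral_add
      (Continuous.intervalIntegrable (by fun_prop) _ _)
      (Continuous.intervalIntegrable (by fun_prop) _ _),
      intervalIntegral.integral_comp_div (fun y => y ^ (n + 1)) hT.ne',
      intervalIntegral.integral_comp_sub_div (fun y => y ^ (n + 1)) hT.ne']
    simp only [zero_div, div_self hT.ne', sub_self, sub_zero, integral_pow, smul_eq_mul]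
    push_cast
    have : (n : ℝ) + 1 + 1 = n + 2 := by ring
    rw [this, one_pow, zero_pow (by lia)]
    ring
  · filter_upwards [ae_restrict_mem measurableSet_Icc] with t ht
    have := timeCutoff_mem hT n ht
    exact mul_nonneg hC (by linarith)

/-- The extended control can be replaced by a usual one. -/
theorem IsBurgersSolution.exists_of_extended (hμ : 0 < μ) (hT : 0 < T) (hu₀ : Continuous u₀)
    (hG : ∀ w ∈ G, IsCbInf w) (hf : SlabLocallyIntegrable T f) {ζ : ℝ → ℝ → ℝ}
    (hζ : IsSmoothControl T G ζ) (hu : IsBurgersSolution μ T f ζ u₀ u) {ε : ℝ} (hε : 0 < ε) :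
    ∃ η, IsSmoothControl T G η ∧ ∃ u', IsBurgersSolution μ T (fun t x => f t x + η t x)
      (fun _ _ => 0) u₀ u' ∧ ∃ w : ℝ → ℝ, Continuous w ∧ (∀ x, |w x| ≤ ε) ∧
        u' T = fun x => u T x + w x := by
  obtain ⟨M, hM0, hM⟩ := hu.exists_bound
  obtain ⟨U, V, hU, hUM, hflux⟩ := hu.exists_regularRep hM hM0
  obtain ⟨k, k', k'', kt, hk, hζk, -⟩ := hζ.exists_ctrlRep hT hG
  have hflux := hflux k k' hk.c1 hζk
  obtain ⟨Ck, hCk⟩ := hk.c1.bdd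
  obtain ⟨Ck', hCk'⟩ := hk.c1.bdd'
  have hCk0 : 0 ≤ Ck := (abs_nonneg _).trans (hCk 0)
  have hCk'0 : 0 ≤ Ck' := (abs_nonneg _).trans (hCk' 0)
  obtain ⟨lam, hlam, δ, hδ, hpert⟩ := exists_perturbed_solution hμ hT (M := M + Ck) (by positivity) hε
  set C : ℝ := |μ| * Ck' + Ck * (M + Ck) with hC
  have hC0 : 0 ≤ C := by positivity
  obtain ⟨R, hR, d, hd, hsmall⟩ := exists_abs_kconv_le (integrable_heatK hμ hlam) hC0 hδ
  -- The left side is the bound for the source in L¹ of a strip of width 2R: the size C, the L¹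
  -- distance of the cutoff from 1, and the width.
  obtain ⟨n, hn⟩ : ∃ n : ℕ, C * (2 * T / ((n : ℝ) + 2)) * (2 * R) ≤ d := by
    obtain ⟨n, hn⟩ := exists_nat_ge (C * (2 * T) * (2 * R) / d)
    refine ⟨n, ?_⟩
    rw [div_le_iff₀ hd] at hn
    rw [mul_div_assoc', div_mul_eq_mul_div, div_le_iff₀ (by positivity)]
    nlinarith
  set χ := timeCutoff T n with hχ
  have hζ' := hζ.time_mul (contDiff_timeCutoff T n)
  obtain ⟨l, l', l'', lt, hl, hζl, hlt⟩ := hζ'.exists_ctrlRep hT hG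
  have hlk : ∀ t ∈ Set.Icc 0 T, ∀ x, l (t, x) = χ t * k (t, x) := fun t ht x => by
    rw [← hζl t ht x, hζk t ht x]
  have hlk' : ∀ t ∈ Set.Icc 0 T, ∀ x, l' (t, x) = χ t * k' (t, x) := fun t ht x => by
    have h1 := hl.c1.deriv t x
    simp only [hlk t ht] at h1
    exact h1.unique ((hk.c1.deriv t x).const_mul (χ t))
  have hz : BddC1x (fun _ => (0 : ℝ)) (fun _ => 0) :=
    BddC1x.of_time (c := fun _ => 0) continuous_const (C := 0) (by simp)
  -- With the new control χk in place of k, every term of the source contains the factor χ − 1.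
  have hsrc : ∀ z : ℝ × ℝ, z.1 ∈ Set.Icc 0 T → |perturbSource μ T lam U k k' l l' (fun _ => 0) z| ≤
      C * (1 - χ z.1) := by
    rintro ⟨t, x⟩ hz
    obtain ⟨hχ0, hχ1, -⟩ := timeCutoff_mem hT n hz
    change 0 ≤ χ t at hχ0
    change χ t ≤ 1 at hχ1
    simp only at hz
    have e : perturbSource μ T lam U k k' l l' (fun _ => 0) (t, x) = Real.exp (-(lam * t)) *
        ((χ t - 1) * (μ * k' (t, x) - k (t, x) * (U (t, x) + (χ t + 1) / 2 * k (t, x)))) := by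
      rw [perturbSource, Set.indicator_of_mem (mem_slab.2 hz), hlk t hz, hlk' t hz]
      ring
    rw [e, abs_mul, Real.abs_exp, abs_mul, abs_of_nonpos (by linarith : χ t - 1 ≤ 0)]
    have h1 : Real.exp (-(lam * t)) ≤ 1 := Real.exp_le_one_iff.2 (by
      have := mul_nonneg hlam.le hz.1
      linarith)
    have h2 : |μ * k' (t, x) - k (t, x) * (U (t, x) + (χ t + 1) / 2 * k (t, x))| ≤ C := by
      refine (abs_sub _ _).trans (add_le_add ?_ ?_)
      · rw [abs_mul]
        exact mul_le_mul_of_nonneg_left (hCk' _) (abs_nonneg _)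
      · rw [abs_mul]
        refine mul_le_mul (hCk _) ((abs_add_le _ _).trans (add_le_add (hUM _) ?_)) (abs_nonneg _)
          hCk0
        rw [abs_mul, abs_of_nonneg (by linarith)]
        have := hCk (t, x)
        nlinarith [abs_nonneg (k (t, x))]
    calc _ ≤ 1 * (-(χ t - 1) * C) := by
          exact mul_le_mul h1 (mul_le_mul_of_nonneg_left h2 (by linarith))
            (mul_nonneg (by linarith) (abs_nonneg _)) zero_le_one
      _ = C * (1 - χ t) := by ring
  have hsrc0 : ∀ z : ℝ × ℝ, z.1 ∉ Set.Icc 0 T →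
      perturbSource μ T lam U k k' l l' (fun _ => 0) z = 0 := fun z hz =>
    Set.indicator_of_notMem (fun h => hz (mem_slab.1 h)) _
  obtain ⟨A', hA', -⟩ := exists_xDiff_perturbSource (μ := μ) hlam.le hU.toXDiff hk.c1 hk.c2 hl.c1
    hl.c2 hz
  obtain ⟨w, hwc, hwε, hsol⟩ := hpert hf hu₀ hk.c1 hk.c2 hl.c1 hl.c2 hz (fun z hz => by
      obtain ⟨hχ0, hχ1, -⟩ := timeCutoff_mem hT n (mem_slab.1 hz)
      rw [hlk z.1 (mem_slab.1 hz) z.2, abs_mul, abs_of_nonneg hχ0]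
      have := mul_le_mul hχ1 (hCk z) (abs_nonneg _) zero_le_one
      linarith) hU (fun z => (hUM z).trans (by linarith)) hflux hu.2.1
    (hsmall _ hA'.meas (fun z => by
      by_cases hz : z.1 ∈ Set.Icc 0 T
      · refine (hsrc z hz).trans ?_
        have := (timeCutoff_mem hT n hz).1
        nlinarith
      · rw [hsrc0 z hz, abs_zero]; exact hC0) fun x => by
      refine (lintegral_strip_le (T := T)
        (r := fun t => C * ((t / T) ^ (n + 1) + (1 - t / T) ^ (n + 1))) (by fun_prop)
        (fun z hz => (hsrc z hz).trans ?_) hsrc0 R x).trans ?_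
      · exact mul_le_mul_of_nonneg_left (timeCutoff_mem hT n hz).2.2 hC0
      · refine (mul_le_mul_left (lintegral_timeCutoff_le hT n hC0) _).trans ?_
        rw [← ENNReal.ofReal_mul (by positivity)]
        exact ENNReal.ofReal_le_ofReal hn)
  simp only [add_zero] at hsol
  -- Vanishing at 0 preserves the initial condition when the control is absorbed; vanishing at `T`
  -- makes the absorbed control invisible in the final state.
  have hχ0 : χ 0 = 0 := by simp [hχ, timeCutoff]
  have hχT : χ T = 0 := by simp [hχ, timeCutoff, hT.ne']
  have hfin := hsol.shift hT hu₀ hf hl (fun x => by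
    rw [hlk 0 ⟨le_rfl, hT.le⟩, hχ0, zero_mul])
  refine ⟨_, hlt, _, hfin, fun x => w (T, x), by fun_prop, hwε T ⟨hT.le, le_rfl⟩, ?_⟩
  funext x
  rw [hlk T ⟨hT.le, le_rfl⟩, hχT, zero_mul, add_zero]

end Cutoff

/-! ### Fast oscillating controls and the generators of the extended space -/

section Oscillation

variable {μ T : ℝ} {f : ℝ → ℝ → ℝ} {u₀ : ℝ → ℝ} {u : ℝ → ℝ → ℝ} {G : Submodule ℝ (ℝ → ℝ)}

theorem BddC1x.zero : BddC1x (fun _ => (0 : ℝ)) (fun _ => 0) :=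
  BddC1x.of_time (c := fun _ => 0) continuous_const (C := 0) (by simp)

/-- The amplitude only has to be continuous in time inside (0,T]; the jumps from the restriction to
the slab are handled by the translation estimate for cut-off functions. -/
theorem exists_abs_kconv_slab_oscillation_le {κ a : ℝ × ℝ → ℝ} {S : Set ℝ}
    (hκ : Integrable κ volume) (ha : Measurable a) {M : ℝ} (hM : ∀ z, |a z| ≤ M)
    (hTC : TimeContinuous T S a) (hS : S ⊆ Set.Icc 0 T)
    (hSae : ∀ᵐ s, s ∈ Set.Ioc 0 T → s ∈ S) {ε : ℝ} (hε : 0 < ε) :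
    ∃ τ₀ > 0, ∀ τ, 0 < τ → τ < τ₀ → ∀ e : ℝ → ℝ, Measurable e → (∀ s, |e s| ≤ 1) →
      (∀ s, e (s + τ) = - e s) →
      ∀ z, |kconv κ (fun w => e w.1 * (slab T).indicator a w) z| ≤ ε := by
  have hm : Measurable ((slab T).indicator a) := ha.indicator (measurableSet_slab T)
  have hb : ∀ z, |(slab T).indicator a z| ≤ M := fun z => by
    by_cases hz : z ∈ slab T
    · rw [Set.indicator_of_mem hz]; exact hM z
    · rw [Set.indicator_of_notMem hz, abs_zero]; exact (abs_nonneg _).trans (hM 0)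
  refine exists_abs_kconv_oscillation_le hκ hm hb (fun R δ hR hδ => ?_) hε
  refine TimeContinuous.exists_translate_le (hTC.congr fun s hs y => ?_) hm hSae hb
    (fun z hz => Set.indicator_of_notMem (fun h => hz (mem_slab.1 h)) _) R δ hR hδ
  exact Set.indicator_of_mem (mem_slab.2 (hS hs)) _

/-- A fast oscillating extended control reproduces the nonlinear term. -/
theorem IsBurgersSolution.exists_oscillating (hμ : 0 < μ) (hT : 0 < T) (hu₀ : Continuous u₀)
    (hG : ∀ w ∈ G, IsCbInf w) (hf : SlabLocallyIntegrable T f) {ζ : ℝ → ℝ → ℝ}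
    (hζ : IsSmoothControl T G ζ) (hu : IsBurgersSolution μ T f (fun _ _ => 0) u₀ u) {ε : ℝ}
    (hε : 0 < ε) :
    ∃ ζ', IsSmoothControl T G ζ' ∧ ∃ u', IsBurgersSolution μ T
      (fun t x => f t x + ζ t x * deriv (ζ t) x) ζ' u₀ u' ∧
        ∃ w : ℝ → ℝ, Continuous w ∧ (∀ x, |w x| ≤ ε) ∧ u' T = fun x => u T x + w x := by
  obtain ⟨M, hM0, hM⟩ := hu.exists_bound
  obtain ⟨U, V, hU, hUM, hflux⟩ := hu.exists_regularRep hM hM0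
  obtain ⟨p, p', p'', pt, hp, hζp, -⟩ := hζ.exists_ctrlRep hT hG
  have hflux := hflux _ _ BddC1x.zero (fun _ _ _ => rfl)
  obtain ⟨C, hC⟩ := hp.c1.bdd
  obtain ⟨C', hC'⟩ := hp.c1.bdd'
  have hC0 : 0 ≤ C := (abs_nonneg _).trans (hC 0)
  have hC'0 : 0 ≤ C' := (abs_nonneg _).trans (hC' 0)
  obtain ⟨lam, hlam, δ, hδ, hpert⟩ := exists_perturbed_solution hμ hT (M := M + 2 * C)
    (by positivity) hε
  -- Continuity in time is a property of u, whereas estimates use the representative `U`. They agree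
  -- on almost every slice, and the times in S are those where continuity transfers.
  set S : Set ℝ := {t | t ∈ Set.Ioc 0 T ∧ u t =ᵐ[volume] fun x => U (t, x)} with hS
  have hSI : S ⊆ Set.Icc 0 T := fun t ht => ⟨ht.1.1.le, ht.1.2⟩
  have hSae : ∀ᵐ s, s ∈ Set.Ioc 0 T → s ∈ S := by
    filter_upwards [(ae_restrict_iff' measurableSet_Icc).1 hU.ae_slice_eq] with s hs hsI
    exact ⟨hsI, hs ⟨hsI.1.le, hsI.2⟩⟩
  have hE := BddC1x.exp_neg hlam.le
  obtain ⟨CE, hCE⟩ := hE.bdd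
  have hEu : TimeUnif fun z => Real.exp (-(lam * |z.1|)) :=
    timeUnif_of_time (c := fun t => Real.exp (-(lam * |t|))) (by fun_prop)
  have mE := hE.cont.measurable
  have mp := hp.c1.cont.measurable
  have mp' := hp.c2.cont.measurable
  have hUT : TimeContinuous T S U := hu.2.1.timeContinuous
  have hconst : ∀ r : ℝ, TimeUnif fun _ => r := fun r => timeUnif_of_time (c := fun _ => r)
    continuous_const
  have hpp : ∀ z, |p z * p z| ≤ C * C := fun z => by
    rw [abs_mul]; exact mul_le_mul (hC z) (hC z) (abs_nonneg _) hC0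
  have hpU : ∀ z, |p z * U z| ≤ C * M := fun z => by
    rw [abs_mul]; exact mul_le_mul (hC z) (hUM z) (abs_nonneg _) hC0
  have hcm : ∀ {F : ℝ × ℝ → ℝ} {K : ℝ} (r : ℝ), (∀ z, |F z| ≤ K) → ∀ z, |r * F z| ≤ |r| * K :=
    fun r h z => by rw [abs_mul]; exact mul_le_mul_of_nonneg_left (h z) (abs_nonneg _)
  have hμp := hcm μ hC'
  have hsum : ∀ z, |μ * p' z + -1 * (p z * U z)| ≤ |μ| * C' + |(-1 : ℝ)| * (C * M) := fun z =>
    (abs_add_le _ _).trans (add_le_add (hμp z) (hcm (-1) hpU z))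
  have hEb : ∀ {F : ℝ × ℝ → ℝ} {K : ℝ}, (∀ z, |F z| ≤ K) →
      ∀ z : ℝ × ℝ, |Real.exp (-(lam * |z.1|)) * F z| ≤ CE * K := fun h z => by
    rw [abs_mul]
    exact mul_le_mul (hCE z) (h z) (abs_nonneg _) ((abs_nonneg _).trans (hCE 0))
  have t1 : TimeContinuous T S fun z => Real.exp (-(lam * |z.1|)) *
      (√2 * (μ * p' z + -1 * (p z * U z))) := by
    refine (hEu.timeContinuous T S).mul (((hconst √2).timeContinuous T S).mul
      ((((hconst μ).mul hp.unif' (C := |μ|) (fun _ => le_rfl) hC').timeContinuous T S).add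
        (((hconst (-1)).timeContinuous T S).mul ((hp.unif.timeContinuous T S).mul hUT mp hU.meas
          hC hUM) (by fun_prop) (mp.mul hU.meas) (Cf := |(-1)|) (fun _ => le_rfl) hpU)
        (by fun_prop)) (by fun_prop) ?_ (Cf := |√2|) (fun _ => le_rfl) hsum) mE ?_ hCE
        (hcm √2 hsum)
    · exact (mp'.const_mul μ).add ((mp.mul hU.meas).const_mul (-1))
    · exact ((mp'.const_mul μ).add ((mp.mul hU.meas).const_mul (-1))).const_mul √2
  have t2 : TimeContinuous T S fun z => Real.exp (-(lam * |z.1|)) * (1 / 2 * (p z * p z)) :=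
    (hEu.mul ((hconst (1 / 2)).mul (hp.unif.mul hp.unif hC hC) (C := |(1 / 2)|) (fun _ => le_rfl)
      hpp) hCE (hcm (1 / 2) hpp)).timeContinuous T S
  have hκ := integrable_heatK hμ hlam
  have m1 : Measurable fun z : ℝ × ℝ => Real.exp (-(lam * |z.1|)) *
      (√2 * (μ * p' z + -1 * (p z * U z))) :=
    mE.mul (((mp'.const_mul μ).add ((mp.mul hU.meas).const_mul (-1))).const_mul √2)
  have m2 : Measurable fun z : ℝ × ℝ => Real.exp (-(lam * |z.1|)) * (1 / 2 * (p z * p z)) :=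
    mE.mul ((mp.mul mp).const_mul _)
  have b1 := hEb (hcm √2 hsum)
  have b2 := hEb (hcm (1 / 2) hpp)
  obtain ⟨τ₁, hτ₁, h1⟩ := exists_abs_kconv_slab_oscillation_le hκ m1 b1 t1 hSI hSae
    (show 0 < δ / 2 by positivity)
  obtain ⟨τ₂, hτ₂, h2⟩ := exists_abs_kconv_slab_oscillation_le hκ m2 b2 t2 hSI hSae
    (show 0 < δ / 2 by positivity)
  obtain ⟨τ, hτ, hττ⟩ := exists_between (lt_min hτ₁ hτ₂)
  obtain ⟨hττ₁, hττ₂⟩ := lt_min_iff.1 hττ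
  -- The frequency is chosen so that τ is the half-period of sin(rt); the half-period of cos(2rt) is
  -- τ/2, which is also below its threshold.
  set r := Real.pi / τ with hr
  have h1 := h1 τ hτ hττ₁ (fun s => Real.sin (r * s)) (by fun_prop) (fun s => Real.abs_sin_le_one _)
    fun s => by
      rw [mul_add, hr, div_mul_cancel₀ _ hτ.ne', Real.sin_add_pi]
  have h2 := h2 (τ / 2) (by positivity) (by linarith) (fun s => Real.cos (2 * (r * s)))
    (by fun_prop) (fun s => Real.abs_cos_le_one _) fun s => by
      rw [← Real.cos_add_pi]
      congr 1
      rw [hr]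
      field_simp
  have hs : BddC1x (fun z => √2 * Real.sin (r * z.1)) (fun _ => 0) :=
    BddC1x.of_time (c := fun t => √2 * Real.sin (r * t)) (by fun_prop) (C := √2) fun t => by
      rw [abs_mul, abs_of_nonneg (Real.sqrt_nonneg 2)]
      exact mul_le_of_le_one_right (Real.sqrt_nonneg 2) (Real.abs_sin_le_one _)
  have hk := hs.mul hp.c1
  have hk' := hs.mul hp.c2
  simp only [zero_mul, zero_add] at hk hk'
  have hb := (hp.c1.mul hp.c1).const_mul (1 / 2)
  have h22 : √2 * √2 = 2 := Real.mul_self_sqrt (by norm_num)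
  -- By (√2 sin)² = 1 − cos of the double angle, the mean of the quadratic flux is p²/2. It cancels
  -- the flux of the added force p∂_xp, and only purely oscillating terms of frequencies r and 2r
  -- remain.
  have hsplit : perturbSource μ T lam U (fun _ => 0) (fun _ => 0)
      (fun z => √2 * Real.sin (r * z.1) * p z) (fun z => √2 * Real.sin (r * z.1) * p' z)
      (fun z => 1 / 2 * (p z * p z)) = fun w =>
        (Real.sin (r * w.1) * (slab T).indicator (fun z => Real.exp (-(lam * |z.1|)) *
          (√2 * (μ * p' z + -1 * (p z * U z)))) w) +
        (Real.cos (2 * (r * w.1)) * (slab T).indicator (fun z => Real.exp (-(lam * |z.1|)) *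
          (1 / 2 * (p z * p z))) w) := by
    funext w
    by_cases hw : w ∈ slab T
    · have hw0 : |w.1| = w.1 := abs_of_nonneg (mem_slab.1 hw).1
      simp only [perturbSource, Set.indicator_of_mem hw, hw0]
      rw [Real.cos_two_mul']
      have h3 := Real.sin_sq_add_cos_sq (r * w.1)
      linear_combination (Real.exp (-(lam * w.1)) * (p w) ^ 2 / 2) *
        (-(Real.sin (r * w.1)) ^ 2 * h22 - h3)
    · simp only [perturbSource, Set.indicator_of_notMem hw, mul_zero, add_zero]
  have hmul : ∀ {e : ℝ → ℝ} {F : ℝ × ℝ → ℝ} {K : ℝ}, (∀ s, |e s| ≤ 1) → (∀ z, |F z| ≤ K) →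
      ∀ z : ℝ × ℝ, |e z.1 * (slab T).indicator F z| ≤ K := fun {e F K} he hF z => by
    by_cases hz : z ∈ slab T
    · rw [Set.indicator_of_mem hz, abs_mul]
      exact (mul_le_mul (he _) (hF z) (abs_nonneg _) zero_le_one).trans_eq (one_mul _)
    · rw [Set.indicator_of_notMem hz, mul_zero, abs_zero]
      exact (abs_nonneg _).trans (hF 0)
  obtain ⟨w, hwc, hwε, hsol⟩ := hpert hf hu₀ BddC1x.zero BddC1x.zero hk hk' hb
    (fun z hz => by
      rw [abs_mul, abs_mul, abs_of_nonneg (Real.sqrt_nonneg 2)]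
      have e1 : √2 * |Real.sin (r * z.1)| ≤ 2 * 1 := mul_le_mul
        (Real.sqrt_le_iff.2 ⟨by norm_num, by norm_num⟩) (Real.abs_sin_le_one _) (abs_nonneg _)
        zero_le_two
      have e2 := mul_le_mul e1 (hC z) (abs_nonneg _) (by norm_num)
      linarith)
    hU (fun z => (hUM z).trans (by linarith)) hflux hu.2.1 (fun z => by
      have q1 : Measurable fun w : ℝ × ℝ => Real.sin (r * w.1) * (slab T).indicator
          (fun z => Real.exp (-(lam * |z.1|)) * (√2 * (μ * p' z + -1 * (p z * U z)))) w :=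
        (Real.measurable_sin.comp (measurable_fst.const_mul r)).mul
          (m1.indicator (measurableSet_slab T))
      have q2 : Measurable fun w : ℝ × ℝ => Real.cos (2 * (r * w.1)) * (slab T).indicator
          (fun z => Real.exp (-(lam * |z.1|)) * (1 / 2 * (p z * p z))) w :=
        (Real.measurable_cos.comp ((measurable_fst.const_mul r).const_mul 2)).mul
          (m2.indicator (measurableSet_slab T))
      rw [hsplit, kconv_add hκ q1
        (hmul (e := fun s => Real.sin (r * s)) (fun s => Real.abs_sin_le_one _) b1) q2
        (hmul (e := fun s => Real.cos (2 * (r * s))) (fun s => Real.abs_cos_le_one _) b2)]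
      refine (abs_add_le _ _).trans ?_
      linarith [h1 z, h2 z])
  refine ⟨fun t x => (√2 * Real.sin (r * t)) * ζ t x, hζ.time_mul (by fun_prop), _,
    hsol.congr (fun t ht x => ?_) (fun t ht x => by rw [hζp t ht x]), fun x => w (T, x),
    by fun_prop, hwε T ⟨hT.le, le_rfl⟩, rfl⟩
  have e : ζ t = fun x => p (t, x) := funext (hζp t ht)
  rw [e, (hp.c1.deriv t x).deriv]
  ring

/-- A control proportional to a generator of the extended space can be replaced by a control with
values in the original space. -/
theorem IsBurgersSolution.exists_of_generator (hμ : 0 < μ) (hT : 0 < T) (hu₀ : Continuous u₀)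
    (hG : ∀ w ∈ G, IsCbInf w) (hf : SlabLocallyIntegrable T f) {c ξ ξ' : ℝ → ℝ}
    (hc : ContDiffOn ℝ ∞ c (Set.Icc 0 T)) (hξ : ξ ∈ G) (hξ' : ξ' ∈ G) (hB : burgersB ξ' ∈ G)
    (hu : IsBurgersSolution μ T (fun t x => f t x + c t * (ξ x * deriv ξ' x + ξ' x * deriv ξ x))
      (fun _ _ => 0) u₀ u) {ε : ℝ} (hε : 0 < ε) :
    ∃ η, IsSmoothControl T G η ∧ ∃ u', IsBurgersSolution μ T (fun t x => f t x + η t x)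
      (fun _ _ => 0) u₀ u' ∧ ∃ w : ℝ → ℝ, Continuous w ∧ (∀ x, |w x| ≤ ε) ∧
        u' T = fun x => u T x + w x := by
  obtain ⟨M, hM0, hM⟩ := hu.exists_bound
  obtain ⟨U, V, hU, hUM, hflux⟩ := hu.exists_regularRep hM hM0
  have hflux := hflux _ _ BddC1x.zero (fun _ _ _ => rfl)
  obtain ⟨k, k', k'', kt, hk, hck, -⟩ := exists_ctrlRep_single hT hc (hG ξ hξ)
  have hξd : ∀ x, HasDerivAt ξ (deriv ξ x) x := fun x =>
    ((hG ξ hξ).1.differentiable (by simp) x).hasDerivAt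
  have hξd' : ∀ x, HasDerivAt ξ' (deriv ξ' x) x := fun x =>
    ((hG ξ' hξ').1.differentiable (by simp) x).hasDerivAt
  have hck' : ∀ t ∈ Set.Icc 0 T, ∀ x, k' (t, x) = c t * deriv ξ x := fun t ht x => by
    have h1 := hk.c1.deriv t x
    simp only [← hck t ht] at h1
    exact h1.unique ((hξd x).const_mul (c t))
  obtain ⟨C, hC⟩ := hk.c1.bdd
  have hC0 : 0 ≤ C := (abs_nonneg _).trans (hC 0)
  have hgen : SlabLocallyIntegrable T fun t x => c t * (ξ x * deriv ξ' x + ξ' x * deriv ξ x) := by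
    have c1 := hk.c1.cont
    have c2 := hk.c2.cont
    have c3 := (hG ξ' hξ').1.continuous
    have c4 := (hG ξ' hξ').deriv.1.continuous
    refine SlabLocallyIntegrable.of_continuous
      (k := fun z => k z * deriv ξ' z.2 + ξ' z.2 * k' z) (by fun_prop) fun t ht x => ?_
    simp only
    rw [← hck t ht x, hck' t ht x]
    ring
  obtain ⟨lam, hlam, δ, hδ, hpert⟩ := exists_perturbed_solution hμ hT hM0
    (show 0 < ε / 3 by positivity)
  have hκ := integrable_heatK hμ hlam
  -- The term r²c²ξ∂_xξ has flux (r²/2)(cξ)². For small r the whole convolution is small simply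
  -- because this flux is, with no oscillation needed.
  obtain ⟨r, hr, hrδ⟩ : ∃ r > 0, (∫ w, |heatK μ lam w|) * (r ^ 2 / 2 * (C * C)) ≤ δ := by
    have h0 : Tendsto (fun r : ℝ => (∫ w, |heatK μ lam w|) * (r ^ 2 / 2 * (C * C))) (𝓝[>] 0)
        (𝓝 ((∫ w, |heatK μ lam w|) * (0 ^ 2 / 2 * (C * C)))) :=
      (Continuous.tendsto (by fun_prop) 0).mono_left nhdsWithin_le_nhds
    have h1 := h0.eventually_le_const (u := δ) (by simpa using hδ)
    obtain ⟨r, hr, hr'⟩ := (h1.and self_mem_nhdsWithin).exists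
    exact ⟨r, hr', hr⟩
  have hb := (hk.c1.mul hk.c1).const_mul (-(r ^ 2 / 2))
  obtain ⟨w₁, hw₁c, hw₁ε, hsol₁⟩ := hpert (hf.add hgen) hu₀ BddC1x.zero BddC1x.zero BddC1x.zero
    BddC1x.zero hb (fun z hz => by simpa using hM0) hU hUM hflux hu.2.1 (fun z => by
      refine (abs_kconv_le hκ (C := r ^ 2 / 2 * (C * C)) (fun z => ?_) z).trans hrδ
      by_cases hz : z ∈ slab T
      · simp only [perturbSource, Set.indicator_of_mem hz, mul_zero, add_zero, sub_self, zero_mul,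
          sub_zero]
        rw [abs_mul, Real.abs_exp, abs_mul, abs_neg, abs_of_nonneg (by positivity : 0 ≤ r ^ 2 / 2),
          abs_mul]
        have h1 : Real.exp (-(lam * z.1)) ≤ 1 := Real.exp_le_one_iff.2 (by
          have := mul_nonneg hlam.le (mem_slab.1 hz).1
          linarith)
        have h2 : |k z| * |k z| ≤ C * C := mul_le_mul (hC z) (hC z) (abs_nonneg _) hC0
        calc _ ≤ 1 * (r ^ 2 / 2 * (C * C)) := mul_le_mul h1
              (mul_le_mul_of_nonneg_left h2 (by positivity)) (by positivity) zero_le_one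
          _ = _ := one_mul _
      · simp only [perturbSource, Set.indicator_of_notMem hz, abs_zero]
        positivity)
  have hsli : SlabLocallyIntegrable T fun t x =>
      f t x + c t * (ξ x * deriv ξ' x + ξ' x * deriv ξ x) +
        -(r ^ 2 / 2) * (k' (t, x) * k (t, x) + k (t, x) * k' (t, x)) :=
    (hf.add hgen).add (SlabLocallyIntegrable.of_continuous hb.cont' fun t _ x => rfl)
  -- The nonlinearity of this ζ contains minus the generator as its cross term, with the weights r⁻¹
  -- and r cancelling. Its r²-term was subtracted from the force beforehand, and its r⁻²-term is a
  -- multiple of B(ξ'), admissible however large because B(ξ') lies in `G`.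
  have hζ : IsSmoothControl T G fun t x => r⁻¹ * ξ' x + (-r * c t) * ξ x :=
    (IsSmoothControl.single (c := fun _ => r⁻¹) hξ' contDiffOn_const).add
      (IsSmoothControl.single hξ (contDiffOn_const.mul hc))
  obtain ⟨ζ', hζ', u₂, hu₂, w₂, hw₂c, hw₂ε, hw₂⟩ := hsol₁.exists_oscillating hμ hT hu₀ hG hsli hζ
    (show 0 < ε / 3 by positivity)
  have hBc : SlabLocallyIntegrable T fun _ x => (r⁻¹) ^ 2 * burgersB ξ' x :=
    SlabLocallyIntegrable.of_continuous (k := fun z => (r⁻¹) ^ 2 * burgersB ξ' z.2)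
      (by have := (hG _ hB).1.continuous; fun_prop) fun _ _ _ => rfl
  have hu₂' : IsBurgersSolution μ T (fun t x => f t x + (r⁻¹) ^ 2 * burgersB ξ' x) ζ' u₀ u₂ := by
    refine hu₂.congr (fun t ht x => ?_) fun t _ x => rfl
    have hd : deriv (fun x => r⁻¹ * ξ' x + -r * c t * ξ x) x =
        r⁻¹ * deriv ξ' x + -r * c t * deriv ξ x :=
      (((hξd' x).const_mul r⁻¹).add ((hξd x).const_mul (-r * c t))).deriv
    rw [hd, hck' t ht x,
      ← hck t ht x, burgersB]
    field_simp
    ring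
  -- The auxiliary oscillating control is removed last; each of the three approximations spends ε/3.
  obtain ⟨η, hη, u₃, hu₃, w₃, hw₃c, hw₃ε, hw₃⟩ := hu₂'.exists_of_extended hμ hT hu₀ hG
    (hf.add hBc) hζ' (show 0 < ε / 3 by positivity)
  refine ⟨fun t x => (r⁻¹) ^ 2 * burgersB ξ' x + η t x,
    (IsSmoothControl.single (c := fun _ => (r⁻¹) ^ 2) hB contDiffOn_const).add hη, u₃,
    hu₃.congr (fun t _ x => by ring) fun _ _ _ => rfl,
    fun x => w₁ (T, x) + w₂ x + w₃ x, by fun_prop, fun x => ?_, ?_⟩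
  · have := (abs_add_three (w₁ (T, x)) (w₂ x) (w₃ x))
    linarith [hw₁ε T ⟨hT.le, le_rfl⟩ x, hw₂ε x, hw₃ε x]
  · rw [hw₃, hw₂]
    funext x
    ring

end Oscillation

/-! ### Replacing controls with values in the extended space -/

section Reduction

variable {μ T : ℝ} {u₀ : ℝ → ℝ} {G : Submodule ℝ (ℝ → ℝ)}

/-- The force `η` can be replaced by a control with values in `G`, with a small error at the final
time, whatever the other forces are. -/
def IsReplaceable (μ T : ℝ) (u₀ : ℝ → ℝ) (G : Submodule ℝ (ℝ → ℝ)) (η : ℝ → ℝ → ℝ) : Prop :=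
  SlabLocallyIntegrable T η ∧ ∀ (f u : ℝ → ℝ → ℝ), SlabLocallyIntegrable T f →
    IsBurgersSolution μ T (fun t x => f t x + η t x) (fun _ _ => 0) u₀ u → ∀ ε > 0,
      ∃ η', IsSmoothControl T G η' ∧ ∃ u', IsBurgersSolution μ T (fun t x => f t x + η' t x)
        (fun _ _ => 0) u₀ u' ∧ ∃ w : ℝ → ℝ, Continuous w ∧ (∀ x, |w x| ≤ ε) ∧
          u' T = fun x => u T x + w x

theorem IsSmoothControl.slabLocallyIntegrable (hT : 0 < T) (hG : ∀ w ∈ G, IsCbInf w)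
    {η : ℝ → ℝ → ℝ} (h : IsSmoothControl T G η) : SlabLocallyIntegrable T η := by
  obtain ⟨k, k', k'', kt, hk, hηk, -⟩ := h.exists_ctrlRep hT hG
  exact SlabLocallyIntegrable.of_continuous hk.c1.cont hηk

theorem IsSmoothControl.isReplaceable (hT : 0 < T) (hG : ∀ w ∈ G, IsCbInf w)
    {η : ℝ → ℝ → ℝ} (h : IsSmoothControl T G η) : IsReplaceable μ T u₀ G η :=
  ⟨h.slabLocallyIntegrable hT hG, fun f u _ hu ε hε => ⟨η, h, u, hu, fun _ => 0,
    continuous_const, fun x => by simpa using hε.le, by simp⟩⟩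

theorem IsReplaceable.congr {a b : ℝ → ℝ → ℝ} (ha : IsReplaceable μ T u₀ G a)
    (hab : ∀ t ∈ Set.Icc 0 T, ∀ x, b t x = a t x) : IsReplaceable μ T u₀ G b := by
  refine ⟨fun φ hφ => (ha.1 φ hφ).congr_fun (fun z hz => ?_) (measurableSet_slab T),
    fun f u hf hu => ha.2 f u hf (hu.congr (fun t ht x => by rw [hab t ht x]) fun _ _ _ => rfl)⟩
  simp only [hab z.1 (mem_slab.1 hz)]

/-- The two summands are replaced in turn. Replaceability is required for every background force so
that first b and then the control already found for a can be counted in it. -/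
theorem IsReplaceable.add (hT : 0 < T) (hG : ∀ w ∈ G, IsCbInf w) {a b : ℝ → ℝ → ℝ}
    (ha : IsReplaceable μ T u₀ G a) (hb : IsReplaceable μ T u₀ G b) :
    IsReplaceable μ T u₀ G fun t x => a t x + b t x := by
  refine ⟨ha.1.add hb.1, fun f u hf hu ε hε => ?_⟩
  obtain ⟨η₁, hη₁, u₁, hu₁, w₁, hw₁c, hw₁ε, hw₁⟩ := ha.2 (fun t x => f t x + b t x) u
    (hf.add hb.1) (hu.congr (fun t _ x => by ring) fun _ _ _ => rfl) (ε / 2) (by positivity)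
  obtain ⟨η₂, hη₂, u₂, hu₂, w₂, hw₂c, hw₂ε, hw₂⟩ := hb.2 (fun t x => f t x + η₁ t x) u₁
    (hf.add (hη₁.slabLocallyIntegrable hT hG))
    (hu₁.congr (fun t _ x => by ring) fun _ _ _ => rfl) (ε / 2) (by positivity)
  refine ⟨fun t x => η₁ t x + η₂ t x, hη₁.add hη₂, u₂,
    hu₂.congr (fun t _ x => by ring) fun _ _ _ => rfl, fun x => w₁ x + w₂ x, by fun_prop,
    fun x => ?_, ?_⟩
  · exact (abs_add_le _ _).trans (by linarith [hw₁ε x, hw₂ε x])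
  · rw [hw₂, hw₁]
    funext x
    ring

theorem isReplaceable_of_extendedSpace (hμ : 0 < μ) (hT : 0 < T) (hu₀ : Continuous u₀)
    (hG : ∀ w ∈ G, IsCbInf w) {N : Set (ℝ → ℝ)} (hNG : ∀ ξ ∈ N, ξ ∈ G)
    (hBN : ∀ ξ ∈ N, burgersB ξ ∈ G) {η : ℝ → ℝ → ℝ}
    (h : IsSmoothControl T (extendedSpace N G) η) : IsReplaceable μ T u₀ G η := by
  refine IsSmoothControl.induction (P := IsReplaceable μ T u₀ G)
    (IsSmoothControl.zero.isReplaceable hT hG) (fun c e hc he => ?_)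
    (fun a b ha hb => ha.add hT hG hb) (fun a b ha hab => ha.congr hab) h
  clear h
  revert c
  -- The coefficient c is quantified inside the induction hypothesis, so that scalar multiples are
  -- absorbed into it.
  refine Submodule.span_induction (p := fun e _ => ∀ c : ℝ → ℝ, ContDiffOn ℝ ∞ c (Set.Icc 0 T) →
    IsReplaceable μ T u₀ G fun t x => c t * e x) ?_ ?_ ?_ ?_ he
  · rintro _ ⟨η, hη, ξ, hξ, ξ', hξ', rfl⟩ c hc
    have h1 : IsReplaceable μ T u₀ G fun t x => c t * η x :=
      (IsSmoothControl.single hη hc).isReplaceable hT hG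
    have h2 : IsReplaceable μ T u₀ G
        fun t x => c t * (ξ x * deriv ξ' x + ξ' x * deriv ξ x) := by
      refine ⟨?_, fun f u hf hu ε hε => hu.exists_of_generator hμ hT hu₀ hG hf hc hξ (hNG _ hξ')
        (hBN _ hξ') hε⟩
      obtain ⟨k, k', k'', kt, hk, hck, -⟩ := exists_ctrlRep_single hT hc (hG ξ hξ)
      have c1 := hk.c1.cont
      have c2 := hk.c2.cont
      have c3 := (hG _ (hNG _ hξ')).1.continuous
      have c4 := (hG _ (hNG _ hξ')).deriv.1.continuous
      refine SlabLocallyIntegrable.of_continuous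
        (k := fun z => k z * deriv ξ' z.2 + ξ' z.2 * k' z) (by fun_prop) fun t ht x => ?_
      have hd := hk.c1.deriv t x
      simp only [← hck t ht] at hd
      simp only
      rw [← hck t ht x, hd.unique
        ((((hG ξ hξ).1.differentiable (by simp) x).hasDerivAt).const_mul (c t))]
      ring
    exact (h1.add hT hG h2).congr fun t _ x => by ring
  · intro c _
    exact (IsSmoothControl.zero.isReplaceable hT hG).congr fun t _ x => by simp
  · intro e e' _ _ he he' c hc
    exact ((he c hc).add hT hG (he' c hc)).congr fun t _ x => by simp [mul_add]
  · intro r e _ he c hc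
    exact (he (fun t => c t * r) (hc.mul contDiffOn_const)).congr fun t _ x => by
      simp [mul_assoc]

end Reduction

/-! ### Stability of the terminal inequalities -/

section Target

theorem ReachesTarget.mono {uhat w : ℝ → ℝ} {ε r K K' : ℝ} (hK : K ≤ K')
    (h : ReachesTarget uhat ε r K w) : ReachesTarget uhat ε r K' w :=
  ⟨h.1.trans (ENNReal.ofReal_le_ofReal hK), h.2⟩

/-- The terminal inequalities are stable under small perturbations. -/
theorem ReachesTarget.exists_perturbation {uhat v : ℝ → ℝ} {ε r K K' : ℝ} (hK : 0 ≤ K)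
    (hKK' : K < K') (huhat : Continuous uhat) (h : ReachesTarget uhat ε r K v) :
    ∃ δ > 0, ∀ w : ℝ → ℝ, Continuous w → (∀ x, |w x| ≤ δ) →
      ReachesTarget uhat ε r K' fun x => v x + w x := by
  obtain ⟨h1, h2⟩ := h
  have hv : LocallyIntegrable v volume := locallyIntegrable_of_hulNorm_ne_top (s := 0)
    ((le_self_add.trans h1).trans_lt ENNReal.ofReal_lt_top).ne
  have hsm : AEStronglyMeasurable (fun x => v x - uhat x) (volume.restrict (Set.Icc (-r) r)) :=
    (hv.aestronglyMeasurable.sub huhat.aestronglyMeasurable).restrict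
  set A := eLpNorm (fun x => v x - uhat x) 2 (volume.restrict (Set.Icc (-r) r)) with hA
  set m : ℝ≥0∞ := (volume.restrict (Set.Icc (-r) r)) Set.univ ^ ((2 : ℝ≥0∞).toReal⁻¹) with hm
  have hmfin : m ≠ ⊤ := ENNReal.rpow_ne_top_of_nonneg (by positivity) (by simp)
  -- The strict inequality with ε leaves room for the perturbation, whose L² norm on the interval is
  -- at most δ times m. In the other inequality both norms grow by at most δ, hence δ < (K' − K)/2.
  have hlim : Tendsto (fun δ : ℝ => A + m * ENNReal.ofReal δ) (𝓝[>] 0)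
      (𝓝 (A + m * ENNReal.ofReal 0)) :=
    (((ENNReal.continuous_const_mul hmfin).comp ENNReal.continuous_ofReal).const_add A
      |>.tendsto 0).mono_left nhdsWithin_le_nhds
  have hev := hlim.eventually_lt_const (u := ENNReal.ofReal ε) (by simpa using h2)
  have hev2 : ∀ᶠ δ : ℝ in 𝓝[>] 0, δ < (K' - K) / 2 :=
    (eventually_lt_nhds (by linarith : (0 : ℝ) < (K' - K) / 2)).filter_mono nhdsWithin_le_nhds
  obtain ⟨δ, ⟨hδ1, hδ2⟩, hδ⟩ := ((hev.and hev2).and self_mem_nhdsWithin).exists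
  have hδ : 0 < δ := hδ
  refine ⟨δ, hδ, fun w hwc hw => ⟨?_, ?_⟩⟩
  · have hwl : LocallyIntegrable w volume := hwc.locallyIntegrable
    have e1 : hulNorm 0 (fun x => v x + w x) ≤ hulNorm 0 v + ENNReal.ofReal δ :=
      (hulNorm_zero_add_le hwl).trans (add_le_add le_rfl (hulNorm_zero_le hwl hw))
    have e2 : eLpNorm (fun x => v x + w x) ⊤ volume ≤ eLpNorm v ⊤ volume + ENNReal.ofReal δ := by
      refine (eLpNorm_add_le hv.aestronglyMeasurable hwc.aestronglyMeasurable le_top).trans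
        (add_le_add le_rfl ?_)
      rw [eLpNorm_exponent_top]
      exact eLpNormEssSup_le_of_ae_bound (ae_of_all _ hw)
    calc _ ≤ (hulNorm 0 v + ENNReal.ofReal δ) + (eLpNorm v ⊤ volume + ENNReal.ofReal δ) :=
          add_le_add e1 e2
      _ = (hulNorm 0 v + eLpNorm v ⊤ volume) + (ENNReal.ofReal δ + ENNReal.ofReal δ) :=
          add_add_add_comm _ _ _ _
      _ ≤ ENNReal.ofReal K + (ENNReal.ofReal δ + ENNReal.ofReal δ) := add_le_add h1 le_rfl
      _ ≤ ENNReal.ofReal K' := by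
          rw [← ENNReal.ofReal_add hδ.le hδ.le, ← ENNReal.ofReal_add hK (by positivity)]
          exact ENNReal.ofReal_le_ofReal (by linarith)
  · have e : (fun x => v x + w x - uhat x) = (fun x => v x - uhat x) + w := by
      funext x; simp only [Pi.add_apply]; ring
    rw [e]
    refine ((eLpNorm_add_le hsm hwc.aestronglyMeasurable (by norm_num)).trans
      (add_le_add le_rfl (eLpNorm_le_of_ae_bound (ae_of_all _ hw)))).trans_lt hδ1

end Target

/-! ### The implications between the controllability properties -/

section Equivalence

variable {μ T : ℝ} {h : ℝ → ℝ → ℝ} {u₀ uhat : ℝ → ℝ} {G G' : Submodule ℝ (ℝ → ℝ)}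
  {N : Set (ℝ → ℝ)} {ε r K K' : ℝ}

theorem BurgersControllable.mono (hG : G ≤ G') (hK : K ≤ K')
    (hc : BurgersControllable μ T h u₀ uhat G ε r K) :
    BurgersControllable μ T h u₀ uhat G' ε r K' := by
  obtain ⟨η, hη, u, hu, hr⟩ := hc
  exact ⟨η, hη.mono hG, u, hu, hr.mono hK⟩

theorem BurgersControllable.extended (hc : BurgersControllable μ T h u₀ uhat G ε r K) :
    ExtendedControllable μ T h u₀ uhat G ε r K := by
  obtain ⟨η, hη, u, hu, hr⟩ := hc
  exact ⟨η, _, hη, IsSmoothControl.zero, u, hu, hr⟩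

theorem ExtendedControllable.burgers (hμ : 0 < μ) (hT : 0 < T) (hh : MemLpHul 2 0 T h)
    (hu₀ : Continuous u₀) (huhat : Continuous uhat) (hG : ∀ w ∈ G, IsCbInf w) (hK : 0 ≤ K)
    (hKK' : K < K') (hc : ExtendedControllable μ T h u₀ uhat G ε r K) :
    BurgersControllable μ T h u₀ uhat G ε r K' := by
  obtain ⟨η, ζ, hη, hζ, u, hu, hr⟩ := hc
  obtain ⟨δ, hδ, hpert⟩ := hr.exists_perturbation hK hKK' huhat
  obtain ⟨η', hη', u', hu', w, hwc, hw, e⟩ := hu.exists_of_extended hμ hT hu₀ hG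
    ((slabLocallyIntegrable_of_memLpHul hh).add (hη.slabLocallyIntegrable hT hG)) hζ hδ
  refine ⟨fun t x => η t x + η' t x, hη.add hη', u',
    hu'.congr (fun t _ x => by ring) fun _ _ _ => rfl, ?_⟩
  rw [e]
  exact hpert w hwc hw

theorem BurgersControllable.of_extendedSpace (hμ : 0 < μ) (hT : 0 < T) (hh : MemLpHul 2 0 T h)
    (hu₀ : Continuous u₀) (huhat : Continuous uhat) (hG : ∀ w ∈ G, IsCbInf w)
    (hNG : ∀ ξ ∈ N, ξ ∈ G) (hBN : ∀ ξ ∈ N, burgersB ξ ∈ G) (hK : 0 ≤ K) (hKK' : K < K')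
    (hc : BurgersControllable μ T h u₀ uhat (extendedSpace N G) ε r K) :
    BurgersControllable μ T h u₀ uhat G ε r K' := by
  obtain ⟨η, hη, u, hu, hr⟩ := hc
  obtain ⟨δ, hδ, hpert⟩ := hr.exists_perturbation hK hKK' huhat
  obtain ⟨η', hη', u', hu', w, hwc, hw, e⟩ := (isReplaceable_of_extendedSpace hμ hT hu₀ hG hNG hBN
    hη).2 h u (slabLocallyIntegrable_of_memLpHul hh) hu δ hδ
  refine ⟨η', hη', u', hu', ?_⟩
  rw [e]
  exact hpert w hwc hw

theorem le_extendedSpace (hN : N.Nonempty) : G ≤ extendedSpace N G := by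
  intro η hη
  obtain ⟨ξ', hξ'⟩ := hN
  -- With ξ = 0 the generator is η itself; an element of `N` is needed only to fill the remaining
  -- slot.
  refine Submodule.subset_span ⟨η, hη, 0, G.zero_mem, ξ', hξ', ?_⟩
  funext x
  simp

end Equivalence

theorem proposition2p5
    (μ T : ℝ) (hμ : 0 < μ) (hT : 0 < T)
    (h : ℝ → ℝ → ℝ) (hh : ∀ s : ℕ, MemLpHul 2 s T h)
    (u₀ uhat : ℝ → ℝ) (hu₀ : IsCbInf u₀) (huhat : IsCbInf uhat)
    (G : Submodule ℝ (ℝ → ℝ)) (hGfin : FiniteDimensional ℝ G) (hG : ∀ w ∈ G, IsCbInf w)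
    (N : Set (ℝ → ℝ)) (hNne : N.Nonempty)
    (hNscale : ∀ c : ℝ, ∀ ξ ∈ N, c • ξ ∈ N)
    (hNG : ∀ ξ ∈ N, ξ ∈ G) (hBN : ∀ ξ ∈ N, burgersB ξ ∈ G) :
    -- for fixed `ε`, `r`: the two equivalences
    (∀ ε r : ℝ, 0 < ε → 0 < r →
      ((∃ K > 0, ExtendedControllable μ T h u₀ uhat G ε r K) ↔
        (∃ K > 0, BurgersControllable μ T h u₀ uhat (extendedSpace N G) ε r K)) ∧
      ((∃ K > 0, BurgersControllable μ T h u₀ uhat G ε r K) ↔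
        (∃ K > 0, BurgersControllable μ T h u₀ uhat (extendedSpace N G) ε r K))) ∧
    -- the same equivalences with a bound constant independent of `ε`, `r`
    ((∃ K > 0, ∀ ε r : ℝ, 0 < ε → 0 < r → ExtendedControllable μ T h u₀ uhat G ε r K) ↔
      (∃ K > 0, ∀ ε r : ℝ, 0 < ε → 0 < r →
        BurgersControllable μ T h u₀ uhat (extendedSpace N G) ε r K)) ∧
    ((∃ K > 0, ∀ ε r : ℝ, 0 < ε → 0 < r → BurgersControllable μ T h u₀ uhat G ε r K) ↔
      (∃ K > 0, ∀ ε r : ℝ, 0 < ε → 0 < r →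
        BurgersControllable μ T h u₀ uhat (extendedSpace N G) ε r K)) ∧
    -- the bound constants can be taken arbitrarily close to each other
    (∀ ε r K K' : ℝ, 0 < ε → 0 < r → 0 < K → K < K' →
      (ExtendedControllable μ T h u₀ uhat G ε r K →
        BurgersControllable μ T h u₀ uhat (extendedSpace N G) ε r K') ∧
      (BurgersControllable μ T h u₀ uhat (extendedSpace N G) ε r K →
        ExtendedControllable μ T h u₀ uhat G ε r K') ∧
      (BurgersControllable μ T h u₀ uhat G ε r K →
        BurgersControllable μ T h u₀ uhat (extendedSpace N G) ε r K') ∧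
      (BurgersControllable μ T h u₀ uhat (extendedSpace N G) ε r K →
        BurgersControllable μ T h u₀ uhat G ε r K')) := by
  have c0 := hu₀.1.continuous
  have c1 := huhat.1.continuous
  have hle := le_extendedSpace (G := G) hNne
  -- Only these two implications lose anything in the constant. The loss does not depend on ε and r,
  -- so the choice K' = K + 1 also settles the uniform versions.
  have main : ∀ ε r K K' : ℝ, 0 < K → K < K' →
      (ExtendedControllable μ T h u₀ uhat G ε r K →
        BurgersControllable μ T h u₀ uhat (extendedSpace N G) ε r K') ∧
      (BurgersControllable μ T h u₀ uhat (extendedSpace N G) ε r K →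
        BurgersControllable μ T h u₀ uhat G ε r K') := fun ε r K K' hK hKK' =>
    ⟨fun hc => (hc.burgers hμ hT (hh 0) c0 c1 hG hK.le hKK').mono hle le_rfl,
      fun hc => hc.of_extendedSpace hμ hT (hh 0) c0 c1 hG hNG hBN hK.le hKK'⟩
  refine ⟨fun ε r _ _ => ⟨⟨?_, ?_⟩, ⟨?_, ?_⟩⟩, ⟨?_, ?_⟩, ⟨?_, ?_⟩,
    fun ε r K K' _ _ hK hKK' => ⟨(main ε r K K' hK hKK').1,
      fun hc => ((main ε r K K' hK hKK').2 hc).extended, fun hc => hc.mono hle hKK'.le,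
      (main ε r K K' hK hKK').2⟩⟩
  · rintro ⟨K, hK, hc⟩
    exact ⟨K + 1, by positivity, (main ε r K _ hK (lt_add_one K)).1 hc⟩
  · rintro ⟨K, hK, hc⟩
    exact ⟨K + 1, by positivity, ((main ε r K _ hK (lt_add_one K)).2 hc).extended⟩
  · rintro ⟨K, hK, hc⟩
    exact ⟨K, hK, hc.mono hle le_rfl⟩
  · rintro ⟨K, hK, hc⟩
    exact ⟨K + 1, by positivity, (main ε r K _ hK (lt_add_one K)).2 hc⟩
  · rintro ⟨K, hK, hc⟩
    exact ⟨K + 1, by positivity, fun ε r hε hr =>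
      (main ε r K _ hK (lt_add_one K)).1 (hc ε r hε hr)⟩
  · rintro ⟨K, hK, hc⟩
    exact ⟨K + 1, by positivity, fun ε r hε hr =>
      ((main ε r K _ hK (lt_add_one K)).2 (hc ε r hε hr)).extended⟩
  · rintro ⟨K, hK, hc⟩
    exact ⟨K, hK, fun ε r hε hr => (hc ε r hε hr).mono hle le_rfl⟩
  · rintro ⟨K, hK, hc⟩
    exact ⟨K + 1, by positivity, fun ε r hε hr =>
      (main ε r K _ hK (lt_add_one K)).2 (hc ε r hε hr)⟩
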